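/- **Setting.** Fix $r\in\mathbb R$ and $S_0,\sigma_0^2,\lambda,T,K>0$ (the "market parameters"), $a,b>0$ and $\rho\le 0$. Let $Z$ be a Lévy subordinator, with $\kappa(\theta)=\ln E[e^{\theta Z_1}]$, and let $\sigma^2$ solve $d\sigma_t^2=-\lambda\sigma_t^2\,dt+dZ_{\lambda t}$ with deterministic start $\sigma_0^2$. Assume that $\sigma^2$ is an inverse Gaussian Ornstein–Uhlenbeck process, i.e. that the stationary distribution of this equation is the law $IG(a,b)$ with density $\frac{a}{\sqrt{2\pi}}e^{ab}x^{-3/2}e^{-\frac12(a^2/x+b^2x)}$ on $(0,\infty)$. Put $I_T=\int_0^T\sigma_s^2\,ds$ and $P_T=e^{\rho Z_{\lambda T}-\lambda T\kappa(\rho)}$, let $$BS(x,y)=Ke^{-rT}\Phi(-d_-)-x\Phi(-d_+),\qquad d_\pm=\tfrac1{\sqrt y}\left(\ln\tfrac xK+rT\pm\tfrac12y\right)$$ be the Black–Scholes put price, and for $i,j\ge0$, $u\in(0,1)$ write $$D_{(i,j)}(u)=\frac{\partial^{i+j}BS}{\partial x^i\partial y^j}\big((1-u)S_0+uP_TS_0,\,(1-u)E[I_T]+uI_T\big).$$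 The remainder of the $N$-th order Taylor approximation of the put price is $$R_N=\frac1{N!}\sum_{n=0}^{N+1}\binom{N+1}nS_0^{N+1-n}E\left[(P_T-1)^{N+1-n}(I_T-E[I_T])^n\int_0^1(1-u)^ND_{(N+1-n,n)}(u)\,du\right].$$ For $n\ge1$ let $G_n=E\big[\big(-\lambda T\kappa(\rho)(\tfrac12e^{-\lambda T\kappa(\rho)}+\tfrac12)+|\rho|Z_{\lambda T}\big)^n\big]$. **Claim.** There are polynomials $f_n$ (in 4 variables) and $g_n$ (in 6 variables) with non-negative coefficients, not depending on any parameter, and finite constants $M^*_{(i,j)}\ge0$ depending only on $(i,j)$ and the market parameters (not on $a,b,\rho$), such that the following hold. 1. For all $n\ge1$ the moments below are finite and $$\big|E[(I_T-E[I_T])^n]\big|\le\frac{aT}{\lambda b^{n+1}}f_n\big(a,\tfrac1\lambda,\tfrac1b,T\big),\qquad G_n\le\frac{a\lambda T|\rho|}{b^n}g_n\big(a,\lambda,\tfrac1b,T,|\rho|,e^{-\lambda T\kappa(\rho)}\big).$$ 2. Let $N\ge2$. All expectations in $R_N$ exist. If $M_{(N+1-n,n)}$, $0\le n\le N+1$,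 are real numbers such that almost surely $\sup_{u\in(0,1)}|D_{(N+1-n,n)}(u)|\le M_{(N+1-n,n)}$, then, with $f_n,g_n$ evaluated as in 1, $$|R_N|\le\frac{\sqrt{aT}}{b^{N+1}(N+1)!}\Big(\sum_{n=1}^N\binom{N+1}nS_0^{N+1-n}M_{(N+1-n,n)}\sqrt{\tfrac{aT|\rho|}b\,g_{2N+2-2n}f_{2n}}+M_{(0,N+1)}\sqrt{\tfrac1{b^2\lambda}f_{2N+2}}+S_0^{N+1}M_{(N+1,0)}\sqrt{\lambda|\rho|g_{2N+2}}\Big).\tag{$*$}$$ 3. For every $N\ge2$ the bound $(*)$ holds also with $M=M^*$, and these constants satisfy almost surely $(N+1)\int_0^1(1-u)^N|D_{(N+1-n,n)}(u)|\,du\le M^*_{(N+1-n,n)}$ for $0\le n\le N+1$. 4. If $\rho=0$ and $N\ge2$, then almost surely $\sup_{u\in(0,1)}|D_{(N+1-n,n)}(u)|\le M^*_{(N+1-n,n)}$ for $0\le n\le N+1$, and for every $M_{(0,N+1)}$ such that almost surely $\sup_{u\in(0,1)}|D_{(0,N+1)}(u)|\le M_{(0,N+1)}$, $$|R_N|\le\frac1{(N+1)!}\,\frac{aT}{\lambda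 b^{N+2}}\,f_{N+1}\big(a,\tfrac1\lambda,\tfrac1b,T\big)\,M_{(0,N+1)}.$$ 5. For fixed market parameters, $a$, $\rho\le0$, $N\ge2$ and $b_0>0$ there is a constant $C$ with $|R_N|\le C/b^{N+1}$ for all $b\ge b_0$, and, if $\rho=0$, $|R_N|\le C/b^{N+2}$ for all $b\ge b_0$. -/

import Mathlib

open MeasureTheory ProbabilityTheory Set
open scoped NNReal ENNReal Nat

noncomputable section

namespace BNS

/-- A (Lévy) subordinator: a process on `[0, ∞)` with independent and stationary increments that
starts at `0` and whose paths are almost surely non-decreasing and right-continuous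
(left limits exist by monotonicity). -/
structure IsSubordinator {Ω : Type*} [MeasurableSpace Ω] (Q : Measure Ω) (Z : ℝ≥0 → Ω → ℝ) :
    Prop where
  measurable : ∀ t, Measurable (Z t)
  start : ∀ᵐ ω ∂Q, Z 0 ω = 0
  indep : HasIndepIncrements Z Q
  stationary : ∀ s h : ℝ≥0, IdentDistrib (fun ω => Z (s + h) ω - Z s ω) (Z h) Q Q
  mono : ∀ᵐ ω ∂Q, Monotone fun t => Z t ω
  rightCont : ∀ᵐ ω ∂Q, ∀ t, ContinuousWithinAt (fun s => Z s ω) (Ici t) t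

/-- `V` (the process `σ²`) solves `dV_t = -lam V_t dt + dZ_{lam t}`, `V_0 = v₀`, on `[0, ∞)`.
All paths have finite variation, so this is the integral equation along almost every path. -/
def IsOUSolution {Ω : Type*} [MeasurableSpace Ω] (Q : Measure Ω) (lam v₀ : ℝ)
    (Z : ℝ≥0 → Ω → ℝ) (V : ℝ → Ω → ℝ) : Prop :=
  ∀ᵐ ω ∂Q, ∀ t : ℝ, 0 ≤ t →
    IntervalIntegrable (fun s => V s ω) volume 0 t ∧
    V t ω = v₀ - lam * (∫ s in (0 : ℝ)..t, V s ω) + Z (lam * t).toNNReal ω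

/-- The inverse Gaussian law `IG(a, b)`, with density
`a / √(2π) * e^{ab} * x^{-3/2} * exp (-(a² / x + b² x) / 2)` on `(0, ∞)`
(its cumulant generating function is `a (b - √(b² - 2θ))`). -/
def inverseGaussian (a b : ℝ) : Measure ℝ :=
  (volume.restrict (Ioi 0)).withDensity fun x =>
    ENNReal.ofReal (a / √(2 * Real.pi) * Real.exp (a * b) * x ^ (-(3 / 2) : ℝ) *
      Real.exp (-(a ^ 2 / x + b ^ 2 * x) / 2))

/-- `D` is a stationary distribution of the Ornstein-Uhlenbeck dynamics solved by `V` from `v₀`.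
The solution from a general start `v` is `e^{-lam t} v + (V_t - e^{-lam t} v₀)`; if `v` has law `D`
and is independent of the driving process, then the law at every time `t ≥ 0` is again `D`. -/
def IsStationaryLaw {Ω : Type*} [MeasurableSpace Ω] (Q : Measure Ω) (lam v₀ : ℝ)
    (V : ℝ → Ω → ℝ) (D : Measure ℝ) : Prop :=
  ∀ t : ℝ, 0 ≤ t →
    (D.map fun v => Real.exp (-(lam * t)) * v).conv
      (Q.map fun ω => V t ω - Real.exp (-(lam * t)) * v₀) = D

/-- The parameters that do not concern the law of the driving process, nor the correlation:
interest rate `r`, initial price `S₀`, initial variance `v₀`, mean reversion rate `lam`,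
expiration date `T` and strike `K`. -/
structure Market where
  r : ℝ
  S₀ : ℝ
  v₀ : ℝ
  lam : ℝ
  T : ℝ
  K : ℝ
  S₀_pos : 0 < S₀
  v₀_pos : 0 < v₀
  lam_pos : 0 < lam
  T_pos : 0 < T
  K_pos : 0 < K

/-- The variance `V` is an inverse Gaussian Ornstein-Uhlenbeck process with parameters `a`, `b`,
driven by the subordinator `Z`. -/
structure IsIGOU {Ω : Type*} [MeasurableSpace Ω] (Q : Measure Ω) (m : Market) (a b : ℝ)
    (Z : ℝ≥0 → Ω → ℝ) (V : ℝ → Ω → ℝ) : Prop where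
  a_pos : 0 < a
  b_pos : 0 < b
  subordinator : IsSubordinator Q Z
  solution : IsOUSolution Q m.lam m.v₀ Z V
  stationaryLaw : IsStationaryLaw Q m.lam m.v₀ V (inverseGaussian a b)

/-- Distribution function of the standard normal law. -/
def stdNormalCdf (z : ℝ) : ℝ := cdf (gaussianReal 0 1) z

def dPlus (m : Market) (x y : ℝ) : ℝ := (Real.log (x / m.K) + m.r * m.T + y / 2) / √y

def dMinus (m : Market) (x y : ℝ) : ℝ := (Real.log (x / m.K) + m.r * m.T - y / 2) / √y

/-- Black-Scholes put price as a function of the spot `x` and the integrated variance `y`. -/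
def bsPut (m : Market) (x y : ℝ) : ℝ :=
  m.K * Real.exp (-(m.r * m.T)) * stdNormalCdf (-dMinus m x y) - x * stdNormalCdf (-dPlus m x y)

/-- The partial derivative `∂^{i+j} BS / ∂x^i ∂y^j` at `(x, y)`. -/
def bsPutDeriv (m : Market) (i j : ℕ) (x y : ℝ) : ℝ :=
  iteratedDeriv i (fun x' => iteratedDeriv j (fun y' => bsPut m x' y') y) x

section Model

variable {Ω : Type*} [MeasurableSpace Ω] (Q : Measure Ω) (m : Market) (ρ : ℝ)
  (Z : ℝ≥0 → Ω → ℝ) (V : ℝ → Ω → ℝ)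

/-- `κ(ρ)`, where `κ` is the cumulant generating function of `Z_1`. -/
def kappa : ℝ := cgf (Z 1) Q ρ

/-- `P_T = exp (ρ Z_{lam T} - lam T κ(ρ))`. -/
def priceFactor (ω : Ω) : ℝ :=
  Real.exp (ρ * Z (m.lam * m.T).toNNReal ω - m.lam * m.T * kappa Q ρ Z)

/-- The integrated variance `I_T`. -/
def intVar (ω : Ω) : ℝ := ∫ s in (0 : ℝ)..m.T, V s ω

/-- `E[I_T]`. -/
def meanIntVar : ℝ := ∫ ω, intVar m V ω ∂Q

/-- `∂^{i+j} BS / ∂x^i ∂y^j` at `((1-u) S₀ + u P_T S₀, (1-u) E[I_T] + u I_T)`. -/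
def derivOnSegment (i j : ℕ) (u : ℝ) (ω : Ω) : ℝ :=
  bsPutDeriv m i j ((1 - u) * m.S₀ + u * priceFactor Q m ρ Z ω * m.S₀)
    ((1 - u) * meanIntVar Q m V + u * intVar m V ω)

/-- The random variable under the expectation in the `n`-th term of the remainder. -/
def remainderIntegrand (N n : ℕ) (ω : Ω) : ℝ :=
  (priceFactor Q m ρ Z ω - 1) ^ (N + 1 - n) * (intVar m V ω - meanIntVar Q m V) ^ n *
    ∫ u in (0 : ℝ)..1, (1 - u) ^ N * derivOnSegment Q m ρ Z V (N + 1 - n) n u ω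

/-- The remainder `R_N` of the `N`-th order Taylor approximation of the put price. -/
def remainder (N : ℕ) : ℝ :=
  1 / (N ! : ℝ) * ∑ n ∈ Finset.range (N + 2),
    ((N + 1).choose n : ℝ) * m.S₀ ^ (N + 1 - n) * ∫ ω, remainderIntegrand Q m ρ Z V N n ω ∂Q

/-- Almost surely, `sup_{u ∈ (0,1)} |∂^{i+j} BS / ∂x^i ∂y^j| ≤ c` along the segment. -/
def SupBound (i j : ℕ) (c : ℝ) : Prop :=
  ∀ᵐ ω ∂Q, ∀ u ∈ Ioo (0 : ℝ) 1, |derivOnSegment Q m ρ Z V i j u ω| ≤ c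

/-- Almost surely, the average of `|∂^{i+j} BS / ∂x^i ∂y^j|` along the segment for the probability
density `(i + j) (1 - u)^{i + j - 1}` of the Taylor remainder is at most `c`. -/
def AverageBound (i j : ℕ) (c : ℝ) : Prop :=
  ∀ᵐ ω ∂Q, ∫⁻ u in Ioo (0 : ℝ) 1,
    ENNReal.ofReal ((i + j : ℝ) * (1 - u) ^ (i + j - 1) * |derivOnSegment Q m ρ Z V i j u ω|)
      ≤ ENNReal.ofReal c

/-- The random variable whose `n`-th moment is `G_n`. -/
def gVar (ω : Ω) : ℝ :=
  -(m.lam * m.T * kappa Q ρ Z) * (1 / 2 * Real.exp (-(m.lam * m.T * kappa Q ρ Z)) + 1 / 2) +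
    |ρ| * Z (m.lam * m.T).toNNReal ω

end Model

/-- The value `f (a, 1/lam, 1/b, T)`. -/
def evalF (f : MvPolynomial (Fin 4) ℝ) (m : Market) (a b : ℝ) : ℝ :=
  MvPolynomial.eval ![a, 1 / m.lam, 1 / b, m.T] f

/-- The value `g (a, lam, 1/b, T, |ρ|, e^{-lam T κ})`. -/
def evalG (g : MvPolynomial (Fin 6) ℝ) (m : Market) (a b ρ κ : ℝ) : ℝ :=
  MvPolynomial.eval ![a, m.lam, 1 / b, m.T, |ρ|, Real.exp (-(m.lam * m.T * κ))] g

/-- The error bound for `ρ ≤ 0`; here `κ` is the value `κ(ρ)` and `M i j` bounds the derivative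
`∂^{i+j} BS / ∂x^i ∂y^j`. -/
def errorBound (f : ℕ → MvPolynomial (Fin 4) ℝ) (g : ℕ → MvPolynomial (Fin 6) ℝ)
    (M : ℕ → ℕ → ℝ) (m : Market) (a b ρ κ : ℝ) (N : ℕ) : ℝ :=
  √(a * m.T) / (b ^ (N + 1) * ((N + 1)! : ℝ)) *
    ((∑ n ∈ Finset.Icc 1 N, ((N + 1).choose n : ℝ) * m.S₀ ^ (N + 1 - n) * M (N + 1 - n) n *
        √(a * m.T * |ρ| / b * evalG (g (2 * N + 2 - 2 * n)) m a b ρ κ * evalF (f (2 * n)) m a b))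
      + M 0 (N + 1) * √(1 / (b ^ 2 * m.lam) * evalF (f (2 * N + 2)) m a b)
      + m.S₀ ^ (N + 1) * M (N + 1) 0 * √(m.lam * |ρ| * evalG (g (2 * N + 2)) m a b ρ κ))

/-- The error bound for `ρ = 0`; here `M` bounds the derivative `∂^{N+1} BS / ∂y^{N+1}`. -/
def errorBoundZero (f : ℕ → MvPolynomial (Fin 4) ℝ) (M : ℝ) (m : Market) (a b : ℝ) (N : ℕ) : ℝ :=
  1 / ((N + 1)! : ℝ) * (a * m.T / (m.lam * b ^ (N + 2))) * evalF (f (N + 1)) m a b * M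

end BNS

end

namespace BNS

open Filter Topology

/-! Each term of the remainder is the expectation of a power of `P_T - 1`, times a power of `I_T -
E[I_T]`, times a weighted integral of a derivative of the put price. The three factors are
controlled separately; the Cauchy-Schwarz inequality then splits the first two.

Moments. Write `ψ(θ) = a (b - √(b² - 2θ))` for the cumulant function of `IG(a, b)`. Stationarity
forces `V_t - e^{-λt} v₀` to have cumulant function `ψ(θ) - ψ(θ e^{-λt})`. Pathwise this noise lies
between `e^{-λt} Z_{λt}` and `Z_{λt}`, so cutting `[0, s]` into ever smaller steps identifies the
cumulant function of `Z_s` as `s θ ψ'(θ) = s a θ / √(b² - 2θ)` (`IsIGOU.cgf_driver`). By scaling,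
the `k`-th cumulant of `Z_1` is a universal number times `a b^{1-2k}`. The random part of `I_T`
integrates a kernel with values in `[0, 1/λ]` against `dZ`. It is a limit of weighted sums of
independent increments, whose cumulants of order `k ≥ 2` are at most a universal number times `a T
λ^{1-k} b^{1-2k}`. The recursion between moments and cumulants turns such bounds into moment bounds
(`exists_moment_bound`, `exists_central_moment_bound`). Centering removes the first cumulant, and
this gains one power of `1/b`, or two from the third moment on.

Price factor. With `c = -λTκ(ρ) ≥ 0` one has `P_T = e^{c - |ρ| Z_{λT}}`, and elementary convexity
gives `|P_T - 1| ≤ gVar` (`IsIGOU.abs_priceFactor_sub_one_le`). Hence its moments are at most the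
`G_n`.

Derivatives. Every derivative of order at least two is `x^{-i} y^{-1/2}` times a polynomial in `L/y`
and `1/y`, times a Gaussian factor in `d_±` (`exists_bsPutDeriv_eq`). The variance never falls below
a positive deterministic level, so the Gaussian factor absorbs the polynomial, and only `x^{-(i-1)}`
is left for `i ≥ 1`. Along the segment `x ≥ (1-u) S₀`, so the Taylor weight `(1-u)^N` compensates
this singularity (`IsIGOU.abs_derivOnSegment_le`). This yields averaged bounds that do not depend on
`a`, `b`, `ρ`. -/

/-! ### The normal law and the exponential moments of the inverse Gaussian law. -/

/-- Density of the standard normal law. -/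
noncomputable def stdNormalPdf (z : ℝ) : ℝ := (√(2 * Real.pi))⁻¹ * Real.exp (-z ^ 2 / 2)

lemma continuous_stdNormalPdf : Continuous stdNormalPdf := by
  unfold stdNormalPdf; fun_prop

lemma gaussianPDFReal_zero_one (z : ℝ) : gaussianPDFReal 0 1 z = stdNormalPdf z := by
  simp [gaussianPDFReal, stdNormalPdf]

lemma stdNormalCdf_eq (z : ℝ) : stdNormalCdf z = ∫ t in Iic z, stdNormalPdf t := by
  rw [stdNormalCdf, cdf_eq_real, measureReal_def, gaussianReal_apply_eq_integral _ one_ne_zero,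
    ENNReal.toReal_ofReal (integral_nonneg fun _ => gaussianPDFReal_nonneg _ _ _)]
  simp [gaussianPDFReal_zero_one]

lemma integrable_stdNormalPdf : Integrable stdNormalPdf := by
  have := integrable_gaussianPDFReal 0 1
  rwa [show gaussianPDFReal 0 1 = stdNormalPdf from funext gaussianPDFReal_zero_one] at this

lemma hasDerivAt_stdNormalCdf (z : ℝ) : HasDerivAt stdNormalCdf (stdNormalPdf z) z := by
  have h : stdNormalCdf = fun z =>
      (∫ t in Iic (0 : ℝ), stdNormalPdf t) + ∫ t in (0 : ℝ)..z, stdNormalPdf t := by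
    funext z
    rw [stdNormalCdf_eq, ← intervalIntegral.integral_Iic_sub_Iic
      integrable_stdNormalPdf.integrableOn integrable_stdNormalPdf.integrableOn]
    ring
  rw [h]
  exact (continuous_stdNormalPdf.integral_hasStrictDerivAt 0 z).hasDerivAt.const_add _

lemma tendsto_stdNormalCdf_atBot : Tendsto stdNormalCdf atBot (𝓝 0) := tendsto_cdf_atBot _

lemma tendsto_stdNormalCdf_atTop : Tendsto stdNormalCdf atTop (𝓝 1) := tendsto_cdf_atTop _

/-- Distribution function of the inverse Gaussian law, on `(0, ∞)`. -/
noncomputable def invGaussianCdf (a β x : ℝ) : ℝ :=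
  stdNormalCdf (β * √x - a / √x) + Real.exp (2 * a * β) * stdNormalCdf (-(β * √x + a / √x))

/-- Density of the inverse Gaussian law, on `(0, ∞)`. -/
noncomputable def invGaussianPdf (a b x : ℝ) : ℝ :=
  a / √(2 * Real.pi) * Real.exp (a * b) * x ^ (-(3 / 2) : ℝ) *
      Real.exp (-(a ^ 2 / x + b ^ 2 * x) / 2)

/-- Expanding the squares `(β√x ∓ a/√x)²` shows that both normal densities, the second one with its
factor `e^{2aβ}`, equal the same expression. The inner derivatives are `±β/(2√x) + a/(2x^{3/2})`, so
the `β` parts cancel. -/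
lemma hasDerivAt_invGaussianCdf (a β : ℝ) {x : ℝ} (hx : 0 < x) :
    HasDerivAt (invGaussianCdf a β) (invGaussianPdf a β x) x := by
  have hs : 0 < √x := Real.sqrt_pos.2 hx
  have hss : √x ^ 2 = x := Real.sq_sqrt hx.le
  have h0 : HasDerivAt (fun x => √x) (1 / (2 * √x)) x := Real.hasDerivAt_sqrt hx.ne'
  have h1 : HasDerivAt (fun x => β * √x) (β * (1 / (2 * √x))) x := h0.const_mul β
  have h2 : HasDerivAt (fun x => a / √x) ((0 * √x - a * (1 / (2 * √x))) / √x ^ 2) x :=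
    (hasDerivAt_const x a).div h0 hs.ne'
  have h3 := (hasDerivAt_stdNormalCdf (β * √x - a / √x)).comp x (h1.sub h2)
  have h4 := ((hasDerivAt_stdNormalCdf (-(β * √x + a / √x))).comp x (h1.add h2).neg).const_mul
    (Real.exp (2 * a * β))
  have h5 := h3.add h4
  refine h5.congr_deriv ?_
  have hq : a ^ 2 / x + β ^ 2 * x = a ^ 2 / √x ^ 2 + β ^ 2 * √x ^ 2 := by rw [hss]
  have e1 : stdNormalPdf (β * √x - a / √x) =
      (√(2 * Real.pi))⁻¹ * (Real.exp (a * β) * Real.exp (-(a ^ 2 / x + β ^ 2 * x) / 2)) := by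
    rw [stdNormalPdf, ← Real.exp_add]
    congr 2
    rw [hq]; field_simp; ring
  have e2 : Real.exp (2 * a * β) * stdNormalPdf (-(β * √x + a / √x)) =
      (√(2 * Real.pi))⁻¹ * (Real.exp (a * β) * Real.exp (-(a ^ 2 / x + β ^ 2 * x) / 2)) := by
    rw [stdNormalPdf, mul_left_comm, ← Real.exp_add, ← Real.exp_add]
    congr 2
    rw [hq]; field_simp; ring
  have e3 : x ^ (-(3 / 2) : ℝ) = (√x ^ 3)⁻¹ := by
    rw [Real.sqrt_eq_rpow, ← Real.rpow_natCast, ← Real.rpow_mul hx.le, ← Real.rpow_neg hx.le]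
    norm_num
  rw [← mul_assoc, e2, e1, invGaussianPdf, e3]
  field_simp
  ring

lemma tendsto_invGaussianCdf_zero {a β : ℝ} (ha : 0 < a) :
    Tendsto (invGaussianCdf a β) (𝓝[>] 0) (𝓝 0) := by
  have hs : Tendsto (fun x : ℝ => √x) (𝓝[>] 0) (𝓝[>] 0) := by
    refine tendsto_nhdsWithin_iff.2 ⟨?_, ?_⟩
    · have := Real.continuous_sqrt.tendsto 0
      rw [Real.sqrt_zero] at this
      exact this.mono_left nhdsWithin_le_nhds
    · filter_upwards [self_mem_nhdsWithin] with x hx using Real.sqrt_pos.2 hx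
  have hd : Tendsto (fun x : ℝ => a / √x) (𝓝[>] 0) atTop := by
    simp only [div_eq_mul_inv]
    exact (tendsto_inv_nhdsGT_zero.comp hs).const_mul_atTop ha
  have hm : Tendsto (fun x : ℝ => β * √x) (𝓝[>] 0) (𝓝 0) := by
    simpa using (hs.mono_right nhdsWithin_le_nhds).const_mul β
  have h1 : Tendsto (fun x : ℝ => β * √x - a / √x) (𝓝[>] 0) atBot := by
    simp only [sub_eq_add_neg]
    exact hm.add_atBot (tendsto_neg_atTop_atBot.comp hd)
  have h2 : Tendsto (fun x : ℝ => -(β * √x + a / √x)) (𝓝[>] 0) atBot :=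
    tendsto_neg_atTop_atBot.comp (hm.add_atTop hd)
  have := (tendsto_stdNormalCdf_atBot.comp h1).add
    ((tendsto_stdNormalCdf_atBot.comp h2).const_mul (Real.exp (2 * a * β)))
  rwa [mul_zero, add_zero] at this

lemma tendsto_invGaussianCdf_atTop {a β : ℝ} (hβ : 0 < β) :
    Tendsto (invGaussianCdf a β) atTop (𝓝 1) := by
  have hs : Tendsto (fun x : ℝ => √x) atTop atTop := Real.tendsto_sqrt_atTop
  have hd : Tendsto (fun x : ℝ => a / √x) atTop (𝓝 0) := hs.const_div_atTop a
  have hm : Tendsto (fun x : ℝ => β * √x) atTop atTop := hs.const_mul_atTop hβ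
  have h1 : Tendsto (fun x : ℝ => β * √x - a / √x) atTop atTop := by
    simp only [sub_eq_add_neg]
    exact hm.atTop_add hd.neg
  have h2 : Tendsto (fun x : ℝ => -(β * √x + a / √x)) atTop atBot :=
    tendsto_neg_atTop_atBot.comp (hm.atTop_add hd)
  have := (tendsto_stdNormalCdf_atTop.comp h1).add
    ((tendsto_stdNormalCdf_atBot.comp h2).const_mul (Real.exp (2 * a * β)))
  rwa [mul_zero, add_zero] at this

lemma measurable_invGaussianPdf (a b : ℝ) : Measurable (invGaussianPdf a b) := by
  unfold invGaussianPdf; fun_prop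

lemma invGaussianPdf_nonneg {a : ℝ} (ha : 0 < a) (b : ℝ) {x : ℝ} (hx : 0 < x) :
    0 ≤ invGaussianPdf a b x := by
  unfold invGaussianPdf; positivity

lemma lintegral_invGaussianPdf {a β : ℝ} (ha : 0 < a) (hβ : 0 < β) :
    ∫⁻ x in Ioi 0, ENNReal.ofReal (invGaussianPdf a β x) = 1 := by
  -- The formula of `invGaussianCdf` has a wrong value at `0` (division by zero yields zero), so it
  -- is replaced by `0` there to obtain right continuity.
  set G : ℝ → ℝ := fun x => if x ≤ 0 then 0 else invGaussianCdf a β x with hG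
  have hGe : ∀ x, 0 < x → G =ᶠ[𝓝 x] invGaussianCdf a β := fun x hx => by
    filter_upwards [lt_mem_nhds hx] with y hy
    simp [hG, hy.not_ge]
  have hcont : ContinuousWithinAt G (Ici 0) 0 := by
    rw [← Ioi_insert, continuousWithinAt_insert_self, ContinuousWithinAt]
    have h0 : G 0 = 0 := by simp [hG]
    rw [h0]
    refine (tendsto_invGaussianCdf_zero (β := β) ha).congr' ?_
    filter_upwards [self_mem_nhdsWithin] with x hx
    simp [hG, (show (0 : ℝ) < x from hx).not_ge]
  have hder : ∀ x ∈ Ioi (0 : ℝ), HasDerivAt G (invGaussianPdf a β x) x := fun x hx =>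
    (hasDerivAt_invGaussianCdf a β hx).congr_of_eventuallyEq (hGe x hx)
  have hpos : ∀ x ∈ Ioi (0 : ℝ), 0 ≤ invGaussianPdf a β x := fun x hx =>
    invGaussianPdf_nonneg ha β hx
  have htop : Tendsto G atTop (𝓝 1) := by
    refine (tendsto_invGaussianCdf_atTop (a := a) hβ).congr' ?_
    filter_upwards [eventually_gt_atTop 0] with x hx
    simp [hG, hx.not_ge]
  have hint := integrableOn_Ioi_deriv_of_nonneg hcont hder hpos htop
  have hval := integral_Ioi_of_hasDerivAt_of_nonneg hcont hder hpos htop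
  rw [← ofReal_integral_eq_lintegral_ofReal hint
    (ae_restrict_of_forall_mem measurableSet_Ioi hpos), hval]
  simp [hG]

/-- Cumulant generating function of `IG(a, b)`. -/
noncomputable def invGaussianCgf (a b θ : ℝ) : ℝ := a * (b - √(b ^ 2 - 2 * θ))

/-- Exponential tilting stays in the family: `e^{θx}` times the density of `IG(a, b)` is
`e^{a(b-β)}` times the density of `IG(a, β)` with `β = √(b² - 2θ)`, and the latter has mass one. -/
lemma lintegral_exp_inverseGaussian {a b θ : ℝ} (ha : 0 < a) (hθ : θ < b ^ 2 / 2) :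
    ∫⁻ x, ENNReal.ofReal (Real.exp (θ * x)) ∂inverseGaussian a b =
      ENNReal.ofReal (Real.exp (invGaussianCgf a b θ)) := by
  have hp : 0 < b ^ 2 - 2 * θ := by linarith
  have hβ : 0 < √(b ^ 2 - 2 * θ) := Real.sqrt_pos.2 hp
  have hβ2 : √(b ^ 2 - 2 * θ) ^ 2 = b ^ 2 - 2 * θ := Real.sq_sqrt hp.le
  set β := √(b ^ 2 - 2 * θ)
  have hm : Measurable fun x : ℝ => ENNReal.ofReal (invGaussianPdf a b x) :=
    (measurable_invGaussianPdf a b).ennreal_ofReal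
  have : inverseGaussian a b =
      (volume.restrict (Ioi 0)).withDensity fun x => ENNReal.ofReal (invGaussianPdf a b x) := rfl
  rw [this, lintegral_withDensity_eq_lintegral_mul _ hm (by fun_prop)]
  have key : ∀ x ∈ Ioi (0 : ℝ), ((fun x => ENNReal.ofReal (invGaussianPdf a b x)) *
      fun x => ENNReal.ofReal (Real.exp (θ * x))) x =
      ENNReal.ofReal (Real.exp (a * (b - β))) * ENNReal.ofReal (invGaussianPdf a β x) := by
    intro x hx
    rw [Pi.mul_apply, ← ENNReal.ofReal_mul (invGaussianPdf_nonneg ha _ hx),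
      ← ENNReal.ofReal_mul (Real.exp_nonneg _)]
    congr 1
    have e : Real.exp (a * b) * Real.exp (-(a ^ 2 / x + b ^ 2 * x) / 2) * Real.exp (θ * x) =
        Real.exp (a * (b - β)) * (Real.exp (a * β) * Real.exp (-(a ^ 2 / x + β ^ 2 * x) / 2)) := by
      simp only [← Real.exp_add]
      congr 1
      rw [hβ2]; ring
    unfold invGaussianPdf
    linear_combination (a / √(2 * Real.pi) * x ^ (-(3 / 2) : ℝ)) * e
  rw [setLIntegral_congr_fun measurableSet_Ioi key,
    lintegral_const_mul _ (measurable_invGaussianPdf a β).ennreal_ofReal,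
    lintegral_invGaussianPdf ha hβ, mul_one, invGaussianCgf]

/-! ### Closed form of the partial derivatives of the put price. -/

/-- Logarithm of the forward moneyness. -/
noncomputable def logMoneyness (m : Market) (x : ℝ) : ℝ := Real.log (x / m.K) + m.r * m.T

/-- The exponential `exp (-(L - y / 2) ^ 2 / (2 y))` in expanded form. -/
noncomputable def bsKernel (L y : ℝ) : ℝ := Real.exp (-L ^ 2 / (2 * y) + L / 2 - y / 8)

/-- The constant `K e^{-rT} / √(2π)`. -/
noncomputable def bsConst (m : Market) : ℝ := m.K * Real.exp (-(m.r * m.T)) * (√(2 * Real.pi))⁻¹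

/-- Every partial derivative of order at least two of the put price is a multiple of such a
function. -/
noncomputable def bsTerm (m : Market) (i : ℕ) (p : MvPolynomial (Fin 2) ℝ) (x y : ℝ) : ℝ :=
  x⁻¹ ^ i * ((√y)⁻¹ * (MvPolynomial.eval ![logMoneyness m x / y, 1 / y] p *
    bsKernel (logMoneyness m x) y))

lemma bsConst_pos (m : Market) : 0 < bsConst m := by
  have := m.K_pos
  unfold bsConst
  have := Real.pi_pos
  positivity

lemma bsConst_mul_exp (m : Market) {x : ℝ} (hx : 0 < x) :
    bsConst m * Real.exp (logMoneyness m x) = x * (√(2 * Real.pi))⁻¹ := by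
  have hK := m.K_pos
  rw [bsConst, logMoneyness, Real.exp_add, Real.exp_log (by positivity), Real.exp_neg]
  field_simp

lemma bsKernel_eq_dMinus (m : Market) (x : ℝ) {y : ℝ} (hy : 0 < y) :
    bsKernel (logMoneyness m x) y = Real.exp (-dMinus m x y ^ 2 / 2) := by
  rw [bsKernel, dMinus, div_pow, Real.sq_sqrt hy.le, ← logMoneyness]
  congr 1
  field_simp
  ring

lemma bsKernel_eq_dPlus (m : Market) (x : ℝ) {y : ℝ} (hy : 0 < y) :
    bsKernel (logMoneyness m x) y =
      Real.exp (logMoneyness m x) * Real.exp (-dPlus m x y ^ 2 / 2) := by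
  rw [bsKernel, dPlus, div_pow, Real.sq_sqrt hy.le, ← logMoneyness, ← Real.exp_add]
  congr 1
  field_simp
  ring

/-- Together with `mul_stdNormalPdf_dPlus` this is the classical identity `K e^{-rT} φ(d_-) = x
φ(d_+)`, which collapses the first derivatives of the put price. -/
lemma const_mul_stdNormalPdf_dMinus (m : Market) (x : ℝ) {y : ℝ} (hy : 0 < y) :
    m.K * Real.exp (-(m.r * m.T)) * stdNormalPdf (-dMinus m x y) =
      bsConst m * bsKernel (logMoneyness m x) y := by
  rw [bsKernel_eq_dMinus m x hy, stdNormalPdf, bsConst, neg_sq]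
  ring

lemma mul_stdNormalPdf_dPlus (m : Market) {x y : ℝ} (hx : 0 < x) (hy : 0 < y) :
    x * stdNormalPdf (-dPlus m x y) = bsConst m * bsKernel (logMoneyness m x) y := by
  rw [bsKernel_eq_dPlus m x hy, stdNormalPdf, ← mul_assoc, ← mul_assoc, bsConst_mul_exp m hx,
    neg_sq]

lemma hasDerivAt_logMoneyness (m : Market) {x : ℝ} (hx : 0 < x) :
    HasDerivAt (logMoneyness m) x⁻¹ x := by
  have hK := m.K_pos
  have h := ((hasDerivAt_id x).div_const m.K).log (div_pos hx hK).ne'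
  refine (h.add_const (m.r * m.T)).congr_deriv ?_
  simp
  field_simp

lemma hasDerivAt_dPlus_snd (m : Market) (x : ℝ) {y : ℝ} (hy : 0 < y) :
    HasDerivAt (fun y => dPlus m x y)
      (-(logMoneyness m x) / (2 * y * √y) + 1 / (4 * √y)) y := by
  have hs : 0 < √y := Real.sqrt_pos.2 hy
  have h := (((hasDerivAt_id y).div_const 2).const_add (logMoneyness m x)).div
    (Real.hasDerivAt_sqrt hy.ne') hs.ne'
  refine h.congr_deriv ?_
  have hss : √y ^ 2 = y := Real.sq_sqrt hy.le
  simp only [id]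
  rw [hss]
  field_simp
  rw [hss]
  ring

lemma hasDerivAt_dMinus_snd (m : Market) (x : ℝ) {y : ℝ} (hy : 0 < y) :
    HasDerivAt (fun y => dMinus m x y)
      (-(logMoneyness m x) / (2 * y * √y) - 1 / (4 * √y)) y := by
  have hs : 0 < √y := Real.sqrt_pos.2 hy
  have h := (((hasDerivAt_id y).div_const 2).const_sub (logMoneyness m x)).div
    (Real.hasDerivAt_sqrt hy.ne') hs.ne'
  refine h.congr_deriv ?_
  have hss : √y ^ 2 = y := Real.sq_sqrt hy.le
  simp only [id]
  rw [hss]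
  field_simp
  rw [hss]
  ring

lemma hasDerivAt_dPlus_fst (m : Market) {x : ℝ} (hx : 0 < x) (y : ℝ) :
    HasDerivAt (fun x => dPlus m x y) (x⁻¹ / √y) x :=
  ((hasDerivAt_logMoneyness m hx).add_const (y / 2)).div_const _

lemma hasDerivAt_dMinus_fst (m : Market) {x : ℝ} (hx : 0 < x) (y : ℝ) :
    HasDerivAt (fun x => dMinus m x y) (x⁻¹ / √y) x :=
  ((hasDerivAt_logMoneyness m hx).sub_const (y / 2)).div_const _

lemma hasDerivAt_bsPut_snd (m : Market) {x y : ℝ} (hx : 0 < x) (hy : 0 < y) :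
    HasDerivAt (fun y => bsPut m x y)
      (bsConst m * bsTerm m 0 (MvPolynomial.C (1 / 2)) x y) y := by
  have h1 := ((hasDerivAt_stdNormalCdf (-dMinus m x y)).comp y
    (hasDerivAt_dMinus_snd m x hy).neg).const_mul (m.K * Real.exp (-(m.r * m.T)))
  have h2 := ((hasDerivAt_stdNormalCdf (-dPlus m x y)).comp y
    (hasDerivAt_dPlus_snd m x hy).neg).const_mul x
  refine (h1.sub h2).congr_deriv ?_
  rw [← mul_assoc, ← mul_assoc x, const_mul_stdNormalPdf_dMinus m x hy,
    mul_stdNormalPdf_dPlus m hx hy, bsTerm, MvPolynomial.eval_C]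
  have hs : 0 < √y := Real.sqrt_pos.2 hy
  field_simp
  ring

/-- The first spot derivative still contains the normal distribution function and is not a `bsTerm`.
This is why the closed form is stated from order two on. -/
lemma hasDerivAt_bsPut_fst (m : Market) {x y : ℝ} (hx : 0 < x) (hy : 0 < y) :
    HasDerivAt (fun x => bsPut m x y) (-stdNormalCdf (-dPlus m x y)) x := by
  have h1 := ((hasDerivAt_stdNormalCdf (-dMinus m x y)).comp x
    (hasDerivAt_dMinus_fst m hx y).neg).const_mul (m.K * Real.exp (-(m.r * m.T)))
  have h2 := (hasDerivAt_id x).mul ((hasDerivAt_stdNormalCdf (-dPlus m x y)).comp x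
    (hasDerivAt_dPlus_fst m hx y).neg)
  refine (h1.sub h2).congr_deriv ?_
  simp only [id, Function.comp]
  rw [← mul_assoc, ← mul_assoc x, const_mul_stdNormalPdf_dMinus m x hy,
    mul_stdNormalPdf_dPlus m hx hy, Pi.neg_apply]
  ring

lemma hasDerivAt_neg_stdNormalCdf_dPlus (m : Market) {x y : ℝ} (hx : 0 < x) (hy : 0 < y) :
    HasDerivAt (fun x => -stdNormalCdf (-dPlus m x y)) (bsConst m * bsTerm m 2 1 x y) x := by
  have h2 := ((hasDerivAt_stdNormalCdf (-dPlus m x y)).comp x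
    (hasDerivAt_dPlus_fst m hx y).neg).neg
  refine h2.congr_deriv ?_
  have h3 := mul_stdNormalPdf_dPlus m hx hy
  have h4 : stdNormalPdf (-dPlus m x y) = x⁻¹ * (bsConst m * bsKernel (logMoneyness m x) y) := by
    rw [← h3]; field_simp
  rw [h4, bsTerm, map_one]
  ring

/-- Both generators `L/y` and `1/y` have as `y`-derivative minus themselves times `1/y`, so the
algebra they generate is stable under differentiation. -/
lemma exists_hasDerivAt_eval_snd (p : MvPolynomial (Fin 2) ℝ) :
    ∃ p' : MvPolynomial (Fin 2) ℝ, ∀ L y : ℝ, 0 < y →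
      HasDerivAt (fun y => MvPolynomial.eval ![L / y, 1 / y] p)
        (MvPolynomial.eval ![L / y, 1 / y] p') y := by
  induction p using MvPolynomial.induction_on with
  | C c => exact ⟨0, fun L y _ => by simpa using hasDerivAt_const y c⟩
  | add p q hp hq =>
    obtain ⟨p', hp⟩ := hp
    obtain ⟨q', hq⟩ := hq
    exact ⟨p' + q', fun L y hy => by simpa using (hp L y hy).fun_add (hq L y hy)⟩
  | mul_X p i hp =>
    obtain ⟨p', hp⟩ := hp
    refine ⟨p' * .X i - p * .X i * .X 1, fun L y hy => ?_⟩
    have key : ∀ c : ℝ, HasDerivAt (fun y => c / y) (-(c / y * (1 / y))) y := fun c => by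
      refine ((hasDerivAt_const y c).div (hasDerivAt_id y) hy.ne').congr_deriv ?_
      simp only [id]
      field_simp
      ring
    have hX : HasDerivAt (fun y => ![L / y, 1 / y] i) (-(![L / y, 1 / y] i * (1 / y))) y := by
      fin_cases i
      · simpa using key L
      · simpa using key 1
    simp only [map_mul, map_sub, MvPolynomial.eval_X]
    refine ((hp L y hy).fun_mul hX).congr_deriv ?_
    simp
    ring

lemma exists_hasDerivAt_eval_fst (p : MvPolynomial (Fin 2) ℝ) :
    ∃ p' : MvPolynomial (Fin 2) ℝ, ∀ L y : ℝ,
      HasDerivAt (fun L => MvPolynomial.eval ![L / y, 1 / y] p)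
        (MvPolynomial.eval ![L / y, 1 / y] p') L := by
  induction p using MvPolynomial.induction_on with
  | C c => exact ⟨0, fun L y => by simpa using hasDerivAt_const L c⟩
  | add p q hp hq =>
    obtain ⟨p', hp⟩ := hp
    obtain ⟨q', hq⟩ := hq
    exact ⟨p' + q', fun L y => by simpa using (hp L y).fun_add (hq L y)⟩
  | mul_X p i hp =>
    obtain ⟨p', hp⟩ := hp
    refine ⟨p' * .X i + p * (.C (![1, 0] i) * .X 1), fun L y => ?_⟩
    have hX : HasDerivAt (fun L => ![L / y, 1 / y] i) (![1, 0] i * (1 / y)) L := by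
      fin_cases i
      · simpa using (hasDerivAt_id L).div_const y
      · simpa using hasDerivAt_const L y⁻¹
    simp only [map_mul, map_add, MvPolynomial.eval_X, MvPolynomial.eval_C]
    refine ((hp L y).fun_mul hX).congr_deriv ?_
    simp

lemma exists_hasDerivAt_bsTerm_snd (p : MvPolynomial (Fin 2) ℝ) :
    ∃ p' : MvPolynomial (Fin 2) ℝ, ∀ (m : Market) (i : ℕ) (x y : ℝ), 0 < y →
      HasDerivAt (fun y => bsTerm m i p x y) (bsTerm m i p' x y) y := by
  obtain ⟨p', hp⟩ := exists_hasDerivAt_eval_snd p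
  -- The second summand is `p` times the logarithmic `y`-derivative `L²/(2y²) - 1/8 - 1/(2y)` of
  -- `y^{-1/2} bsKernel L y`.
  refine ⟨p' + p * (.C (1 / 2) * .X 0 ^ 2 - .C (1 / 8) - .C (1 / 2) * .X 1), fun m i x y hy => ?_⟩
  have hs : 0 < √y := Real.sqrt_pos.2 hy
  have hss : √y ^ 2 = y := Real.sq_sqrt hy.le
  set L := logMoneyness m x with hL
  have h1 : HasDerivAt (fun y => (√y)⁻¹) (-(1 / 2) * (1 / y) * (√y)⁻¹) y := by
    refine ((Real.hasDerivAt_sqrt hy.ne').inv hs.ne').congr_deriv ?_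
    rw [hss]; field_simp
  have h2 : HasDerivAt (fun y => bsKernel L y)
      ((1 / 2 * (L / y) ^ 2 - 1 / 8) * bsKernel L y) y := by
    have h := (((hasDerivAt_const y (-L ^ 2)).div ((hasDerivAt_id y).const_mul 2)
      (by simp; positivity)).add_const (L / 2)).sub ((hasDerivAt_id y).div_const 8)
    refine h.exp.congr_deriv ?_
    rw [mul_comm]
    simp only [id, bsKernel]
    congr 1
    field_simp
    ring
  have h3 := (h1.fun_mul ((hp L y hy).fun_mul h2)).const_mul (x⁻¹ ^ i)
  refine h3.congr_deriv ?_
  simp only [bsTerm, ← hL, map_add, map_mul, map_sub, map_pow, MvPolynomial.eval_X,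
    MvPolynomial.eval_C]
  simp only [Matrix.cons_val_zero, Matrix.cons_val_one]
  ring

lemma exists_hasDerivAt_bsTerm_fst (i : ℕ) (p : MvPolynomial (Fin 2) ℝ) :
    ∃ p' : MvPolynomial (Fin 2) ℝ, ∀ (m : Market) (x y : ℝ), 0 < x → 0 < y →
      HasDerivAt (fun x => bsTerm m i p x y) (bsTerm m (i + 1) p' x y) x := by
  obtain ⟨p', hp⟩ := exists_hasDerivAt_eval_fst p
  -- After one factor `1/x` is split off, `x^{-i}` contributes `-i` and the kernel contributes `1/2
  -- - L/y`.
  refine ⟨p' + p * (.C (1 / 2) - .X 0 - .C (i : ℝ)), fun m x y hx hy => ?_⟩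
  set L := logMoneyness m x with hL
  have hlog := hasDerivAt_logMoneyness m hx
  have h1 : HasDerivAt (fun x => x⁻¹ ^ i) (-(i : ℝ) * x⁻¹ ^ (i + 1)) x := by
    refine ((hasDerivAt_inv hx.ne').pow i).congr_deriv ?_
    rcases i with _ | i
    · simp
    · simp only [Nat.add_sub_cancel, inv_pow]
      field_simp
      ring
  have h2 : HasDerivAt (fun L => bsKernel L y) ((1 / 2 - L / y) * bsKernel L y) L := by
    have h := ((((hasDerivAt_id L).pow 2).neg.div_const (2 * y)).add
      ((hasDerivAt_id L).div_const 2)).sub_const (y / 8)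
    refine h.exp.congr_deriv ?_
    rw [mul_comm]
    simp only [bsKernel]
    congr 1
    simp
    field_simp
    ring
  have h3 := h1.fun_mul
    ((((hp L y).comp x hlog).fun_mul (h2.comp x hlog)).const_mul ((√y)⁻¹))
  refine h3.congr_deriv ?_
  simp only [bsTerm, ← hL, map_add, map_mul, map_sub, MvPolynomial.eval_X,
    MvPolynomial.eval_C, Function.comp_apply]
  simp only [Matrix.cons_val_zero]
  ring

lemma deriv_eq_of_eqOn_Ioi {f g : ℝ → ℝ} (h : ∀ x, 0 < x → f x = g x) {x g' : ℝ} (hx : 0 < x)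
    (hg : HasDerivAt g g' x) : deriv f x = g' := by
  refine (hg.congr_of_eventuallyEq ?_).deriv
  filter_upwards [lt_mem_nhds hx] with y hy using h y hy

lemma exists_iteratedDeriv_bsPut_snd (j : ℕ) :
    ∃ p : MvPolynomial (Fin 2) ℝ, ∀ (m : Market) (x y : ℝ), 0 < x → 0 < y →
      iteratedDeriv (j + 1) (fun y => bsPut m x y) y = bsConst m * bsTerm m 0 p x y := by
  induction j with
  | zero => exact ⟨_, fun m x y hx hy => by
      rw [zero_add, iteratedDeriv_one]; exact (hasDerivAt_bsPut_snd m hx hy).deriv⟩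
  | succ j ih =>
    obtain ⟨p, hp⟩ := ih
    obtain ⟨p', hp'⟩ := exists_hasDerivAt_bsTerm_snd p
    refine ⟨p', fun m x y hx hy => ?_⟩
    rw [iteratedDeriv_succ]
    exact deriv_eq_of_eqOn_Ioi (fun y hy => hp m x y hx hy) hy ((hp' m 0 x y hy).const_mul _)

lemma exists_bsPutDeriv_succ {i j : ℕ} (h : ∃ p : MvPolynomial (Fin 2) ℝ,
      ∀ (m : Market) (x y : ℝ), 0 < x → 0 < y →
        bsPutDeriv m i j x y = bsConst m * bsTerm m i p x y) :
    ∃ p : MvPolynomial (Fin 2) ℝ, ∀ (m : Market) (x y : ℝ), 0 < x → 0 < y →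
      bsPutDeriv m (i + 1) j x y = bsConst m * bsTerm m (i + 1) p x y := by
  obtain ⟨p, hp⟩ := h
  obtain ⟨p', hp'⟩ := exists_hasDerivAt_bsTerm_fst i p
  refine ⟨p', fun m x y hx hy => ?_⟩
  rw [bsPutDeriv, iteratedDeriv_succ]
  exact deriv_eq_of_eqOn_Ioi (fun x hx => hp m x y hx hy) hx ((hp' m x y hx hy).const_mul _)

lemma exists_bsPutDeriv_two_zero :
    ∃ p : MvPolynomial (Fin 2) ℝ, ∀ (m : Market) (x y : ℝ), 0 < x → 0 < y →
      bsPutDeriv m 2 0 x y = bsConst m * bsTerm m 2 p x y := by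
  refine ⟨1, fun m x y hx hy => ?_⟩
  rw [bsPutDeriv, iteratedDeriv_succ, iteratedDeriv_one]
  refine deriv_eq_of_eqOn_Ioi (fun x hx => ?_) hx (hasDerivAt_neg_stdNormalCdf_dPlus m hx hy)
  simpa using (hasDerivAt_bsPut_fst m hx hy).deriv

/-- Closed form of the partial derivatives of order at least two of the put price. -/
lemma exists_bsPutDeriv_eq {i j : ℕ} (hij : 2 ≤ i + j) :
    ∃ p : MvPolynomial (Fin 2) ℝ, ∀ (m : Market) (x y : ℝ), 0 < x → 0 < y →
      bsPutDeriv m i j x y = bsConst m * bsTerm m i p x y := by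
  -- Without `y`-derivatives the induction on `i` starts at the second spot derivative. One
  -- `y`-derivative already gives the required form, so otherwise it starts at `i = 0`.
  rcases j with _ | j
  · obtain ⟨i, rfl⟩ := Nat.exists_eq_add_of_le' (show 2 ≤ i from hij)
    clear hij
    induction i with
    | zero => exact exists_bsPutDeriv_two_zero
    | succ i ih => exact exists_bsPutDeriv_succ ih
  · clear hij
    induction i with
    | zero => simpa [bsPutDeriv] using exists_iteratedDeriv_bsPut_snd j
    | succ i ih => exact exists_bsPutDeriv_succ ih

lemma measurable_bsTerm (m : Market) (i : ℕ) (p : MvPolynomial (Fin 2) ℝ) :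
    Measurable fun z : ℝ × ℝ => bsTerm m i p z.1 z.2 := by
  have h1 : Measurable fun z : ℝ × ℝ => logMoneyness m z.1 := by
    unfold logMoneyness; fun_prop
  have h2 : Measurable fun z : ℝ × ℝ =>
      MvPolynomial.eval ![logMoneyness m z.1 / z.2, 1 / z.2] p := by
    have hc : Continuous fun v : Fin 2 → ℝ => MvPolynomial.eval v p := MvPolynomial.continuous_eval p
    refine hc.measurable.comp (measurable_pi_lambda _ fun k => ?_)
    fin_cases k
    · exact h1.div measurable_snd
    · exact measurable_const.div measurable_snd
  unfold bsTerm bsKernel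
  fun_prop

/-! ### Bounds on the derivatives for variances bounded away from zero. -/

/-- A polynomial of `s / √y + c` and `1 / y` grows at most polynomially in `s`, uniformly in
`y` bounded away from `0`. -/
lemma exists_abs_eval_le (y₀ : ℝ) (hy₀ : 0 < y₀) (p : MvPolynomial (Fin 2) ℝ) :
    ∃ (A : ℝ) (k : ℕ), 0 ≤ A ∧ ∀ s q y : ℝ, y₀ ≤ y → |q| ≤ |s| / √y + 1 / 2 →
      |MvPolynomial.eval ![q, 1 / y] p| ≤ A * (1 + |s|) ^ k := by
  induction p using MvPolynomial.induction_on with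
  | C c => exact ⟨|c|, 0, abs_nonneg _, fun s q y _ _ => by simp⟩
  | add p q hp hq =>
    obtain ⟨A, k, hA, hp⟩ := hp
    obtain ⟨B, l, hB, hq⟩ := hq
    refine ⟨A + B, k + l, add_nonneg hA hB, fun s r y hy hr => ?_⟩
    rw [map_add, add_mul]
    have h1 : 1 ≤ 1 + |s| := by linarith [abs_nonneg s]
    refine (abs_add_le _ _).trans (add_le_add ((hp s r y hy hr).trans ?_)
      ((hq s r y hy hr).trans ?_))
    · have := pow_le_pow_right₀ h1 (Nat.le_add_right k l)
      gcongr
    · have := pow_le_pow_right₀ h1 (Nat.le_add_left l k)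
      gcongr
  | mul_X p i hp =>
    obtain ⟨A, k, hA, hp⟩ := hp
    have hs0 : 0 < √y₀ := Real.sqrt_pos.2 hy₀
    refine ⟨A * (1 / √y₀ + 1 / 2 + 1 / y₀), k + 1, by positivity, fun s r y hy hr => ?_⟩
    rw [map_mul, abs_mul, MvPolynomial.eval_X]
    have hy' : 0 < y := hy₀.trans_le hy
    have h2 : |s| / √y ≤ |s| / √y₀ := by gcongr
    have h3 : 1 / y ≤ 1 / y₀ := by gcongr
    have h4 : 0 < 1 / y := by positivity
    have h5 : 0 < 1 / y₀ := by positivity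
    have h6 : 0 < 1 / √y₀ := by positivity
    have hs := abs_nonneg s
    have hX : |![r, 1 / y] i| ≤ (1 / √y₀ + 1 / 2 + 1 / y₀) * (1 + |s|) := by
      fin_cases i
      · simp only [Fin.zero_eta, Matrix.cons_val_zero]
        have : |s| / √y₀ = |s| * (1 / √y₀) := div_eq_mul_one_div _ _
        nlinarith [mul_nonneg hs h5.le]
      · simp only [Fin.mk_one, Matrix.cons_val_one]
        rw [Matrix.cons_val_fin_one, abs_of_pos h4]
        nlinarith [mul_nonneg hs h5.le, mul_nonneg hs h6.le]
    calc _ ≤ (A * (1 + |s|) ^ k) * ((1 / √y₀ + 1 / 2 + 1 / y₀) * (1 + |s|)) :=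
          mul_le_mul (hp s r y hy hr) hX (abs_nonneg _) (by positivity)
      _ = _ := by ring

/-- Use `t^k ≤ k! e^t` with `t = 1 + |s|`; the maximum of `1 + |s| - s²/2` is `3/2`, attained at
`|s| = 1`. -/
lemma one_add_abs_pow_mul_exp_le (k : ℕ) (s : ℝ) :
    (1 + |s|) ^ k * Real.exp (-s ^ 2 / 2) ≤ k ! * Real.exp (3 / 2) := by
  have h1 := Real.pow_div_factorial_le_exp (1 + |s|) (by positivity) k
  rw [div_le_iff₀ (by positivity)] at h1
  have h2 : Real.exp (1 + |s|) * Real.exp (-s ^ 2 / 2) ≤ Real.exp (3 / 2) := by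
    rw [← Real.exp_add]
    refine Real.exp_le_exp.2 ?_
    nlinarith [sq_nonneg (|s| - 1), sq_abs s]
  calc _ ≤ (Real.exp (1 + |s|) * k !) * Real.exp (-s ^ 2 / 2) := by gcongr
    _ = k ! * (Real.exp (1 + |s|) * Real.exp (-s ^ 2 / 2)) := by ring
    _ ≤ _ := by gcongr

lemma exists_abs_eval_mul_exp_le (y₀ : ℝ) (hy₀ : 0 < y₀) (p : MvPolynomial (Fin 2) ℝ) :
    ∃ A : ℝ, 0 ≤ A ∧ ∀ s q y : ℝ, y₀ ≤ y → |q| ≤ |s| / √y + 1 / 2 →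
      |MvPolynomial.eval ![q, 1 / y] p| * Real.exp (-s ^ 2 / 2) ≤ A := by
  obtain ⟨A, k, hA, h⟩ := exists_abs_eval_le y₀ hy₀ p
  refine ⟨A * (k ! * Real.exp (3 / 2)), by positivity, fun s q y hy hq => ?_⟩
  calc _ ≤ A * (1 + |s|) ^ k * Real.exp (-s ^ 2 / 2) := by gcongr; exact h s q y hy hq
    _ = A * ((1 + |s|) ^ k * Real.exp (-s ^ 2 / 2)) := by ring
    _ ≤ _ := mul_le_mul_of_nonneg_left (one_add_abs_pow_mul_exp_le k s) hA

/-- Lets the Gaussian variable `s = d_-` control the polynomial argument `L/y`;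
`logMoneyness_div_dPlus` does the same for `s = d_+`. -/
lemma logMoneyness_div_dMinus (m : Market) (x : ℝ) {y : ℝ} (hy : 0 < y) :
    |logMoneyness m x / y| ≤ |dMinus m x y| / √y + 1 / 2 := by
  have e : logMoneyness m x / y = dMinus m x y / √y + 1 / 2 := by
    rw [dMinus, ← logMoneyness, div_div, Real.mul_self_sqrt hy.le]
    field_simp
    ring
  rw [e]
  refine (abs_add_le _ _).trans ?_
  rw [abs_div, abs_of_nonneg (Real.sqrt_nonneg y), abs_of_pos (show (0 : ℝ) < 1 / 2 by norm_num)]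

lemma logMoneyness_div_dPlus (m : Market) (x : ℝ) {y : ℝ} (hy : 0 < y) :
    |logMoneyness m x / y| ≤ |dPlus m x y| / √y + 1 / 2 := by
  have e : logMoneyness m x / y = dPlus m x y / √y - 1 / 2 := by
    rw [dPlus, ← logMoneyness, div_div, Real.mul_self_sqrt hy.le]
    field_simp
    ring
  rw [e]
  refine (abs_sub _ _).trans ?_
  rw [abs_div, abs_of_nonneg (Real.sqrt_nonneg y), abs_of_pos (show (0 : ℝ) < 1 / 2 by norm_num)]

/-- Bounds for the partial derivatives of the put price for variances bounded away from `0`. -/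
lemma exists_abs_bsPutDeriv_le (m : Market) (y₀ : ℝ) (hy₀ : 0 < y₀) {i j : ℕ} (hij : 2 ≤ i + j) :
    ∃ A : ℝ, 0 ≤ A ∧ ∀ x y : ℝ, 0 < x → y₀ ≤ y → |bsPutDeriv m i j x y| ≤ A * x⁻¹ ^ (i - 1) := by
  obtain ⟨p, hp⟩ := exists_bsPutDeriv_eq hij
  obtain ⟨A, hA, h⟩ := exists_abs_eval_mul_exp_le y₀ hy₀ p
  have hc := bsConst_pos m
  have hs0 : 0 < √y₀ := Real.sqrt_pos.2 hy₀
  -- For `i = 0` the kernel is written through `d_-`, with no power of `x`. For `i ≥ 1` it is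
  -- written through `d_+`, which supplies a factor `x` and lowers the exponent to `i - 1`.
  rcases i with _ | i
  · refine ⟨bsConst m * ((√y₀)⁻¹ * A), by positivity, fun x y hx hy => ?_⟩
    have hy' : 0 < y := hy₀.trans_le hy
    rw [hp m x y hx hy', bsTerm, bsKernel_eq_dMinus m x hy', abs_mul, abs_of_pos hc, abs_mul,
      abs_mul, abs_mul, Real.abs_exp, abs_of_nonneg (inv_nonneg.2 (Real.sqrt_nonneg y))]
    simp only [pow_zero, abs_one, one_mul, zero_tsub, mul_one]
    have := h _ _ y hy (logMoneyness_div_dMinus m x hy')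
    gcongr
  · refine ⟨(√y₀)⁻¹ * A * (√(2 * Real.pi))⁻¹, by positivity, fun x y hx hy => ?_⟩
    have hy' : 0 < y := hy₀.trans_le hy
    have e : bsPutDeriv m (i + 1) j x y = x⁻¹ ^ i * ((√y)⁻¹ *
        (MvPolynomial.eval ![logMoneyness m x / y, 1 / y] p * Real.exp (-dPlus m x y ^ 2 / 2))) *
        (√(2 * Real.pi))⁻¹ := by
      rw [hp m x y hx hy', bsTerm, bsKernel_eq_dPlus m x hy']
      have := bsConst_mul_exp m hx
      rw [show (√(2 * Real.pi))⁻¹ = x⁻¹ * (x * (√(2 * Real.pi))⁻¹) by field_simp, ← this]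
      ring
    rw [e, abs_mul, abs_mul, abs_mul, abs_mul, Real.abs_exp, abs_of_nonneg (by positivity),
      abs_of_nonneg (inv_nonneg.2 (Real.sqrt_nonneg y)),
      abs_of_nonneg (inv_nonneg.2 (Real.sqrt_nonneg _)), Nat.add_sub_cancel]
    have := h _ _ y hy (logMoneyness_div_dPlus m x hy')
    calc _ ≤ x⁻¹ ^ i * ((√y₀)⁻¹ * A) * (√(2 * Real.pi))⁻¹ := by gcongr
      _ = _ := by ring

/-! ### Pathwise solution of the Ornstein-Uhlenbeck equation. -/

section Path

variable {lam v₀ : ℝ} {z : ℝ≥0 → ℝ} {v : ℝ → ℝ}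

/-- The integral of `exp (-lam (t - s))` over `s ∈ [0, t]`. -/
noncomputable def decayIntegral (lam t : ℝ) : ℝ := (1 - Real.exp (-(lam * t))) / lam

lemma decayIntegral_pos (hlam : 0 < lam) {t : ℝ} (ht : 0 < t) : 0 < decayIntegral lam t := by
  refine div_pos ?_ hlam
  have : Real.exp (-(lam * t)) < 1 := Real.exp_lt_one_iff.mpr (by nlinarith)
  linarith

lemma decayIntegral_le (hlam : 0 < lam) (t : ℝ) : decayIntegral lam t ≤ 1 / lam := by
  unfold decayIntegral
  gcongr
  have := Real.exp_pos (-(lam * t))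
  linarith

lemma hasDerivAt_exp_decay (hlam : 0 < lam) (t s : ℝ) :
    HasDerivAt (fun s => Real.exp (-(lam * (t - s))) / lam) (Real.exp (-(lam * (t - s)))) s := by
  have h := ((((hasDerivAt_id s).const_sub t).const_mul lam).neg.exp).div_const lam
  refine h.congr_deriv ?_
  simp only [id, Pi.neg_apply]
  field_simp

lemma integral_exp_decay (hlam : 0 < lam) (t p q : ℝ) :
    ∫ s in p..q, Real.exp (-(lam * (t - s))) =
      (Real.exp (-(lam * (t - q))) - Real.exp (-(lam * (t - p)))) / lam := by
  rw [intervalIntegral.integral_eq_sub_of_hasDerivAt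
    (fun s _ => hasDerivAt_exp_decay hlam t s)
    (Continuous.intervalIntegrable (by fun_prop) _ _)]
  ring

lemma integral_exp_decay_zero (hlam : 0 < lam) (t : ℝ) :
    ∫ s in (0 : ℝ)..t, Real.exp (-(lam * (t - s))) = decayIntegral lam t := by
  rw [integral_exp_decay hlam]
  simp [decayIntegral]

lemma monotone_comp_toNNReal (hlam : 0 < lam) (hz : Monotone z) :
    Monotone fun s : ℝ => z (lam * s).toNNReal :=
  fun s t hst => hz (Real.toNNReal_le_toNNReal (by gcongr))

/-- The convolution of the driving path with the exponential kernel. -/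
noncomputable def expConv (lam : ℝ) (z : ℝ≥0 → ℝ) (t : ℝ) : ℝ :=
  ∫ s in (0 : ℝ)..t, Real.exp (-(lam * (t - s))) * z (lam * s).toNNReal

lemma intervalIntegrable_exp_decay_mul (hlam : 0 < lam) (hz : Monotone z) (t p q : ℝ) :
    IntervalIntegrable (fun s => Real.exp (-(lam * (t - s))) * z (lam * s).toNNReal)
      volume p q :=
  ((monotone_comp_toNNReal hlam hz).intervalIntegrable).continuousOn_mul
    (Continuous.continuousOn (by fun_prop))

/-- The integral of the solution of the Ornstein-Uhlenbeck equation. -/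
lemma integral_ouSolution (hlam : 0 < lam) (hz : Monotone z)
    (hzr : ∀ t, ContinuousWithinAt z (Ici t) t)
    (hv : ∀ t : ℝ, 0 ≤ t → IntervalIntegrable v volume 0 t ∧
      v t = v₀ - lam * (∫ s in (0 : ℝ)..t, v s) + z (lam * t).toNNReal) {t : ℝ} (ht : 0 ≤ t) :
    ∫ s in (0 : ℝ)..t, v s = v₀ * decayIntegral lam t + expConv lam z t := by
  set J : ℝ → ℝ := fun t => ∫ s in (0 : ℝ)..t, v s with hJ
  have hint := (hv t ht).1
  have hJc : ContinuousOn J (Icc 0 t) := by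
    have := intervalIntegral.continuousOn_primitive_interval' hint left_mem_uIcc
    rwa [uIcc_of_le ht] at this
  -- The driver may jump, so the solution is only right-continuous, and the fundamental theorem is
  -- applied with right derivatives.
  have hvr : ∀ x ∈ Ioo 0 t, ContinuousWithinAt v (Ioi x) x := by
    intro x hx
    have h1 : ContinuousWithinAt J (Ioi x) x :=
      (hJc.continuousAt (Icc_mem_nhds hx.1 hx.2)).continuousWithinAt
    have h2 : ContinuousWithinAt (fun s => z (lam * s).toNNReal) (Ioi x) x := by
      refine ContinuousWithinAt.comp (t := Ici (lam * x).toNNReal) (hzr _) ?_ ?_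
      · exact Continuous.continuousWithinAt (by fun_prop)
      · exact fun y hy => Real.toNNReal_le_toNNReal
          (mul_le_mul_of_nonneg_left (le_of_lt hy) hlam.le)
    have h3 : ContinuousWithinAt (fun s => v₀ - lam * J s + z (lam * s).toNNReal) (Ioi x) x :=
      ((continuousWithinAt_const).sub (h1.const_mul lam)).add h2
    refine h3.congr (fun y hy => (hv y (hx.1.trans hy).le).2) (hv x hx.1.le).2
  -- Integrating factor: the `J` terms from the product rule cancel by the equation, the `v₀` terms
  -- by the subtracted antiderivative, and only the integrand of `expConv` survives.
  have hderiv : ∀ x ∈ Ioo 0 t, HasDerivWithinAt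
      (fun s => Real.exp (-(lam * (t - s))) * J s - v₀ * (Real.exp (-(lam * (t - s))) / lam))
      (Real.exp (-(lam * (t - x))) * z (lam * x).toNNReal) (Ioi x) x := by
    intro x hx
    have hi := (hv x hx.1.le).1
    have hm : StronglyMeasurableAtFilter v (𝓝[>] x) :=
      AEStronglyMeasurable.stronglyMeasurableAtFilter_of_mem (s := Ioc 0 t)
        hint.1.aestronglyMeasurable
        (mem_of_superset (Ioo_mem_nhdsGT hx.2) fun y hy => ⟨hx.1.trans hy.1, hy.2.le⟩)
    have hJd : HasDerivWithinAt J (v x) (Ioi x) x :=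
      (intervalIntegral.integral_hasDerivWithinAt_right (s := Ici x) hi hm (hvr x hx)).mono
        Ioi_subset_Ici_self
    have he : HasDerivWithinAt (fun s => Real.exp (-(lam * (t - s))))
        (lam * Real.exp (-(lam * (t - x)))) (Ioi x) x := by
      have h := ((hasDerivAt_exp_decay hlam t x).mul_const lam).hasDerivWithinAt (s := Ioi x)
      refine (h.congr_deriv (mul_comm _ _)).congr (fun y _ => ?_) ?_ <;> field_simp
    have h := (he.fun_mul hJd).fun_sub
      (((hasDerivAt_exp_decay hlam t x).hasDerivWithinAt (s := Ioi x)).const_mul v₀)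
    refine h.congr_deriv ?_
    rw [(hv x hx.1.le).2]
    ring
  have hcont : ContinuousOn
      (fun s => Real.exp (-(lam * (t - s))) * J s - v₀ * (Real.exp (-(lam * (t - s))) / lam))
      (Icc 0 t) :=
    ((Continuous.continuousOn (by fun_prop)).mul hJc).sub (Continuous.continuousOn (by fun_prop))
  have key := intervalIntegral.integral_eq_sub_of_hasDeriv_right_of_le ht hcont hderiv
    (intervalIntegrable_exp_decay_mul hlam hz t 0 t)
  have hJ0 : J 0 = 0 := by simp [hJ]
  rw [expConv, key, hJ0, decayIntegral]
  simp
  ring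

lemma expConv_nonneg (hz0 : z 0 = 0) (hz : Monotone z) {t : ℝ} (ht : 0 ≤ t) :
    0 ≤ expConv lam z t :=
  intervalIntegral.integral_nonneg ht fun _ _ =>
    mul_nonneg (Real.exp_nonneg _) (hz0 ▸ hz bot_le)

lemma expConv_le (hlam : 0 < lam) (hz : Monotone z) {t : ℝ} (ht : 0 ≤ t) :
    expConv lam z t ≤ decayIntegral lam t * z (lam * t).toNNReal := by
  rw [← integral_exp_decay_zero hlam, ← intervalIntegral.integral_mul_const]
  refine intervalIntegral.integral_mono_on ht (intervalIntegrable_exp_decay_mul hlam hz t 0 t)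
    (Continuous.intervalIntegrable (by fun_prop) _ _) fun s hs => ?_
  exact mul_le_mul_of_nonneg_left (monotone_comp_toNNReal hlam hz hs.2) (Real.exp_nonneg _)

/-- The quantity is `∫ e^{-lam (t - s)} dz(lam s)` integrated by parts, and the kernel lies in
`[e^{-lam t}, 1]` while `z` increases. -/
lemma ouSolution_mem_Icc (hlam : 0 < lam) (hz0 : z 0 = 0) (hz : Monotone z)
    (hzr : ∀ t, ContinuousWithinAt z (Ici t) t)
    (hv : ∀ t : ℝ, 0 ≤ t → IntervalIntegrable v volume 0 t ∧
      v t = v₀ - lam * (∫ s in (0 : ℝ)..t, v s) + z (lam * t).toNNReal) {t : ℝ} (ht : 0 ≤ t) :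
    v t - Real.exp (-(lam * t)) * v₀ ∈
      Icc (Real.exp (-(lam * t)) * z (lam * t).toNNReal) (z (lam * t).toNNReal) := by
  have e : v t - Real.exp (-(lam * t)) * v₀ = z (lam * t).toNNReal - lam * expConv lam z t := by
    rw [(hv t ht).2, integral_ouSolution hlam hz hzr hv ht, decayIntegral]
    field_simp
    ring
  have h1 := expConv_nonneg (lam := lam) hz0 hz ht
  have h2 := expConv_le hlam hz ht
  have h3 : lam * (decayIntegral lam t * z (lam * t).toNNReal) =
      (1 - Real.exp (-(lam * t))) * z (lam * t).toNNReal := by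
    rw [decayIntegral]; field_simp
  rw [e]
  constructor
  · nlinarith [mul_le_mul_of_nonneg_left h2 hlam.le]
  · nlinarith [mul_nonneg hlam.le h1]

end Path

/-! ### The law of the noise, obtained from stationarity. -/

section Law

variable {Ω : Type*} [MeasurableSpace Ω] {Q : Measure Ω} {m : Market} {a b : ℝ}
  {Z : ℝ≥0 → Ω → ℝ} {V : ℝ → Ω → ℝ}

/-- The part of the variance that comes from the driving process. -/
noncomputable def ouNoise (m : Market) (V : ℝ → Ω → ℝ) (t : ℝ) (ω : Ω) : ℝ :=
  V t ω - Real.exp (-(m.lam * t)) * m.v₀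

lemma IsIGOU.ouNoise_mem_Icc (h : IsIGOU Q m a b Z V) {t : ℝ} (ht : 0 ≤ t) :
    ∀ᵐ ω ∂Q, ouNoise m V t ω ∈ Icc (Real.exp (-(m.lam * t)) * Z (m.lam * t).toNNReal ω)
      (Z (m.lam * t).toNNReal ω) := by
  filter_upwards [h.subordinator.start, h.subordinator.mono, h.subordinator.rightCont, h.solution]
    with ω h0 h1 h2 h3
  exact ouSolution_mem_Icc (z := fun t => Z t ω) (v := fun t => V t ω) m.lam_pos h0 h1 h2 h3 ht

lemma IsIGOU.intVar_eq (h : IsIGOU Q m a b Z V) :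
    ∀ᵐ ω ∂Q, intVar m V ω = m.v₀ * decayIntegral m.lam m.T +
      expConv m.lam (fun t => Z t ω) m.T := by
  filter_upwards [h.subordinator.mono, h.subordinator.rightCont, h.solution]
    with ω h1 h2 h3
  exact integral_ouSolution (z := fun t => Z t ω) (v := fun t => V t ω) m.lam_pos h1 h2 h3
    m.T_pos.le

lemma inverseGaussian_ne_zero (ha : 0 < a) (hb : 0 < b) : inverseGaussian a b ≠ 0 := by
  intro h0
  have h := lintegral_exp_inverseGaussian (a := a) (b := b) (θ := 0) ha (by positivity)
  rw [h0, lintegral_zero_measure] at h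
  exact absurd h.symm (ENNReal.ofReal_pos.2 (Real.exp_pos _)).ne'

instance sFinite_inverseGaussian : SFinite (inverseGaussian a b) := by
  unfold inverseGaussian; infer_instance

/-- No measurability of `V` is assumed, but stationarity forces it: the push-forward along a
function that is not a.e. measurable is `0`, and a convolution with `0` is not the inverse Gaussian
law. -/
lemma IsIGOU.aemeasurable_ouNoise (h : IsIGOU Q m a b Z V) {t : ℝ} (ht : 0 ≤ t) :
    AEMeasurable (ouNoise m V t) Q := by
  by_contra hc
  have hs := h.stationaryLaw t ht
  rw [show (fun ω => V t ω - Real.exp (-(m.lam * t)) * m.v₀) = ouNoise m V t from rfl,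
    Measure.map_of_not_aemeasurable hc, Measure.conv_zero] at hs
  exact inverseGaussian_ne_zero h.a_pos h.b_pos hs.symm

/-- The integral equation expresses `I_T` through `V_T` and `Z_{λT}`, so no joint measurability of
`V` is needed. -/
lemma IsIGOU.aemeasurable_intVar (h : IsIGOU Q m a b Z V) : AEMeasurable (intVar m V) Q := by
  have hV : AEMeasurable (V m.T) Q := by
    have := (h.aemeasurable_ouNoise m.T_pos.le).add_const (Real.exp (-(m.lam * m.T)) * m.v₀)
    simpa [ouNoise] using this
  have hm : AEMeasurable
      (fun ω => (m.v₀ - V m.T ω + Z (m.lam * m.T).toNNReal ω) / m.lam) Q :=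
    ((hV.const_sub m.v₀).add (h.subordinator.measurable _).aemeasurable).div_const _
  refine hm.congr ?_
  filter_upwards [h.solution] with ω hω
  have := (hω m.T m.T_pos.le).2
  have hl := m.lam_pos
  rw [intVar]
  field_simp
  linarith

/-- The exponential moment of the convolution in the stationarity equation factorizes, and the
factor of the damped start is positive and finite, so it can be divided out. With values in `[0, ∞]`
no integrability has to be known beforehand. -/
lemma IsIGOU.lintegral_exp_ouNoise [IsProbabilityMeasure Q] (h : IsIGOU Q m a b Z V) {t : ℝ}
    (ht : 0 ≤ t) {θ : ℝ} (hθ : θ < b ^ 2 / 2) :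
    ∫⁻ ω, ENNReal.ofReal (Real.exp (θ * ouNoise m V t ω)) ∂Q =
      ENNReal.ofReal (Real.exp (invGaussianCgf a b θ -
        invGaussianCgf a b (θ * Real.exp (-(m.lam * t))))) := by
  have hl := m.lam_pos
  have hW := h.aemeasurable_ouNoise ht
  have hs := h.stationaryLaw t ht
  rw [show (fun ω => V t ω - Real.exp (-(m.lam * t)) * m.v₀) = ouNoise m V t from rfl] at hs
  have : IsProbabilityMeasure (Q.map (ouNoise m V t)) := Measure.isProbabilityMeasure_map hW
  have hθ' : θ * Real.exp (-(m.lam * t)) < b ^ 2 / 2 := by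
    have h1 : Real.exp (-(m.lam * t)) ≤ 1 := Real.exp_le_one_iff.2 (by nlinarith)
    have h2 := Real.exp_pos (-(m.lam * t))
    rcases le_or_gt θ 0 with h0 | h0
    · have := h.b_pos
      have : 0 < b ^ 2 / 2 := by positivity
      nlinarith
    · nlinarith
  have hl1 := lintegral_exp_inverseGaussian h.a_pos hθ
  have hm : Measurable fun x : ℝ => ENNReal.ofReal (Real.exp (θ * x)) := by fun_prop
  rw [← hs, Measure.lintegral_conv hm] at hl1
  have e : ∀ x y : ℝ, ENNReal.ofReal (Real.exp (θ * (x + y))) =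
      ENNReal.ofReal (Real.exp (θ * x)) * ENNReal.ofReal (Real.exp (θ * y)) := fun x y => by
    rw [mul_add, Real.exp_add, ENNReal.ofReal_mul (Real.exp_nonneg _)]
  simp only [e] at hl1
  simp_rw [lintegral_const_mul _ hm] at hl1
  rw [lintegral_mul_const _ hm, lintegral_map hm (by fun_prop), lintegral_map' hm.aemeasurable hW]
    at hl1
  have h3 := lintegral_exp_inverseGaussian h.a_pos hθ'
  simp only [← mul_assoc] at hl1
  rw [h3] at hl1
  rw [sub_eq_add_neg, Real.exp_add, Real.exp_neg, ENNReal.ofReal_mul (Real.exp_nonneg _), ← hl1,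
    mul_right_comm, ← ENNReal.ofReal_mul (Real.exp_nonneg _),
    mul_inv_cancel₀ (Real.exp_pos _).ne', ENNReal.ofReal_one, one_mul]

lemma IsIGOU.integrable_exp_ouNoise [IsProbabilityMeasure Q] (h : IsIGOU Q m a b Z V) {t : ℝ}
    (ht : 0 ≤ t) {θ : ℝ} (hθ : θ < b ^ 2 / 2) :
    Integrable (fun ω => Real.exp (θ * ouNoise m V t ω)) Q := by
  have hW := h.aemeasurable_ouNoise ht
  refine ⟨(by fun_prop : AEMeasurable _ Q).aestronglyMeasurable, ?_⟩
  rw [hasFiniteIntegral_iff_ofReal (ae_of_all _ fun _ => Real.exp_nonneg _),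
    h.lintegral_exp_ouNoise ht hθ]
  exact ENNReal.ofReal_lt_top

lemma IsIGOU.mgf_ouNoise [IsProbabilityMeasure Q] (h : IsIGOU Q m a b Z V) {t : ℝ}
    (ht : 0 ≤ t) {θ : ℝ} (hθ : θ < b ^ 2 / 2) :
    mgf (ouNoise m V t) Q θ = Real.exp (invGaussianCgf a b θ -
        invGaussianCgf a b (θ * Real.exp (-(m.lam * t)))) := by
  have h1 := h.lintegral_exp_ouNoise ht hθ
  rw [← ofReal_integral_eq_lintegral_ofReal (h.integrable_exp_ouNoise ht hθ)
    (ae_of_all _ fun _ => Real.exp_nonneg _)] at h1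
  exact (ENNReal.ofReal_eq_ofReal_iff (integral_nonneg fun _ => Real.exp_nonneg _)
    (Real.exp_nonneg _)).1 h1

end Law

/-! ### The cumulant generating function of the driving process. -/

section Driver

variable {Ω : Type*} [MeasurableSpace Ω] {Q : Measure Ω} {m : Market} {a b : ℝ}
  {Z : ℝ≥0 → Ω → ℝ} {V : ℝ → Ω → ℝ}

lemma IsSubordinator.nonneg (h : IsSubordinator Q Z) : ∀ᵐ ω ∂Q, ∀ s, 0 ≤ Z s ω := by
  filter_upwards [h.start, h.mono] with ω h0 h1 s
  exact h0 ▸ h1 (show (0 : ℝ≥0) ≤ s from bot_le)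

lemma IsSubordinator.exp_nsmul (h : IsSubordinator Q Z) [IsProbabilityMeasure Q] {s : ℝ≥0} {θ : ℝ}
    (hi : Integrable (fun ω => Real.exp (θ * Z s ω)) Q) (n : ℕ) :
    Integrable (fun ω => Real.exp (θ * Z (n * s) ω)) Q ∧
      mgf (Z (n * s)) Q θ = mgf (Z s) Q θ ^ n := by
  induction n with
  | zero =>
    have h0 : (fun ω => Real.exp (θ * Z ((0 : ℕ) * s) ω)) =ᵐ[Q] fun _ => 1 := by
      filter_upwards [h.start] with ω hω
      simp [hω]
    refine ⟨(integrable_const 1).congr h0.symm, ?_⟩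
    rw [mgf, integral_congr_ae h0]
    simp
  | succ n ih =>
    have e : Z ((n + 1 : ℕ) * s) = Z (n * s) + (Z (n * s + s) - Z (n * s)) := by
      rw [add_sub_cancel]; congr 1; push_cast; ring
    have hind : (Z (n * s)) ⟂ᵢ[Q] (Z (n * s + s) - Z (n * s)) :=
      h.indep.indepFun_eval_sub (r := 0) bot_le le_self_add h.start
    have hid := h.stationary (n * s) s
    have hi' : Integrable (fun ω => Real.exp (θ * (Z (n * s + s) - Z (n * s)) ω)) Q :=
      (hid.comp (u := fun x => Real.exp (θ * x)) (by fun_prop)).integrable_iff.2 hi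
    rw [e]
    refine ⟨hind.integrable_exp_mul_add ih.1 hi', ?_⟩
    rw [hind.mgf_add ih.1.aestronglyMeasurable hi'.aestronglyMeasurable, ih.2, pow_succ]
    congr 1
    exact mgf_congr_of_identDistrib _ _ hid θ

lemma IsIGOU.driver_le_ouNoise (h : IsIGOU Q m a b Z V) (s : ℝ≥0) :
    ∀ᵐ ω ∂Q, ouNoise m V (s / m.lam) ω ≤ Z s ω ∧
      Z s ω ≤ Real.exp s * ouNoise m V (s / m.lam) ω := by
  have hl := m.lam_pos
  have ht : (0 : ℝ) ≤ s / m.lam := by positivity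
  filter_upwards [h.ouNoise_mem_Icc ht] with ω hω
  rw [mul_div_cancel₀ _ hl.ne', Real.toNNReal_coe] at hω
  refine ⟨hω.2, ?_⟩
  have := mul_le_mul_of_nonneg_left hω.1 (Real.exp_nonneg s)
  rwa [← mul_assoc, ← Real.exp_add, add_neg_cancel, Real.exp_zero, one_mul] at this

/-- Write `W` for the noise at time `s / lam`. Then `W ≤ Z_s ≤ e^s W`, and both outer terms have
known exponential moments. The sign of `θ` decides which end is the larger one, hence the unordered
interval. -/
lemma IsIGOU.exp_driver_step [IsProbabilityMeasure Q] (h : IsIGOU Q m a b Z V) {s : ℝ≥0} {θ : ℝ}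
    (hθ : θ < b ^ 2 / 2) (hθs : θ * Real.exp s < b ^ 2 / 2) :
    Integrable (fun ω => Real.exp (θ * Z s ω)) Q ∧ cgf (Z s) Q θ ∈
      uIcc (invGaussianCgf a b (θ * Real.exp s) - invGaussianCgf a b θ)
        (invGaussianCgf a b θ - invGaussianCgf a b (θ * Real.exp (-s))) := by
  have hl := m.lam_pos
  have ht : (0 : ℝ) ≤ s / m.lam := by positivity
  have hdiv : m.lam * (s / m.lam) = s := mul_div_cancel₀ _ hl.ne'
  have hi1 := h.integrable_exp_ouNoise ht hθ
  have hi2 := h.integrable_exp_ouNoise ht hθs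
  have hm1 := h.mgf_ouNoise ht hθ
  have hm2 := h.mgf_ouNoise ht hθs
  rw [hdiv] at hm1 hm2
  rw [mul_assoc, ← Real.exp_add, add_neg_cancel, Real.exp_zero, mul_one] at hm2
  have hmeas : AEStronglyMeasurable (fun ω => Real.exp (θ * Z s ω)) Q := by
    have := h.subordinator.measurable s
    fun_prop
  rcases le_total 0 θ with h0 | h0
  · have hle1 : (fun ω => Real.exp (θ * ouNoise m V (s / m.lam) ω)) ≤ᵐ[Q]
        fun ω => Real.exp (θ * Z s ω) := by
      filter_upwards [h.driver_le_ouNoise s] with ω hω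
      exact Real.exp_le_exp.2 (mul_le_mul_of_nonneg_left hω.1 h0)
    have hle2 : (fun ω => Real.exp (θ * Z s ω)) ≤ᵐ[Q]
        fun ω => Real.exp (θ * Real.exp s * ouNoise m V (s / m.lam) ω) := by
      filter_upwards [h.driver_le_ouNoise s] with ω hω
      rw [mul_assoc]
      exact Real.exp_le_exp.2 (mul_le_mul_of_nonneg_left hω.2 h0)
    have hi : Integrable (fun ω => Real.exp (θ * Z s ω)) Q := by
      refine hi2.mono' hmeas ?_
      filter_upwards [hle2] with ω hω
      rwa [Real.norm_of_nonneg (Real.exp_nonneg _)]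
    refine ⟨hi, Icc_subset_uIcc' ⟨?_, ?_⟩⟩
    · rw [cgf, Real.le_log_iff_exp_le (mgf_pos hi), ← hm1]
      exact integral_mono_ae hi1 hi hle1
    · rw [cgf, Real.log_le_iff_le_exp (mgf_pos hi), ← hm2]
      exact integral_mono_ae hi hi2 hle2
  · have hle1 : (fun ω => Real.exp (θ * Z s ω)) ≤ᵐ[Q]
        fun ω => Real.exp (θ * ouNoise m V (s / m.lam) ω) := by
      filter_upwards [h.driver_le_ouNoise s] with ω hω
      exact Real.exp_le_exp.2 (mul_le_mul_of_nonpos_left hω.1 h0)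
    have hle2 : (fun ω => Real.exp (θ * Real.exp s * ouNoise m V (s / m.lam) ω)) ≤ᵐ[Q]
        fun ω => Real.exp (θ * Z s ω) := by
      filter_upwards [h.driver_le_ouNoise s] with ω hω
      rw [mul_assoc]
      exact Real.exp_le_exp.2 (mul_le_mul_of_nonpos_left hω.2 h0)
    have hi : Integrable (fun ω => Real.exp (θ * Z s ω)) Q := by
      refine hi1.mono' hmeas ?_
      filter_upwards [hle1] with ω hω
      rwa [Real.norm_of_nonneg (Real.exp_nonneg _)]
    refine ⟨hi, Icc_subset_uIcc ⟨?_, ?_⟩⟩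
    · rw [cgf, Real.le_log_iff_exp_le (mgf_pos hi), ← hm2]
      exact integral_mono_ae hi2 hi hle2
    · rw [cgf, Real.log_le_iff_le_exp (mgf_pos hi), ← hm1]
      exact integral_mono_ae hi hi1 hle1

/-- Cumulant generating function of the driving process at time `1`. -/
noncomputable def driverCgf (a b θ : ℝ) : ℝ := a * θ / √(b ^ 2 - 2 * θ)

/-- Links the two functions by `driverCgf a b θ = θ ψ'(θ)`, where `ψ` is `invGaussianCgf a b`. -/
lemma hasDerivAt_invGaussianCgf_exp {θ : ℝ} (hθ : θ < b ^ 2 / 2) (s : ℝ) :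
    HasDerivAt (fun u => invGaussianCgf a b (θ * Real.exp (s * u))) (s * driverCgf a b θ) 0 := by
  have hp : 0 < b ^ 2 - 2 * θ := by linarith
  have h1 := ((((hasDerivAt_id (0 : ℝ)).const_mul s).exp.const_mul θ).const_mul 2).const_sub
    (b ^ 2)
  have h2 := ((h1.sqrt (by simpa using hp.ne')).const_sub b).const_mul a
  refine h2.congr_deriv ?_
  simp [driverCgf]
  field_simp

/-- `Z_s` is a sum of `n + 1` independent copies of `Z_{s/(n+1)}`, so the one-step bounds are
multiplied by `n + 1`. Large `n` keeps `θ e^{s/(n+1)}` below `b²/2`. -/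
lemma IsIGOU.eventually_exp_driver [IsProbabilityMeasure Q] (h : IsIGOU Q m a b Z V) (s : ℝ≥0)
    {θ : ℝ} (hθ : θ < b ^ 2 / 2) :
    ∀ᶠ n : ℕ in atTop, Integrable (fun ω => Real.exp (θ * Z s ω)) Q ∧ cgf (Z s) Q θ ∈
      uIcc ((n + 1) * (invGaussianCgf a b (θ * Real.exp (s * (1 / (n + 1)))) -
          invGaussianCgf a b θ))
        ((n + 1) * (invGaussianCgf a b θ -
          invGaussianCgf a b (θ * Real.exp (s * (-(1 / (n + 1))))))) := by
  have hlim : Tendsto (fun n : ℕ => θ * Real.exp (s * (1 / ((n : ℝ) + 1)))) atTop (𝓝 θ) := by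
    have h1 := (tendsto_one_div_add_atTop_nhds_zero_nat (𝕜 := ℝ)).const_mul (s : ℝ)
    have h2 := ((Real.continuous_exp.tendsto _).comp h1).const_mul θ
    simpa using h2
  filter_upwards [hlim.eventually (gt_mem_nhds hθ)] with n hn
  have hn1 : ((n + 1 : ℕ) : ℝ≥0) ≠ 0 := by positivity
  set σ : ℝ≥0 := s / (n + 1 : ℕ) with hσ
  have hσ' : (σ : ℝ) = s * (1 / ((n : ℝ) + 1)) := by
    rw [hσ]; push_cast; ring
  have e : ((n + 1 : ℕ) : ℝ≥0) * σ = s := by rw [hσ, mul_div_cancel₀ _ hn1]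
  have hstep := h.exp_driver_step (s := σ) hθ (by rwa [hσ'])
  have hpow := h.subordinator.exp_nsmul hstep.1 (n + 1)
  rw [e] at hpow
  refine ⟨hpow.1, ?_⟩
  rw [cgf, hpow.2, Real.log_pow, ← cgf]
  have h3 := hstep.2
  rw [hσ', ← mul_neg] at h3
  push_cast
  rw [← image_const_mul_uIcc]
  exact mem_image_of_mem _ h3

lemma IsIGOU.integrable_exp_driver [IsProbabilityMeasure Q] (h : IsIGOU Q m a b Z V) (s : ℝ≥0)
    {θ : ℝ} (hθ : θ < b ^ 2 / 2) : Integrable (fun ω => Real.exp (θ * Z s ω)) Q :=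
  let ⟨_, hn⟩ := (h.eventually_exp_driver s hθ).exists
  hn.1

/-- The cumulant generating function of the process that drives an inverse Gaussian
Ornstein-Uhlenbeck process. -/
lemma IsIGOU.cgf_driver [IsProbabilityMeasure Q] (h : IsIGOU Q m a b Z V) (s : ℝ≥0)
    {θ : ℝ} (hθ : θ < b ^ 2 / 2) : cgf (Z s) Q θ = s * driverCgf a b θ := by
  have hd := hasDerivAt_iff_tendsto_slope_zero.1
    (hasDerivAt_invGaussianCgf_exp (a := a) (b := b) hθ (s : ℝ))
  have h0 : Tendsto (fun n : ℕ => 1 / ((n : ℝ) + 1)) atTop (𝓝[≠] 0) :=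
    tendsto_nhdsWithin_iff.2 ⟨tendsto_one_div_add_atTop_nhds_zero_nat,
      .of_forall fun n => (by positivity : (1 : ℝ) / (n + 1) ≠ 0)⟩
  have h0' : Tendsto (fun n : ℕ => -(1 / ((n : ℝ) + 1))) atTop (𝓝[≠] 0) :=
    tendsto_nhdsWithin_iff.2
      ⟨by simpa using (tendsto_one_div_add_atTop_nhds_zero_nat (𝕜 := ℝ)).neg,
        .of_forall fun n => (by simp; positivity : -((1 : ℝ) / (n + 1)) ≠ 0)⟩
  have h1 := hd.comp h0
  have h2 := hd.comp h0'
  have h3 : Tendsto (fun _ : ℕ => cgf (Z s) Q θ) atTop (𝓝 (s * driverCgf a b θ)) := by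
    -- Both ends of the interval are difference quotients, with increments `±1/(n+1)`, of one
    -- differentiable function, so they share a limit.
    have hmin := h1.min h2
    have hmax := h1.max h2
    rw [min_self] at hmin
    rw [max_self] at hmax
    refine tendsto_of_tendsto_of_tendsto_of_le_of_le' hmin hmax ?_ ?_
    all_goals
      filter_upwards [h.eventually_exp_driver s hθ] with n hn
      have hn2 := hn.2
      simp only [Function.comp_apply, zero_add, smul_eq_mul, mul_zero, Real.exp_zero, mul_one,
        one_div, inv_inv, inv_neg]
      simp only [one_div] at hn2
      rw [← neg_sub (invGaussianCgf a b (θ * Real.exp (s * (-((n : ℝ) + 1)⁻¹))))] at hn2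
      rw [mul_neg] at hn2
      rw [neg_mul]
    · exact hn2.1
    · exact hn2.2
  exact tendsto_nhds_unique tendsto_const_nhds h3

lemma IsIGOU.mgf_driver [IsProbabilityMeasure Q] (h : IsIGOU Q m a b Z V) (s : ℝ≥0)
    {θ : ℝ} (hθ : θ < b ^ 2 / 2) : mgf (Z s) Q θ = Real.exp (s * driverCgf a b θ) := by
  rw [← h.cgf_driver s hθ, cgf, Real.exp_log (mgf_pos (h.integrable_exp_driver s hθ))]

lemma IsIGOU.kappa_eq [IsProbabilityMeasure Q] (h : IsIGOU Q m a b Z V) {ρ : ℝ} (hρ : ρ ≤ 0) :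
    kappa Q ρ Z = driverCgf a b ρ := by
  have hb := h.b_pos
  have := h.cgf_driver 1 (hρ.trans_lt (by positivity : 0 < b ^ 2 / 2))
  simpa [kappa] using this

end Driver

/-! ### Moments from cumulants. -/

section MomentRecursion

variable {Ω : Type*} [MeasurableSpace Ω] {μ : Measure Ω} {X : Ω → ℝ}

/-- The recursion between moments and cumulants. -/
lemma integral_pow_succ_eq_sum_cumulants [IsProbabilityMeasure μ]
    (h : 0 ∈ interior (integrableExpSet X μ)) (n : ℕ) :
    ∫ ω, X ω ^ (n + 1) ∂μ = ∑ k ∈ Finset.range (n + 1),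
      n.choose k * iteratedDeriv (k + 1) (cgf X μ) 0 * ∫ ω, X ω ^ (n - k) ∂μ := by
  have hm : ∀ n, ∫ ω, X ω ^ n ∂μ = iteratedDeriv n (mgf X μ) 0 := fun n => by
    rw [iteratedDeriv_mgf_zero h]; rfl
  simp only [hm]
  -- The recursion is the Leibniz rule at `0` for `M' = (log M)' M`.
  have hd : deriv (mgf X μ) =ᶠ[𝓝 0] deriv (cgf X μ) * mgf X μ := by
    filter_upwards [isOpen_interior.mem_nhds h] with t ht
    have hp : mgf X μ t ≠ 0 := (mgf_pos (interior_subset ht : t ∈ integrableExpSet X μ)).ne'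
    rw [Pi.mul_apply, deriv_cgf ht, deriv_mgf ht, div_mul_cancel₀ _ hp]
  rw [iteratedDeriv_succ', hd.iteratedDeriv_eq, iteratedDeriv_mul]
  · simp only [iteratedDeriv_succ']
  · exact (analyticAt_cgf h).deriv.contDiffAt
  · exact (analyticAt_mgf h).contDiffAt

end MomentRecursion

/-! ### Scaling of the cumulants of the driver. -/

section DriverCumulants

lemma contDiffAt_driverCgf (a : ℝ) {b θ : ℝ} (hθ : θ < b ^ 2 / 2) (n : ℕ) :
    ContDiffAt ℝ n (driverCgf a b) θ := by
  have hp : 0 < b ^ 2 - 2 * θ := by linarith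
  unfold driverCgf
  refine ContDiffAt.div (by fun_prop) ?_ (Real.sqrt_pos.2 hp).ne'
  exact ContDiffAt.sqrt (by fun_prop) hp.ne'

lemma iteratedDeriv_comp_const_mul' (n : ℕ) (f : ℝ → ℝ) (c : ℝ) :
    iteratedDeriv n (fun x => f (c * x)) = fun x => c ^ n * iteratedDeriv n f (c * x) := by
  induction n with
  | zero => simp
  | succ n ih =>
    funext x
    rw [iteratedDeriv_succ, ih, deriv_const_mul_field, deriv_comp_mul_left, iteratedDeriv_succ,
      smul_eq_mul, pow_succ, mul_assoc]

/-- Hence the `k`-th cumulant of `Z_1` is `a b^{1-2k}` times its value for `a = b = 1`; all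
dependence of the later bounds on `b` comes from here. -/
lemma driverCgf_eq_scale (a : ℝ) {b : ℝ} (hb : 0 < b) (θ : ℝ) :
    driverCgf a b θ = a * b * driverCgf 1 1 (1 / b ^ 2 * θ) := by
  have e : b ^ 2 - 2 * θ = b ^ 2 * (1 ^ 2 - 2 * (1 / b ^ 2 * θ)) := by field_simp
  rw [driverCgf, e, Real.sqrt_mul (sq_nonneg b), Real.sqrt_sq hb.le, driverCgf]
  rcases eq_or_ne (√(1 ^ 2 - 2 * (1 / b ^ 2 * θ))) 0 with h | h
  · rw [h]; simp
  · field_simp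

/-- Absolute values of the cumulants of the driving process for `a = b = 1`. -/
noncomputable def unitCumulant (k : ℕ) : ℝ := |iteratedDeriv k (driverCgf 1 1) 0|

lemma abs_iteratedDeriv_driverCgf_le {a b w W : ℝ} (ha : 0 < a) (hb : 0 < b) (hw : 0 ≤ w)
    (hW : w ≤ W) (k : ℕ) : |iteratedDeriv k (fun θ => driverCgf a b (w * θ)) 0| ≤
      a * b * (W / b ^ 2) ^ k * unitCumulant k := by
  have e : (fun θ => driverCgf a b (w * θ)) =
      fun θ => a * b * (fun θ => driverCgf 1 1 (w / b ^ 2 * θ)) θ := by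
    funext θ
    rw [driverCgf_eq_scale a hb]
    congr 2
    ring
  rw [e, iteratedDeriv_const_mul_field, iteratedDeriv_comp_const_mul']
  simp only [mul_zero]
  rw [abs_mul, abs_of_pos (mul_pos ha hb), abs_mul, unitCumulant, ← mul_assoc,
    abs_of_nonneg (by positivity)]
  gcongr

end DriverCumulants

/-! ### Cumulants of weighted sums of increments. -/

section WeightedIncrements

variable {Ω : Type*} [MeasurableSpace Ω] {Q : Measure Ω} {m : Market} {a b : ℝ}
  {Z : ℝ≥0 → Ω → ℝ} {V : ℝ → Ω → ℝ}

/-- Sum of weighted increments of `Z` over intervals of length `δ`. -/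
def weightedIncr (Z : ℝ≥0 → Ω → ℝ) (δ : ℝ≥0) (w : ℕ → ℝ) (n : ℕ) (ω : Ω) : ℝ :=
  ∑ j ∈ Finset.range n, w j * (Z ((j + 1 : ℕ) * δ) ω - Z (j * δ) ω)

variable {δ : ℝ≥0} {w : ℕ → ℝ} {W : ℝ}

lemma IsIGOU.exp_weightedIncr [IsProbabilityMeasure Q] (h : IsIGOU Q m a b Z V) {θ : ℝ} (n : ℕ)
    (hθ : ∀ j, w j * θ < b ^ 2 / 2) :
    Integrable (fun ω => Real.exp (θ * weightedIncr Z δ w n ω)) Q ∧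
      mgf (weightedIncr Z δ w n) Q θ =
        Real.exp (∑ j ∈ Finset.range n, δ * driverCgf a b (w j * θ)) := by
  have hmono : Monotone fun j : ℕ => (j : ℝ≥0) * δ := fun i j hij => by
    have : (i : ℝ≥0) ≤ j := by exact_mod_cast hij
    exact mul_le_mul_left this δ
  have hid : ∀ j : ℕ, IdentDistrib (fun ω => Z ((j + 1 : ℕ) * δ) ω - Z (j * δ) ω) (Z δ) Q Q := by
    intro j
    have := h.subordinator.stationary (j * δ) δ
    rwa [show ((j + 1 : ℕ) : ℝ≥0) * δ = j * δ + δ by push_cast; ring]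
  have hmeas := h.subordinator.measurable
  have hind : iIndepFun (fun j ω => w j * (Z ((j + 1 : ℕ) * δ) ω - Z (j * δ) ω)) Q :=
    (h.subordinator.indep.nat hmono).comp (fun j x => w j * x) fun j => by fun_prop
  have hm : ∀ j : ℕ, Measurable fun ω => w j * (Z ((j + 1 : ℕ) * δ) ω - Z (j * δ) ω) := fun j =>
    ((hmeas _).sub (hmeas _)).const_mul _
  have e : weightedIncr Z δ w n =
      ∑ j ∈ Finset.range n, fun ω => w j * (Z ((j + 1 : ℕ) * δ) ω - Z (j * δ) ω) := by
    funext ω; simp [weightedIncr]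
  have hi : ∀ j : ℕ, Integrable
      (fun ω => Real.exp (θ * (w j * (Z ((j + 1 : ℕ) * δ) ω - Z (j * δ) ω)))) Q := fun j => by
    have h1 := h.integrable_exp_driver δ (hθ j)
    have h2 := ((hid j).comp (u := fun x => Real.exp (w j * θ * x)) (by fun_prop)).integrable_iff.2 h1
    refine h2.congr (ae_of_all _ fun ω => ?_)
    simp only [Function.comp_apply]
    congr 1; ring
  rw [e]
  refine ⟨hind.integrable_exp_mul_sum hm fun j _ => hi j, ?_⟩
  rw [hind.mgf_sum hm, Real.exp_sum]
  refine Finset.prod_congr rfl fun j _ => ?_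
  rw [mgf_const_mul, mgf_congr_of_identDistrib _ _ (hid j), h.mgf_driver δ (hθ j)]

lemma exists_pos_forall_mul_lt (hb : 0 < b) (hw : ∀ j, 0 ≤ w j) (hW : ∀ j, w j ≤ W) :
    ∃ r > 0, ∀ θ, |θ| < r → ∀ j, w j * θ < b ^ 2 / 2 := by
  have hW0 : 0 ≤ W := (hw 0).trans (hW 0)
  have hb2 : 0 < b ^ 2 / 2 := by positivity
  refine ⟨b ^ 2 / 2 / (W + 1), by positivity, fun θ hθ j => ?_⟩
  rw [lt_div_iff₀ (by positivity)] at hθ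
  have h1 := le_abs_self θ
  have h2 := abs_nonneg θ
  calc w j * θ ≤ w j * |θ| := by gcongr; exact hw j
    _ ≤ W * |θ| := by gcongr; exact hW j
    _ ≤ |θ| * (W + 1) := by nlinarith
    _ < _ := hθ

lemma IsIGOU.zero_mem_interior_weightedIncr [IsProbabilityMeasure Q] (h : IsIGOU Q m a b Z V)
    (hw : ∀ j, 0 ≤ w j) (hW : ∀ j, w j ≤ W) (n : ℕ) (c : ℝ) :
    0 ∈ interior (integrableExpSet (fun ω => weightedIncr Z δ w n ω - c) Q) := by
  obtain ⟨r, hr, hθ⟩ := exists_pos_forall_mul_lt h.b_pos hw hW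
  rw [mem_interior_iff_mem_nhds]
  filter_upwards [Metric.ball_mem_nhds 0 hr] with θ hb
  rw [Metric.mem_ball, dist_zero_right, Real.norm_eq_abs] at hb
  have h1 := ((h.exp_weightedIncr (δ := δ) n (hθ θ hb)).1).mul_const (Real.exp (-(θ * c)))
  refine h1.congr (ae_of_all _ fun ω => ?_)
  simp only [← Real.exp_add]
  congr 1; ring

lemma IsIGOU.cgf_weightedIncr_sub [IsProbabilityMeasure Q] (h : IsIGOU Q m a b Z V)
    (hw : ∀ j, 0 ≤ w j) (hW : ∀ j, w j ≤ W) (n : ℕ) (c : ℝ) :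
    cgf (fun ω => weightedIncr Z δ w n ω - c) Q =ᶠ[𝓝 0]
      fun θ => (∑ j ∈ Finset.range n, δ * driverCgf a b (w j * θ)) - c * θ := by
  obtain ⟨r, hr, hθ⟩ := exists_pos_forall_mul_lt h.b_pos hw hW
  filter_upwards [Metric.ball_mem_nhds 0 hr] with θ hb
  rw [Metric.mem_ball, dist_zero_right, Real.norm_eq_abs] at hb
  have h1 := (h.exp_weightedIncr (δ := δ) n (hθ θ hb)).2
  have h2 : mgf (fun ω => weightedIncr Z δ w n ω - c) Q θ =
      Real.exp ((∑ j ∈ Finset.range n, δ * driverCgf a b (w j * θ)) - c * θ) := by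
    rw [sub_eq_add_neg, Real.exp_add, ← h1, mgf, mgf, ← integral_mul_const]
    refine integral_congr_ae (ae_of_all _ fun ω => ?_)
    simp only [← Real.exp_add]
    congr 1; ring
  rw [cgf, h2, Real.log_exp]

/-- The cumulants of independent increments add up, and a shift by `c` changes only the first of
them. -/
lemma IsIGOU.abs_iteratedDeriv_cgf_le [IsProbabilityMeasure Q] (h : IsIGOU Q m a b Z V)
    (hw : ∀ j, 0 ≤ w j) (hW : ∀ j, w j ≤ W) (n : ℕ) (c : ℝ) {k : ℕ} (hk : c = 0 ∨ 2 ≤ k) :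
    |iteratedDeriv k (cgf (fun ω => weightedIncr Z δ w n ω - c) Q) 0| ≤
      n * δ * (a * b * (W / b ^ 2) ^ k * unitCumulant k) := by
  have hb2 : (0 : ℝ) < b ^ 2 / 2 := by have := h.b_pos; positivity
  have hcd : ∀ j, ContDiffAt ℝ k (fun θ => driverCgf a b (w j * θ)) 0 := fun j =>
    ContDiffAt.comp (g := driverCgf a b) 0
      (contDiffAt_driverCgf a (by simpa using hb2) k) (by fun_prop)
  have hcd' : ∀ j, ContDiffAt ℝ k (fun θ => (δ : ℝ) * driverCgf a b (w j * θ)) 0 := fun j =>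
    contDiffAt_const.mul (hcd j)
  have e1 : iteratedDeriv k (fun θ => c * θ) 0 = 0 := by
    rcases hk with rfl | hk
    · have : (fun θ : ℝ => (0 : ℝ) * θ) = fun _ => 0 := by funext; simp
      rw [this]
      simp
    · rw [iteratedDeriv_const_mul_field]
      simp [iteratedDeriv_fun_id_zero, show k ≠ 1 by omega]
  have e2 : iteratedDeriv k (cgf (fun ω => weightedIncr Z δ w n ω - c) Q) 0 =
      ∑ j ∈ Finset.range n, δ * iteratedDeriv k (fun θ => driverCgf a b (w j * θ)) 0 := by
    rw [(h.cgf_weightedIncr_sub hw hW n c).iteratedDeriv_eq]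
    have := iteratedDeriv_sub (n := k)
      (f := fun θ => ∑ j ∈ Finset.range n, (δ : ℝ) * driverCgf a b (w j * θ))
      (g := fun θ => c * θ) (x := 0) (ContDiffAt.sum fun j _ => hcd' j) (by fun_prop)
    refine this.trans ?_
    rw [e1, sub_zero, iteratedDeriv_fun_sum fun j _ => hcd' j]
    exact Finset.sum_congr rfl fun j _ => iteratedDeriv_const_mul _ (hcd j)
  rw [e2]
  calc _ ≤ ∑ j ∈ Finset.range n, |δ * iteratedDeriv k (fun θ => driverCgf a b (w j * θ)) 0| :=
        Finset.abs_sum_le_sum_abs _ _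
    _ ≤ ∑ j ∈ Finset.range n, δ * (a * b * (W / b ^ 2) ^ k * unitCumulant k) := by
        refine Finset.sum_le_sum fun j _ => ?_
        rw [abs_mul, abs_of_nonneg δ.coe_nonneg]
        exact mul_le_mul_of_nonneg_left
          (abs_iteratedDeriv_driverCgf_le h.a_pos h.b_pos (hw j) (hW j) k) δ.coe_nonneg
    _ = _ := by rw [Finset.sum_const, Finset.card_range, nsmul_eq_mul]; ring

end WeightedIncrements

/-! ### Moment bounds from the recursion. -/

section MomentBounds

/-- A bound for moments whose cumulants are bounded by those of the driving process. -/
lemma exists_moment_bound (γ : ℕ → ℝ) (hγ : ∀ k, 0 ≤ γ k) (n : ℕ) :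
    ∃ C : ℝ, 0 ≤ C ∧ ∀ (B y : ℝ) (μ c : ℕ → ℝ), 0 ≤ B → 0 ≤ y → μ 0 = 1 →
      (∀ k, |c (k + 1)| ≤ B * y ^ (2 * k + 1) * γ (k + 1)) →
      (∀ n, μ (n + 1) = ∑ k ∈ Finset.range (n + 1), n.choose k * c (k + 1) * μ (n - k)) →
      1 ≤ n → |μ n| ≤ C * (B * y ^ n * (1 + B + y) ^ (2 * n)) := by
  induction n using Nat.strong_induction_on with
  | _ n ih =>
    choose! D hD0 hD using ih
    rcases n with _ | n
    · exact ⟨0, le_rfl, fun _ _ _ _ _ _ _ _ _ h => absurd h (by norm_num)⟩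
    -- In `1 + D (n - k)` the `1` serves the term `k = n`, where `μ 0 = 1`; the `D` serves the other
    -- terms.
    refine ⟨∑ k ∈ Finset.range (n + 1), n.choose k * (γ (k + 1) * (1 + D (n - k))),
      Finset.sum_nonneg fun k hk => ?_, fun B y μ c hB hy h0 hc hrec _ => ?_⟩
    · have := hD0 (n - k) (by omega)
      have := hγ (k + 1)
      positivity
    · rw [hrec, Finset.sum_mul]
      refine (Finset.abs_sum_le_sum_abs _ _).trans (Finset.sum_le_sum fun k hk => ?_)
      have hk' : k ≤ n := by simpa [Nat.lt_succ_iff] using hk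
      rw [abs_mul, abs_mul, Nat.abs_cast, mul_assoc, mul_assoc (n.choose k : ℝ)]
      refine mul_le_mul_of_nonneg_left ?_ (Nat.cast_nonneg _)
      have hU : 1 ≤ 1 + B + y := by linarith
      have hBU : B ≤ 1 + B + y := by linarith
      have hyU : y ≤ 1 + B + y := by linarith
      set U := 1 + B + y
      have hU0 : 0 ≤ U := by linarith
      have hg := hγ (k + 1)
      have hDk := hD0 (n - k) (by omega)
      -- The case `k = n` is separate because `μ 0` carries no factor `B`. For `k < n` the product
      -- is of order `B y^{n+1}` times `B y^k`, and this excess goes into powers of `U`.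
      rcases hk'.eq_or_lt with rfl | hlt
      · rw [Nat.sub_self] at hDk
        rw [Nat.sub_self, h0, abs_one, mul_one]
        have h1 : y ^ k ≤ U ^ (2 * (k + 1)) :=
          (pow_le_pow_left₀ hy hyU k).trans (pow_le_pow_right₀ hU (by omega))
        calc _ ≤ B * y ^ (2 * k + 1) * γ (k + 1) := hc k
          _ = γ (k + 1) * 1 * (B * y ^ (k + 1) * y ^ k) := by ring
          _ ≤ γ (k + 1) * (1 + D 0) * (B * y ^ (k + 1) * U ^ (2 * (k + 1))) := by
              gcongr; linarith
      · have hm := hD (n - k) (by omega) B y μ c hB hy h0 hc hrec (by omega)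
        have h1 : B * y ^ k ≤ U ^ (2 * k + 2) :=
          calc B * y ^ k ≤ U * U ^ k := by gcongr
            _ = U ^ (k + 1) := by ring
            _ ≤ _ := pow_le_pow_right₀ hU (by omega)
        calc _ ≤ B * y ^ (2 * k + 1) * γ (k + 1) *
              (D (n - k) * (B * y ^ (n - k) * U ^ (2 * (n - k)))) := by gcongr; exact hc k
          _ = γ (k + 1) * D (n - k) * (B * (y ^ (k + 1) * y ^ (n - k)) *
              ((B * y ^ k) * U ^ (2 * (n - k)))) := by ring
          _ = γ (k + 1) * D (n - k) * (B * y ^ (n + 1) * ((B * y ^ k) * U ^ (2 * (n - k)))) := by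
              rw [← pow_add, show k + 1 + (n - k) = n + 1 by omega]
          _ ≤ γ (k + 1) * (1 + D (n - k)) * (B * y ^ (n + 1) *
              (U ^ (2 * k + 2) * U ^ (2 * (n - k)))) := by
              gcongr; linarith
          _ = _ := by rw [← pow_add, show 2 * k + 2 + 2 * (n - k) = 2 * (n + 1) by omega]

/-- A bound for central moments whose cumulants are bounded by those of the driving process;
the higher ones are of a smaller order in `y`. -/
lemma exists_central_moment_bound (γ : ℕ → ℝ) (hγ : ∀ k, 0 ≤ γ k) (n : ℕ) :
    ∃ C : ℝ, 0 ≤ C ∧ ∀ (A x y : ℝ) (μ c : ℕ → ℝ), 0 ≤ A → 0 ≤ x → 0 ≤ y → μ 0 = 1 → c 1 = 0 →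
      (∀ k, 1 ≤ k → |c (k + 1)| ≤ A * x ^ k * y ^ (2 * k + 1) * γ (k + 1)) →
      (∀ n, μ (n + 1) = ∑ k ∈ Finset.range (n + 1), n.choose k * c (k + 1) * μ (n - k)) →
      ∀ e ≤ 1, 1 + 2 * e ≤ n →
        |μ n| ≤ C * (A * x * y ^ (n + 1) * y ^ e * (1 + A + x + y) ^ (2 * n)) := by
  induction n using Nat.strong_induction_on with
  | _ n ih =>
    choose! D hD0 hD using ih
    rcases n with _ | n
    · exact ⟨0, le_rfl, fun _ _ _ _ _ _ _ _ _ _ _ _ e _ h => absurd h (by omega)⟩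
    refine ⟨∑ k ∈ Finset.range (n + 1), n.choose k * (γ (k + 1) * (1 + D (n - k))),
      Finset.sum_nonneg fun k hk => ?_, fun A x y μ c hA hx hy h0 hc1 hc hrec e he hen => ?_⟩
    · have := hD0 (n - k) (by omega)
      have := hγ (k + 1)
      positivity
    · rw [hrec, Finset.sum_mul]
      refine (Finset.abs_sum_le_sum_abs _ _).trans (Finset.sum_le_sum fun k hk => ?_)
      have hk' : k ≤ n := by simpa [Nat.lt_succ_iff] using hk
      rw [abs_mul, abs_mul, Nat.abs_cast, mul_assoc, mul_assoc (n.choose k : ℝ)]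
      refine mul_le_mul_of_nonneg_left ?_ (Nat.cast_nonneg _)
      have hU : 1 ≤ 1 + A + x + y := by linarith
      have hAU : A ≤ 1 + A + x + y := by linarith
      have hxU : x ≤ 1 + A + x + y := by linarith
      have hyU : y ≤ 1 + A + x + y := by linarith
      set U := 1 + A + x + y
      have hU0 : 0 ≤ U := by linarith
      have hg := hγ (k + 1)
      have hDk := hD0 (n - k) (by omega)
      -- The first cumulant vanishes. In every other term the cumulant brings at least `y ^ 3`,
      -- which is the source of the gain over the uncentered bound.
      rcases Nat.eq_zero_or_pos k with rfl | hk0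
      · rw [zero_add, hc1, abs_zero, zero_mul]
        positivity
      obtain ⟨k, rfl⟩ := Nat.exists_eq_add_of_le' (show 1 ≤ k from hk0)
      rcases hk'.eq_or_lt with rfl | hlt
      · rw [Nat.sub_self] at hDk
        rw [Nat.sub_self, h0, abs_one, mul_one]
        -- Here `1 + 2 * e ≤ n` matters: the second moment is of order `y ^ 3` and has no spare
        -- factor `y`, while higher cumulants do.
        obtain ⟨l, hl⟩ := Nat.exists_eq_add_of_le (show e ≤ k by omega)
        have h1 : x ^ k * y ^ l ≤ U ^ (2 * (k + 1 + 1)) :=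
          calc x ^ k * y ^ l ≤ U ^ k * U ^ l := by gcongr
            _ = U ^ (k + l) := by ring
            _ ≤ _ := pow_le_pow_right₀ hU (by omega)
        have h2 : y ^ (2 * (k + 1) + 1) = y ^ (k + 1 + 1 + 1) * y ^ e * y ^ l := by
          rw [← pow_add, ← pow_add]; congr 1; omega
        calc _ ≤ A * x ^ (k + 1) * y ^ (2 * (k + 1) + 1) * γ (k + 1 + 1) := hc _ hk0
          _ = γ (k + 1 + 1) * 1 * (A * x * y ^ (k + 1 + 1 + 1) * y ^ e * (x ^ k * y ^ l)) := by
              rw [h2]; ring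
          _ ≤ _ := by
              gcongr; linarith
      · have hm := hD (n - (k + 1)) (by omega) A x y μ c hA hx hy h0 hc1 hc hrec 0 (by omega)
          (by omega)
        obtain ⟨l, hl⟩ := Nat.exists_eq_add_of_le (show e ≤ k + 1 by omega)
        have h1 : A * x ^ (k + 1) * y ^ l ≤ U ^ (2 * (k + 1) + 2) :=
          calc A * x ^ (k + 1) * y ^ l ≤ U * U ^ (k + 1) * U ^ l := by gcongr
            _ = U ^ (1 + (k + 1) + l) := by ring
            _ ≤ _ := pow_le_pow_right₀ hU (by omega)
        have h2 : y ^ (2 * (k + 1) + 1) * y ^ (n - (k + 1) + 1) =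
            y ^ (n + 1 + 1) * y ^ e * y ^ l := by
          simp only [← pow_add]; congr 1; omega
        calc _ ≤ A * x ^ (k + 1) * y ^ (2 * (k + 1) + 1) * γ (k + 1 + 1) *
              (D (n - (k + 1)) * (A * x * y ^ (n - (k + 1) + 1) * y ^ 0 *
                U ^ (2 * (n - (k + 1))))) := by gcongr; exact hc _ hk0
          _ = γ (k + 1 + 1) * D (n - (k + 1)) * (A * x *
              (y ^ (2 * (k + 1) + 1) * y ^ (n - (k + 1) + 1)) *
              ((A * x ^ (k + 1)) * U ^ (2 * (n - (k + 1))))) := by ring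
          _ = γ (k + 1 + 1) * D (n - (k + 1)) * (A * x * y ^ (n + 1 + 1) * y ^ e *
              ((A * x ^ (k + 1) * y ^ l) * U ^ (2 * (n - (k + 1))))) := by rw [h2]; ring
          _ ≤ γ (k + 1 + 1) * (1 + D (n - (k + 1))) * (A * x * y ^ (n + 1 + 1) * y ^ e *
              (U ^ (2 * (k + 1) + 2) * U ^ (2 * (n - (k + 1))))) := by
              gcongr; linarith
          _ = _ := by rw [← pow_add, show 2 * (k + 1) + 2 + 2 * (n - (k + 1)) = 2 * (n + 1) by omega]

end MomentBounds

/-! ### Riemann sums for the integrated variance. -/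

section RiemannSum

variable {lam : ℝ} {z : ℝ≥0 → ℝ}

/-- Weights of the increments in the Riemann sums for `expConv`. -/
noncomputable def riemannWeight (lam : ℝ) (δ : ℝ≥0) (n j : ℕ) : ℝ :=
  decayIntegral lam ((n - (j + 1) : ℕ) * (δ / lam))

lemma decayIntegral_nonneg (hlam : 0 < lam) {t : ℝ} (ht : 0 ≤ t) : 0 ≤ decayIntegral lam t := by
  rcases ht.eq_or_lt with rfl | h
  · simp [decayIntegral]
  · exact (decayIntegral_pos hlam h).le

lemma riemannWeight_nonneg (hlam : 0 < lam) (δ : ℝ≥0) (n j : ℕ) : 0 ≤ riemannWeight lam δ n j :=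
  decayIntegral_nonneg hlam (by positivity)

lemma riemannWeight_le (hlam : 0 < lam) (δ : ℝ≥0) (n j : ℕ) :
    riemannWeight lam δ n j ≤ 1 / lam :=
  decayIntegral_le hlam _

/-- Summation by parts: a left-endpoint sum for `expConv` becomes a weighted sum of increments,
whose cumulants are available because the increments of `Z` are independent. -/
lemma sum_riemannWeight_mul (hlam : 0 < lam) (hz0 : z 0 = 0) (δ : ℝ≥0) (n : ℕ) :
    ∑ j ∈ Finset.range n, riemannWeight lam δ n j * (z ((j + 1 : ℕ) * δ) - z (j * δ)) =
      ∑ j ∈ Finset.range n, (∫ s in (j * (δ / lam) : ℝ)..((j + 1 : ℕ) * (δ / lam) : ℝ),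
        Real.exp (-(lam * (n * (δ / lam) - s)))) * z (j * δ) := by
  set E : ℕ → ℝ := fun j => decayIntegral lam ((n - j : ℕ) * (δ / lam)) with hE
  have hk : ∀ j ∈ Finset.range n, ∫ s in (j * (δ / lam) : ℝ)..((j + 1 : ℕ) * (δ / lam) : ℝ),
      Real.exp (-(lam * (n * (δ / lam) - s))) = E j - E (j + 1) := by
    intro j hj
    have hj : j + 1 ≤ n := Finset.mem_range.1 hj
    rw [integral_exp_decay hlam]
    simp only [hE, decayIntegral]
    rw [Nat.cast_sub hj, Nat.cast_sub (by omega : j ≤ n), ← sub_mul, ← sub_mul]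
    ring
  have h1 : ∀ j ∈ Finset.range n, riemannWeight lam δ n j * (z ((j + 1 : ℕ) * δ) - z (j * δ)) =
      (E (j + 1) * z ((j + 1 : ℕ) * δ) - E j * z (j * δ)) +
      (∫ s in (j * (δ / lam) : ℝ)..((j + 1 : ℕ) * (δ / lam) : ℝ),
        Real.exp (-(lam * (n * (δ / lam) - s)))) * z (j * δ) := by
    intro j hj
    rw [hk j hj]
    simp only [hE, riemannWeight]
    ring
  rw [Finset.sum_congr rfl h1, Finset.sum_add_distrib,
    Finset.sum_range_sub (fun j => E j * z (j * δ))]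
  simp [hE, hz0, decayIntegral]

/-- Convergence rate of the Riemann sums for `expConv`. -/
lemma expConv_sub_riemannSum_mem_Icc (hlam : 0 < lam) (hz0 : z 0 = 0) (hz : Monotone z) (δ : ℝ≥0)
    (n : ℕ) : expConv lam z (n * (δ / lam)) -
      ∑ j ∈ Finset.range n, riemannWeight lam δ n j * (z ((j + 1 : ℕ) * δ) - z (j * δ)) ∈
      Icc 0 (δ / lam * z (n * δ)) := by
  set h : ℝ := δ / lam with hh
  have h0 : 0 ≤ h := by positivity
  have hcell : ∀ j : ℕ, z (lam * (j * h)).toNNReal = z (j * δ) := fun j => by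
    congr 1
    rw [hh, show lam * (j * (δ / lam)) = ((j * δ : ℝ≥0) : ℝ) by push_cast; field_simp,
      Real.toNNReal_coe]
  have hii : ∀ p q : ℝ, IntervalIntegrable
      (fun s => Real.exp (-(lam * (n * h - s))) * z (lam * s).toNNReal) volume p q := fun p q =>
    intervalIntegrable_exp_decay_mul hlam hz _ _ _
  have hie : ∀ p q : ℝ, IntervalIntegrable
      (fun s => Real.exp (-(lam * (n * h - s)))) volume p q := fun p q =>
    Continuous.intervalIntegrable (by fun_prop) _ _
  have hsplit : expConv lam z (n * h) = ∑ j ∈ Finset.range n,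
      ∫ s in (j * h : ℝ)..((j + 1 : ℕ) * h : ℝ),
        Real.exp (-(lam * (n * h - s))) * z (lam * s).toNNReal := by
    have := intervalIntegral.sum_integral_adjacent_intervals (μ := volume)
      (f := fun s => Real.exp (-(lam * (n * h - s))) * z (lam * s).toNNReal)
      (a := fun j : ℕ => j * h) (n := n) (fun _ _ => hii _ _)
    rw [this, expConv]
    simp
  rw [sum_riemannWeight_mul hlam hz0, hsplit, ← Finset.sum_sub_distrib]
  have hle : ∀ j : ℕ, (j * h : ℝ) ≤ (j + 1 : ℕ) * h := fun j => by push_cast; nlinarith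
  have hterm : ∀ j : ℕ, (∫ s in (j * h : ℝ)..((j + 1 : ℕ) * h : ℝ),
      Real.exp (-(lam * (n * h - s))) * z (lam * s).toNNReal) -
      (∫ s in (j * h : ℝ)..((j + 1 : ℕ) * h : ℝ), Real.exp (-(lam * (n * h - s)))) * z (j * δ) =
      ∫ s in (j * h : ℝ)..((j + 1 : ℕ) * h : ℝ),
        Real.exp (-(lam * (n * h - s))) * (z (lam * s).toNNReal - z (j * δ)) := fun j => by
    rw [← intervalIntegral.integral_mul_const,
      ← intervalIntegral.integral_sub (hii _ _) ((hie _ _).mul_const _)]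
    simp only [mul_sub]
  constructor
  · refine Finset.sum_nonneg fun j _ => ?_
    rw [hterm]
    refine intervalIntegral.integral_nonneg (hle j) fun s hs => ?_
    refine mul_nonneg (Real.exp_nonneg _) (sub_nonneg.2 ?_)
    rw [← hcell]
    exact monotone_comp_toNNReal hlam hz hs.1
  -- On each cell the error is at most the mesh times the increment of `z`, because the kernel is at
  -- most `1`; the increments telescope.
  · have hbd : ∀ j ∈ Finset.range n, (∫ s in (j * h : ℝ)..((j + 1 : ℕ) * h : ℝ),
        Real.exp (-(lam * (n * h - s))) * z (lam * s).toNNReal) -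
        (∫ s in (j * h : ℝ)..((j + 1 : ℕ) * h : ℝ), Real.exp (-(lam * (n * h - s)))) * z (j * δ) ≤
        h * (z ((j + 1 : ℕ) * δ) - z (j * δ)) := by
      intro j hj
      have hj : ((j + 1 : ℕ) : ℝ) ≤ n := by exact_mod_cast Finset.mem_range.1 hj
      rw [hterm]
      calc _ ≤ ∫ _ in (j * h : ℝ)..((j + 1 : ℕ) * h : ℝ), (z ((j + 1 : ℕ) * δ) - z (j * δ)) := by
            refine intervalIntegral.integral_mono_on (hle j) ?_ (by simp) fun s hs => ?_
            · refine ((hii _ _).sub ((hie _ _).mul_const (z (j * δ)))).congr (fun s _ => ?_)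
              exact (mul_sub _ _ _).symm
            · have h1 : Real.exp (-(lam * (n * h - s))) ≤ 1 := by
                have : s ≤ n * h := hs.2.trans (by gcongr)
                refine Real.exp_le_one_iff.2 ?_
                nlinarith
              have h2 : z (lam * s).toNNReal ≤ z ((j + 1 : ℕ) * δ) := by
                rw [← hcell]
                exact monotone_comp_toNNReal hlam hz hs.2
              have h3 : z (j * δ) ≤ z (lam * s).toNNReal := by
                rw [← hcell]
                exact monotone_comp_toNNReal hlam hz hs.1
              calc _ ≤ 1 * (z (lam * s).toNNReal - z (j * δ)) := by
                    gcongr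
                _ ≤ _ := by linarith
        _ = _ := by
            rw [intervalIntegral.integral_const, smul_eq_mul]
            push_cast; ring
    refine (Finset.sum_le_sum hbd).trans (le_of_eq ?_)
    rw [← Finset.mul_sum, Finset.sum_range_sub (fun j : ℕ => z (j * δ))]
    simp [hz0]

end RiemannSum

/-! ### Moments of the driver and central moments of the integrated variance. -/

section Moments

variable {Ω : Type*} [MeasurableSpace Ω] {Q : Measure Ω} {m : Market} {a b : ℝ}
  {Z : ℝ≥0 → Ω → ℝ} {V : ℝ → Ω → ℝ}

/-- The constants in the moment bounds for the driving process. -/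
noncomputable def driverMomentConst (n : ℕ) : ℝ :=
  (exists_moment_bound unitCumulant (fun _ => abs_nonneg _) n).choose

/-- The constants in the central moment bounds for the integrated variance. -/
noncomputable def centralMomentConst (n : ℕ) : ℝ :=
  (exists_central_moment_bound unitCumulant (fun _ => abs_nonneg _) n).choose

lemma driverMomentConst_nonneg (n : ℕ) : 0 ≤ driverMomentConst n :=
  (exists_moment_bound unitCumulant (fun _ => abs_nonneg _) n).choose_spec.1

lemma centralMomentConst_nonneg (n : ℕ) : 0 ≤ centralMomentConst n :=
  (exists_central_moment_bound unitCumulant (fun _ => abs_nonneg _) n).choose_spec.1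

/-- The bound for the moments of the driving process at expiration. -/
noncomputable def driverMomentBound (m : Market) (a b : ℝ) (n : ℕ) : ℝ :=
  driverMomentConst n * (a * m.lam * m.T * (1 / b) ^ n *
    (1 + a * m.lam * m.T + 1 / b) ^ (2 * n))

/-- The bound for the central moments of the integrated variance; `e = 1` gives an additional
factor `1 / b`. -/
noncomputable def centralMomentBound (m : Market) (a b : ℝ) (n e : ℕ) : ℝ :=
  centralMomentConst n * (a * m.T * (1 / m.lam) * (1 / b) ^ (n + 1) * (1 / b) ^ e *
    (1 + a * m.T + 1 / m.lam + 1 / b) ^ (2 * n))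

/-- The time horizon of the driving process. -/
noncomputable def driverHorizon (m : Market) : ℝ≥0 := (m.lam * m.T).toNNReal

lemma coe_driverHorizon (m : Market) : (driverHorizon m : ℝ) = m.lam * m.T :=
  Real.coe_toNNReal _ (mul_pos m.lam_pos m.T_pos).le

lemma IsIGOU.weightedIncr_one_eq (h : IsIGOU Q m a b Z V) :
    weightedIncr Z (driverHorizon m) (fun _ => 1) 1 =ᵐ[Q] Z (driverHorizon m) := by
  filter_upwards [h.subordinator.start] with ω hω
  simp [weightedIncr, hω]

lemma IsIGOU.integrable_driver_add_pow [IsProbabilityMeasure Q] (h : IsIGOU Q m a b Z V) (c : ℝ)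
    (n : ℕ) : Integrable (fun ω => (Z (driverHorizon m) ω + c) ^ n) Q := by
  refine (integrable_pow_of_mem_interior_integrableExpSet
    (h.zero_mem_interior_weightedIncr (δ := driverHorizon m) (w := fun _ => 1) (W := 1)
      (fun _ => zero_le_one) (fun _ => le_rfl) 1 (-c)) n).congr ?_
  filter_upwards [h.weightedIncr_one_eq] with ω hω
  rw [hω, sub_neg_eq_add]

lemma IsIGOU.integral_driver_pow_le [IsProbabilityMeasure Q] (h : IsIGOU Q m a b Z V) {n : ℕ}
    (hn : 1 ≤ n) : ∫ ω, Z (driverHorizon m) ω ^ n ∂Q ≤ driverMomentBound m a b n := by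
  have ha := h.a_pos
  have hb := h.b_pos
  have hl := m.lam_pos
  have hT := m.T_pos
  set X : Ω → ℝ := fun ω => weightedIncr Z (driverHorizon m) (fun _ => 1) 1 ω - 0 with hX
  have h0 := h.zero_mem_interior_weightedIncr (δ := driverHorizon m) (w := fun _ => 1) (W := 1)
      (fun _ => zero_le_one) (fun _ => le_rfl) 1 0
  have hc : ∀ k, |iteratedDeriv (k + 1) (cgf X Q) 0| ≤
      a * m.lam * m.T * (1 / b) ^ (2 * k + 1) * unitCumulant (k + 1) := fun k => by
    refine (h.abs_iteratedDeriv_cgf_le (δ := driverHorizon m) (w := fun _ => 1) (W := 1)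
      (fun _ => zero_le_one) (fun _ => le_rfl) 1 0 (k := k + 1) (Or.inl rfl)).trans (le_of_eq ?_)
    rw [coe_driverHorizon, show (1 : ℝ) / b ^ 2 = (1 / b) ^ 2 by ring, ← pow_mul,
      show 2 * (k + 1) = 2 * k + 1 + 1 by ring, pow_succ (1 / b) (2 * k + 1)]
    push_cast
    field_simp
  have key := (exists_moment_bound unitCumulant (fun _ => abs_nonneg _) n).choose_spec.2
    (a * m.lam * m.T) (1 / b) (fun n => ∫ ω, X ω ^ n ∂Q)
    (fun k => iteratedDeriv k (cgf X Q) 0) (by positivity) (by positivity) (by simp) hc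
    (integral_pow_succ_eq_sum_cumulants h0) hn
  have e : ∫ ω, Z (driverHorizon m) ω ^ n ∂Q = ∫ ω, X ω ^ n ∂Q := by
    refine integral_congr_ae ?_
    filter_upwards [h.weightedIncr_one_eq] with ω hω
    rw [hX]
    simp only [sub_zero, hω]
  rw [e]
  exact (le_abs_self _).trans key

/-- The Riemann sums for the random part of the integrated variance. -/
noncomputable def riemannVar (m : Market) (Z : ℝ≥0 → Ω → ℝ) (n : ℕ) : Ω → ℝ :=
  weightedIncr Z (driverHorizon m / n) (riemannWeight m.lam (driverHorizon m / n) n) n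

/-- The random part of the integrated variance. -/
noncomputable def randomVar (m : Market) (Z : ℝ≥0 → Ω → ℝ) (ω : Ω) : ℝ :=
  expConv m.lam (fun t => Z t ω) m.T

lemma natCast_mul_driverHorizon_div (m : Market) {n : ℕ} (hn : n ≠ 0) :
    (n : ℝ≥0) * (driverHorizon m / n) = driverHorizon m :=
  mul_div_cancel₀ _ (by exact_mod_cast hn)

/-- Supplies both ingredients of dominated convergence: the common majorant `Z_{λT} / λ` and an
error of order `1/n`. -/
lemma IsIGOU.riemannVar_bounds (h : IsIGOU Q m a b Z V) : ∀ᵐ ω ∂Q, ∀ n : ℕ, n ≠ 0 →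
    0 ≤ riemannVar m Z n ω ∧ riemannVar m Z n ω ≤ Z (driverHorizon m) ω / m.lam ∧
      randomVar m Z ω - riemannVar m Z n ω ∈ Icc 0 (m.T / n * Z (driverHorizon m) ω) := by
  have hl := m.lam_pos
  filter_upwards [h.subordinator.start, h.subordinator.mono] with ω h0 h1 n hn
  have hn' : (n : ℝ) ≠ 0 := by exact_mod_cast hn
  have hδ := natCast_mul_driverHorizon_div m hn
  set δ := driverHorizon m / n with hδdef
  have hinc : ∀ j : ℕ, 0 ≤ Z ((j + 1 : ℕ) * δ) ω - Z (j * δ) ω := fun j =>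
    sub_nonneg.2 (h1 (mul_le_mul_left (by exact_mod_cast Nat.le_succ j) δ))
  have he : riemannVar m Z n ω = ∑ j ∈ Finset.range n,
      riemannWeight m.lam δ n j * (Z ((j + 1 : ℕ) * δ) ω - Z (j * δ) ω) := rfl
  rw [he]
  refine ⟨Finset.sum_nonneg fun j _ => mul_nonneg (riemannWeight_nonneg hl _ _ _) (hinc j), ?_, ?_⟩
  · calc _ ≤ ∑ j ∈ Finset.range n, 1 / m.lam * (Z ((j + 1 : ℕ) * δ) ω - Z (j * δ) ω) :=
          Finset.sum_le_sum fun j _ =>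
            mul_le_mul_of_nonneg_right (riemannWeight_le hl _ _ _) (hinc j)
      _ = _ := by
          rw [← Finset.mul_sum, Finset.sum_range_sub (fun j : ℕ => Z (j * δ) ω), hδ]
          simp [h0]
          ring
  · have := expConv_sub_riemannSum_mem_Icc (z := fun t => Z t ω) hl h0 h1 δ n
    have hc : (δ : ℝ) = m.lam * m.T / n := by
      rw [hδdef]; push_cast; rw [coe_driverHorizon]
    rw [hδ, hc, show (n : ℝ) * (m.lam * m.T / n / m.lam) = m.T by field_simp,
      show m.lam * m.T / n / m.lam = m.T / n by field_simp] at this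
    exact this

lemma IsIGOU.randomVar_bounds (h : IsIGOU Q m a b Z V) : ∀ᵐ ω ∂Q,
    0 ≤ randomVar m Z ω ∧ randomVar m Z ω ≤ Z (driverHorizon m) ω / m.lam := by
  filter_upwards [h.subordinator.start, h.subordinator.mono, h.subordinator.nonneg] with ω h0 h1 h2
  refine ⟨expConv_nonneg h0 h1 m.T_pos.le, (expConv_le m.lam_pos h1 m.T_pos.le).trans ?_⟩
  calc _ ≤ 1 / m.lam * Z (driverHorizon m) ω :=
        mul_le_mul_of_nonneg_right (decayIntegral_le m.lam_pos _) (h2 _)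
    _ = _ := by ring

lemma IsIGOU.tendsto_riemannVar (h : IsIGOU Q m a b Z V) : ∀ᵐ ω ∂Q,
    Tendsto (fun n : ℕ => riemannVar m Z (n + 1) ω) atTop (𝓝 (randomVar m Z ω)) := by
  filter_upwards [h.riemannVar_bounds] with ω hω
  have h1 : Tendsto (fun n : ℕ => m.T * Z (driverHorizon m) ω * (1 / ((n : ℝ) + 1))) atTop
      (𝓝 0) := by
    simpa using (tendsto_one_div_add_atTop_nhds_zero_nat (𝕜 := ℝ)).const_mul
      (m.T * Z (driverHorizon m) ω)
  have h2 : Tendsto (fun n : ℕ => randomVar m Z ω - riemannVar m Z (n + 1) ω) atTop (𝓝 0) := by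
    refine squeeze_zero (fun n => (hω (n + 1) n.succ_ne_zero).2.2.1) (fun n => ?_) h1
    refine ((hω (n + 1) n.succ_ne_zero).2.2.2).trans (le_of_eq ?_)
    push_cast; ring
  have := h2.const_sub (randomVar m Z ω)
  simpa using this

lemma IsIGOU.aemeasurable_riemannVar (h : IsIGOU Q m a b Z V) (n : ℕ) :
    AEMeasurable (riemannVar m Z n) Q := by
  have := h.subordinator.measurable
  unfold riemannVar weightedIncr
  fun_prop

lemma IsIGOU.intVar_ae_eq (h : IsIGOU Q m a b Z V) : ∀ᵐ ω ∂Q,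
    intVar m V ω = m.v₀ * decayIntegral m.lam m.T + randomVar m Z ω := h.intVar_eq

lemma IsIGOU.aemeasurable_randomVar (h : IsIGOU Q m a b Z V) : AEMeasurable (randomVar m Z) Q := by
  refine (h.aemeasurable_intVar.sub_const (m.v₀ * decayIntegral m.lam m.T)).congr ?_
  filter_upwards [h.intVar_ae_eq] with ω hω
  rw [hω]; ring

lemma IsIGOU.integrable_driver [IsProbabilityMeasure Q] (h : IsIGOU Q m a b Z V) :
    Integrable (Z (driverHorizon m)) Q := by
  simpa using h.integrable_driver_add_pow 0 1

lemma IsIGOU.integrable_randomVar [IsProbabilityMeasure Q] (h : IsIGOU Q m a b Z V) :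
    Integrable (randomVar m Z) Q := by
  refine (h.integrable_driver.div_const m.lam).mono' h.aemeasurable_randomVar.aestronglyMeasurable ?_
  filter_upwards [h.randomVar_bounds] with ω hω
  rw [Real.norm_of_nonneg hω.1]
  exact hω.2

lemma IsIGOU.meanIntVar_eq [IsProbabilityMeasure Q] (h : IsIGOU Q m a b Z V) :
    meanIntVar Q m V = m.v₀ * decayIntegral m.lam m.T + ∫ ω, randomVar m Z ω ∂Q := by
  rw [meanIntVar, integral_congr_ae h.intVar_ae_eq, integral_add (integrable_const _) h.integrable_randomVar]
  simp

lemma IsIGOU.tendsto_integral_riemannVar [IsProbabilityMeasure Q] (h : IsIGOU Q m a b Z V) :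
    Tendsto (fun n : ℕ => ∫ ω, riemannVar m Z (n + 1) ω ∂Q) atTop
      (𝓝 (∫ ω, randomVar m Z ω ∂Q)) := by
  refine tendsto_integral_of_dominated_convergence _
    (fun n => (h.aemeasurable_riemannVar _).aestronglyMeasurable)
    (h.integrable_driver.div_const m.lam) (fun n => ?_) h.tendsto_riemannVar
  filter_upwards [h.riemannVar_bounds] with ω hω
  have := hω (n + 1) n.succ_ne_zero
  rw [Real.norm_of_nonneg this.1]
  exact this.2.1

/-- The centered integrated variance. -/
noncomputable def centeredVar (Q : Measure Ω) (m : Market) (V : ℝ → Ω → ℝ) (ω : Ω) : ℝ :=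
  intVar m V ω - meanIntVar Q m V

lemma IsIGOU.centeredVar_eq [IsProbabilityMeasure Q] (h : IsIGOU Q m a b Z V) : ∀ᵐ ω ∂Q,
    centeredVar Q m V ω = randomVar m Z ω - ∫ ω, randomVar m Z ω ∂Q := by
  filter_upwards [h.intVar_ae_eq] with ω hω
  rw [centeredVar, hω, h.meanIntVar_eq]
  ring

lemma abs_sub_le_div_of_bounds {lam x y z w : ℝ} (hx : 0 ≤ x) (hxz : x ≤ z / lam) (hy : 0 ≤ y)
    (hyw : y ≤ w / lam) : |x - y| ≤ 1 / lam * (z + w) := by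
  have : 1 / lam * (z + w) = z / lam + w / lam := by ring
  rw [this, abs_le]
  constructor <;> linarith

lemma IsIGOU.integral_riemannVar_bounds [IsProbabilityMeasure Q] (h : IsIGOU Q m a b Z V) {n : ℕ}
    (hn : n ≠ 0) : 0 ≤ ∫ ω, riemannVar m Z n ω ∂Q ∧
      ∫ ω, riemannVar m Z n ω ∂Q ≤ (∫ ω, Z (driverHorizon m) ω ∂Q) / m.lam := by
  refine ⟨integral_nonneg_of_ae ?_, ?_⟩
  · filter_upwards [h.riemannVar_bounds] with ω hω using (hω n hn).1
  · rw [← integral_div]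
    refine integral_mono_of_nonneg ?_ (h.integrable_driver.div_const _) ?_
    · filter_upwards [h.riemannVar_bounds] with ω hω using (hω n hn).1
    · filter_upwards [h.riemannVar_bounds] with ω hω using (hω n hn).2.1

lemma IsIGOU.integral_randomVar_bounds [IsProbabilityMeasure Q] (h : IsIGOU Q m a b Z V) :
    0 ≤ ∫ ω, randomVar m Z ω ∂Q ∧
      ∫ ω, randomVar m Z ω ∂Q ≤ (∫ ω, Z (driverHorizon m) ω ∂Q) / m.lam := by
  refine ⟨integral_nonneg_of_ae ?_, ?_⟩
  · filter_upwards [h.randomVar_bounds] with ω hω using hω.1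
  · rw [← integral_div]
    refine integral_mono_of_nonneg ?_ (h.integrable_driver.div_const _) ?_
    · filter_upwards [h.randomVar_bounds] with ω hω using hω.1
    · filter_upwards [h.randomVar_bounds] with ω hω using hω.2

lemma IsIGOU.aemeasurable_centeredVar (h : IsIGOU Q m a b Z V) :
    AEMeasurable (centeredVar Q m V) Q :=
  h.aemeasurable_intVar.sub_const _

lemma IsIGOU.integrable_pow_of_abs_le [IsProbabilityMeasure Q] (h : IsIGOU Q m a b Z V)
    {X : Ω → ℝ} (hX : AEMeasurable X Q) {c d : ℝ}
    (hle : ∀ᵐ ω ∂Q, |X ω| ≤ d * (Z (driverHorizon m) ω + c)) (n : ℕ) :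
    Integrable (fun ω => X ω ^ n) Q := by
  refine ((h.integrable_driver_add_pow c n).const_mul (d ^ n)).mono'
    (hX.pow_const n).aestronglyMeasurable ?_
  filter_upwards [hle] with ω hω
  rw [norm_pow, Real.norm_eq_abs, ← mul_pow]
  exact pow_le_pow_left₀ (abs_nonneg _) hω n

lemma IsIGOU.integrable_centeredVar_pow [IsProbabilityMeasure Q] (h : IsIGOU Q m a b Z V) (n : ℕ) :
    Integrable (fun ω => centeredVar Q m V ω ^ n) Q := by
  refine h.integrable_pow_of_abs_le (c := ∫ ω, Z (driverHorizon m) ω ∂Q) (d := 1 / m.lam)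
    h.aemeasurable_centeredVar ?_ n
  have hi := h.integral_randomVar_bounds
  filter_upwards [h.centeredVar_eq, h.randomVar_bounds] with ω h1 h2
  rw [h1]
  exact abs_sub_le_div_of_bounds h2.1 h2.2 hi.1 hi.2

/-- The bound does not depend on the mesh: the step lengths add up to `λT` and the weights are at
most `1/λ`. So the cumulant of order `k + 1` is at most `λT · ab · (λb²)^{-(k+1)} = a T λ^{-k}
b^{-(2k+1)}` times a universal constant, and the bound survives the limit. -/
lemma IsIGOU.abs_integral_riemannVar_pow_le [IsProbabilityMeasure Q] (h : IsIGOU Q m a b Z V)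
    {N : ℕ} (hN : N ≠ 0) {n e : ℕ} (he : e ≤ 1) (hn : 1 + 2 * e ≤ n) :
    |∫ ω, (riemannVar m Z N ω - ∫ ω, riemannVar m Z N ω ∂Q) ^ n ∂Q| ≤
      centralMomentBound m a b n e := by
  have ha := h.a_pos
  have hb := h.b_pos
  have hl := m.lam_pos
  have hT := m.T_pos
  set c := ∫ ω, riemannVar m Z N ω ∂Q
  set X : Ω → ℝ := fun ω => riemannVar m Z N ω - c with hX
  have hw := riemannWeight_nonneg hl (driverHorizon m / N) N
  have hW := riemannWeight_le hl (driverHorizon m / N) N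
  have h0 : 0 ∈ interior (integrableExpSet X Q) :=
    h.zero_mem_interior_weightedIncr (δ := driverHorizon m / N) hw hW N c
  have hint : Integrable (riemannVar m Z N) Q := by
    have := integrable_of_mem_interior_integrableExpSet
      (h.zero_mem_interior_weightedIncr (δ := driverHorizon m / N) hw hW N 0)
    simpa [riemannVar] using this
  have hNδ : (N : ℝ) * (driverHorizon m / N : ℝ≥0) = m.lam * m.T := by
    rw [← coe_driverHorizon]
    exact_mod_cast natCast_mul_driverHorizon_div m hN
  have hc : ∀ k, 1 ≤ k → |iteratedDeriv (k + 1) (cgf X Q) 0| ≤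
      a * m.T * (1 / m.lam) ^ k * (1 / b) ^ (2 * k + 1) * unitCumulant (k + 1) := fun k hk => by
    refine (h.abs_iteratedDeriv_cgf_le (δ := driverHorizon m / N) hw hW N c (k := k + 1)
      (Or.inr (by omega))).trans (le_of_eq ?_)
    rw [hNδ, show 1 / m.lam / b ^ 2 = (1 / m.lam) * (1 / b) ^ 2 by ring, mul_pow, ← pow_mul,
      show 2 * (k + 1) = 2 * k + 1 + 1 by ring, pow_succ (1 / b) (2 * k + 1),
      pow_succ (1 / m.lam) k]
    field_simp
  have hc1 : iteratedDeriv 1 (cgf X Q) 0 = 0 := by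
    rw [iteratedDeriv_one, deriv_cgf_zero h0, hX]
    simp only [integral_sub hint (integrable_const c)]
    simp [c]
  exact (exists_central_moment_bound unitCumulant (fun _ => abs_nonneg _) n).choose_spec.2
    (a * m.T) (1 / m.lam) (1 / b) (fun n => ∫ ω, X ω ^ n ∂Q)
    (fun k => iteratedDeriv k (cgf X Q) 0) (by positivity) (by positivity) (by positivity)
    (by simp) hc1 hc (integral_pow_succ_eq_sum_cumulants h0) e he hn

lemma IsIGOU.abs_integral_centeredVar_pow_le [IsProbabilityMeasure Q] (h : IsIGOU Q m a b Z V)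
    {n e : ℕ} (he : e ≤ 1) (hn : 1 + 2 * e ≤ n) :
    |∫ ω, centeredVar Q m V ω ^ n ∂Q| ≤ centralMomentBound m a b n e := by
  have hlim : Tendsto
      (fun N : ℕ => ∫ ω, (riemannVar m Z (N + 1) ω - ∫ ω, riemannVar m Z (N + 1) ω ∂Q) ^ n ∂Q)
      atTop (𝓝 (∫ ω, centeredVar Q m V ω ^ n ∂Q)) := by
    refine tendsto_integral_of_dominated_convergence
      (fun ω => (1 / m.lam) ^ n *
        (Z (driverHorizon m) ω + ∫ ω, Z (driverHorizon m) ω ∂Q) ^ n)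
      (fun N => (((h.aemeasurable_riemannVar _).sub_const _).pow_const n).aestronglyMeasurable)
      ((h.integrable_driver_add_pow _ n).const_mul _) (fun N => ?_) ?_
    · have hi := h.integral_riemannVar_bounds N.succ_ne_zero
      filter_upwards [h.riemannVar_bounds] with ω hω
      have hω := hω (N + 1) N.succ_ne_zero
      rw [norm_pow, Real.norm_eq_abs, ← mul_pow]
      exact pow_le_pow_left₀ (abs_nonneg _)
        (abs_sub_le_div_of_bounds hω.1 hω.2.1 hi.1 hi.2) n
    · filter_upwards [h.tendsto_riemannVar, h.centeredVar_eq] with ω h1 h2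
      rw [h2]
      exact (h1.sub h.tendsto_integral_riemannVar).pow n
  exact le_of_tendsto hlim.abs
    (.of_forall fun N => h.abs_integral_riemannVar_pow_le N.succ_ne_zero he hn)

end Moments

/-! ### The polynomials `f n` and `g n`. -/

section Polynomials

/-- The sum of the constants that enter the `n`-th central moment bound. -/
noncomputable def polyFConst (n : ℕ) : ℝ≥0 :=
  (centralMomentConst (n - 1) + centralMomentConst n + centralMomentConst (n + 1)).toNNReal

/-- The polynomials in the central moment bounds for the integrated variance. -/
noncomputable def polyF (n : ℕ) : MvPolynomial (Fin 4) ℝ :=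
  -- Coefficients taken from `ℝ≥0` are non-negative automatically. The exponent `2 * n + 2` leaves
  -- room for the moment of order `n + 1` used to bound odd absolute moments.
  MvPolynomial.map NNReal.toRealHom
    (.C (polyFConst n) * (1 + .X 0 * .X 3 + .X 1 + .X 2) ^ (2 * n + 2))

/-- The constant in the `n`-th moment bound for `gVar`. -/
noncomputable def polyGConst (n : ℕ) : ℝ≥0 := (2 ^ (n - 1) * (1 + driverMomentConst n)).toNNReal

/-- The polynomials in the moment bounds for `gVar`. -/
noncomputable def polyG (n : ℕ) : MvPolynomial (Fin 6) ℝ :=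
  -- With one factor `|ρ|` split off, the driver part needs `(n - 1) + 2n` powers and the drift part
  -- `2(n - 1) + n`; both are at most `3n`.
  MvPolynomial.map NNReal.toRealHom
    (.C (polyGConst n) * (1 + .X 0 * .X 1 * .X 3 + .X 2 + .X 4 + .X 5) ^ (3 * n))

lemma coeff_polyF_nonneg (n : ℕ) (d : Fin 4 →₀ ℕ) : 0 ≤ (polyF n).coeff d := by
  rw [polyF, MvPolynomial.coeff_map]; exact NNReal.coe_nonneg _

lemma coeff_polyG_nonneg (n : ℕ) (d : Fin 6 →₀ ℕ) : 0 ≤ (polyG n).coeff d := by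
  rw [polyG, MvPolynomial.coeff_map]; exact NNReal.coe_nonneg _

lemma coe_polyFConst (n : ℕ) : (polyFConst n : ℝ) =
    centralMomentConst (n - 1) + centralMomentConst n + centralMomentConst (n + 1) :=
  Real.coe_toNNReal _ (add_nonneg (add_nonneg (centralMomentConst_nonneg _)
    (centralMomentConst_nonneg _)) (centralMomentConst_nonneg _))

lemma coe_polyGConst (n : ℕ) : (polyGConst n : ℝ) = 2 ^ (n - 1) * (1 + driverMomentConst n) := by
  have := driverMomentConst_nonneg n
  exact Real.coe_toNNReal _ (by positivity)

lemma evalF_polyF (m : Market) (a b : ℝ) (n : ℕ) : evalF (polyF n) m a b =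
    polyFConst n * (1 + a * m.T + 1 / m.lam + 1 / b) ^ (2 * n + 2) := by
  simp [evalF, polyF]

lemma evalG_polyG (m : Market) (a b ρ κ : ℝ) (n : ℕ) : evalG (polyG n) m a b ρ κ =
    polyGConst n * (1 + a * m.lam * m.T + 1 / b + |ρ| + Real.exp (-(m.lam * m.T * κ))) ^
      (3 * n) := by
  simp [evalG, polyG]

lemma evalF_polyF_nonneg (m : Market) {a b : ℝ} (ha : 0 < a) (hb : 0 < b) (n : ℕ) :
    0 ≤ evalF (polyF n) m a b := by
  have := m.lam_pos
  have := m.T_pos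
  rw [evalF_polyF]; positivity

lemma evalG_polyG_nonneg (m : Market) {a b : ℝ} (ha : 0 < a) (hb : 0 < b) (ρ κ : ℝ) (n : ℕ) :
    0 ≤ evalG (polyG n) m a b ρ κ := by
  have := m.lam_pos
  have := m.T_pos
  rw [evalG_polyG]; positivity

lemma evalF_polyF_anti (m : Market) {a b b₀ : ℝ} (ha : 0 < a) (hb₀ : 0 < b₀) (hb : b₀ ≤ b)
    (n : ℕ) : evalF (polyF n) m a b ≤ evalF (polyF n) m a b₀ := by
  have := m.lam_pos
  have := m.T_pos
  have : 0 < b := hb₀.trans_le hb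
  rw [evalF_polyF, evalF_polyF]
  gcongr

lemma evalG_polyG_anti (m : Market) {a b b₀ κ κ₀ : ℝ} (ha : 0 < a) (hb₀ : 0 < b₀) (hb : b₀ ≤ b)
    (hκ : κ₀ ≤ κ) (ρ : ℝ) (n : ℕ) :
    evalG (polyG n) m a b ρ κ ≤ evalG (polyG n) m a b₀ ρ κ₀ := by
  have := m.lam_pos
  have := m.T_pos
  have : 0 < b := hb₀.trans_le hb
  rw [evalG_polyG, evalG_polyG]
  gcongr

end Polynomials

/-! ### Moment bounds in polynomial form, and the price factor. -/

section PolynomialBounds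

variable {Ω : Type*} [MeasurableSpace Ω] {Q : Measure Ω} {m : Market} {a b ρ : ℝ}
  {Z : ℝ≥0 → Ω → ℝ} {V : ℝ → Ω → ℝ}

lemma centralMomentBound_le (m : Market) {a b : ℝ} (ha : 0 < a) (hb : 0 < b) (n e : ℕ) :
    centralMomentBound m a b n e ≤
      a * m.T / (m.lam * b ^ (n + 1 + e)) * evalF (polyF n) m a b := by
  have hl := m.lam_pos
  have hT := m.T_pos
  have h1 := centralMomentConst_nonneg (n - 1)
  have h2 := centralMomentConst_nonneg n
  have h3 := centralMomentConst_nonneg (n + 1)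
  have hU : 1 ≤ 1 + a * m.T + 1 / m.lam + 1 / b := by
    have : 0 < a * m.T + 1 / m.lam + 1 / b := by positivity
    linarith
  have hC : centralMomentConst n ≤ polyFConst n := by rw [coe_polyFConst]; linarith
  rw [evalF_polyF, centralMomentBound]
  set U := 1 + a * m.T + 1 / m.lam + 1 / b
  have e1 : a * m.T * (1 / m.lam) * (1 / b) ^ (n + 1) * (1 / b) ^ e =
      a * m.T / (m.lam * b ^ (n + 1 + e)) := by
    rw [one_div_pow, one_div_pow, pow_add b (n + 1) e]; field_simp
  rw [e1, mul_left_comm]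
  have : U ^ (2 * n) ≤ U ^ (2 * n + 2) := pow_le_pow_right₀ hU (by omega)
  gcongr

lemma IsIGOU.abs_integral_centeredVar_pow_le_evalF [IsProbabilityMeasure Q]
    (h : IsIGOU Q m a b Z V) {n e : ℕ} (he : e ≤ 1) (hn : 1 + 2 * e ≤ n) :
    |∫ ω, centeredVar Q m V ω ^ n ∂Q| ≤
      a * m.T / (m.lam * b ^ (n + 1 + e)) * evalF (polyF n) m a b :=
  (h.abs_integral_centeredVar_pow_le he hn).trans (centralMomentBound_le m h.a_pos h.b_pos n e)

/-- Absolute moments of odd order are reduced to the two neighbouring even ones. The weights `1/b`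
and `b` bring both of these to the order `b^{-(n+1)}` with `n = 2k + 1`. -/
lemma abs_pow_le_of_odd {x b : ℝ} (hb : 0 < b) {k : ℕ} :
    |x| ^ (2 * k + 1) ≤ 1 / b * x ^ (2 * k) + b * x ^ (2 * k + 2) := by
  have h2 : x ^ (2 * k + 2) = x ^ (2 * k) * |x| ^ 2 := by rw [pow_add, sq_abs]
  have h3 : |x| ^ (2 * k + 1) = x ^ (2 * k) * |x| := by
    rw [pow_succ, pow_mul, sq_abs, ← pow_mul]
  have h4 : 0 ≤ x ^ (2 * k) := by rw [pow_mul]; positivity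
  rw [h2, h3]
  have h5 : |x| ≤ 1 / b + b * |x| ^ 2 := by
    have h6 : 1 / b + b * |x| ^ 2 - |x| = 1 / b * ((b * |x| - 1 / 2) ^ 2 + 3 / 4) := by
      field_simp; ring
    have h7 : 0 ≤ 1 / b * ((b * |x| - 1 / 2) ^ 2 + 3 / 4) := by positivity
    linarith
  nlinarith [mul_le_mul_of_nonneg_left h5 h4]

lemma IsIGOU.integral_abs_centeredVar_pow_le [IsProbabilityMeasure Q] (h : IsIGOU Q m a b Z V)
    {n : ℕ} (hn : 2 ≤ n) : ∫ ω, |centeredVar Q m V ω| ^ n ∂Q ≤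
      a * m.T / (m.lam * b ^ (n + 1)) * evalF (polyF n) m a b := by
  have ha := h.a_pos
  have hb := h.b_pos
  have hl := m.lam_pos
  have hT := m.T_pos
  rcases Nat.even_or_odd n with he | ⟨k, rfl⟩
  · simp only [he.pow_abs]
    exact (le_abs_self _).trans
      (h.abs_integral_centeredVar_pow_le_evalF (e := 0) (by norm_num) (by omega))
  · have h1 := (le_abs_self _).trans
      (h.abs_integral_centeredVar_pow_le (n := 2 * k) (e := 0) (by norm_num) (by omega))
    have h2 := (le_abs_self _).trans
      (h.abs_integral_centeredVar_pow_le (n := 2 * k + 2) (e := 0) (by norm_num) (by omega))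
    have hi := h.integrable_centeredVar_pow
    have hint : Integrable (fun ω => 1 / b * centeredVar Q m V ω ^ (2 * k) +
        b * centeredVar Q m V ω ^ (2 * k + 2)) Q :=
      ((hi _).const_mul _).add ((hi _).const_mul _)
    have hC1 := centralMomentConst_nonneg (2 * k)
    have hC2 := centralMomentConst_nonneg (2 * k + 1)
    have hC3 := centralMomentConst_nonneg (2 * k + 2)
    have hU : 1 ≤ 1 + a * m.T + 1 / m.lam + 1 / b := by
      have : 0 < a * m.T + 1 / m.lam + 1 / b := by positivity
      linarith
    calc ∫ ω, |centeredVar Q m V ω| ^ (2 * k + 1) ∂Q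
        ≤ ∫ ω, (1 / b * centeredVar Q m V ω ^ (2 * k) +
            b * centeredVar Q m V ω ^ (2 * k + 2)) ∂Q := by
          refine integral_mono_of_nonneg (ae_of_all _ fun ω => by positivity) hint
            (ae_of_all _ fun ω => abs_pow_le_of_odd hb)
      _ = 1 / b * ∫ ω, centeredVar Q m V ω ^ (2 * k) ∂Q +
            b * ∫ ω, centeredVar Q m V ω ^ (2 * k + 2) ∂Q := by
          rw [integral_add ((hi _).const_mul _) ((hi _).const_mul _), integral_const_mul,
            integral_const_mul]
      _ ≤ 1 / b * centralMomentBound m a b (2 * k) 0 +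
            b * centralMomentBound m a b (2 * k + 2) 0 := by gcongr
      _ = a * m.T / (m.lam * b ^ (2 * k + 1 + 1)) *
            (centralMomentConst (2 * k) * (1 + a * m.T + 1 / m.lam + 1 / b) ^ (2 * (2 * k)) +
              centralMomentConst (2 * k + 2) *
                (1 + a * m.T + 1 / m.lam + 1 / b) ^ (2 * (2 * k + 2))) := by
          rw [centralMomentBound, centralMomentBound]
          generalize (1 + a * m.T + 1 / m.lam + 1 / b) ^ (2 * (2 * k)) = u₁
          generalize (1 + a * m.T + 1 / m.lam + 1 / b) ^ (2 * (2 * k + 2)) = u₂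
          simp only [one_div_pow]
          field_simp
          ring
      _ ≤ _ := by
          rw [evalF_polyF, coe_polyFConst, show 2 * k + 1 - 1 = 2 * k by omega,
            show 2 * k + 1 + 1 = 2 * k + 2 by omega,
            show 2 * (2 * k + 1) + 2 = 2 * (2 * k + 2) by ring]
          set U := 1 + a * m.T + 1 / m.lam + 1 / b
          have hUU : U ^ (2 * (2 * k)) ≤ U ^ (2 * (2 * k + 2)) :=
            pow_le_pow_right₀ hU (by omega)
          have hU0 : 0 ≤ U ^ (2 * (2 * k + 2)) := by positivity
          gcongr
          nlinarith [mul_le_mul_of_nonneg_left hUU hC1, mul_nonneg hC2 hU0]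

lemma driverCgf_bounds {a b ρ : ℝ} (ha : 0 < a) (hb : 0 < b) (hρ : ρ ≤ 0) :
    0 ≤ -driverCgf a b ρ ∧ -driverCgf a b ρ ≤ a * |ρ| / b := by
  have hs : b ≤ √(b ^ 2 - 2 * ρ) := Real.le_sqrt_of_sq_le (by linarith)
  have e : -driverCgf a b ρ = a * |ρ| / √(b ^ 2 - 2 * ρ) := by
    rw [driverCgf, abs_of_nonpos hρ]; ring
  rw [e]
  exact ⟨by positivity, by gcongr⟩

/-- The deterministic part of `gVar`. -/
noncomputable def gDrift (m : Market) (κ : ℝ) : ℝ :=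
  -(m.lam * m.T * κ) * (1 / 2 * Real.exp (-(m.lam * m.T * κ)) + 1 / 2)

lemma gVar_eq (ω : Ω) : gVar Q m ρ Z ω =
    gDrift m (kappa Q ρ Z) + |ρ| * Z (driverHorizon m) ω := rfl

lemma IsIGOU.gDrift_bounds [IsProbabilityMeasure Q] (h : IsIGOU Q m a b Z V) (hρ : ρ ≤ 0) :
    0 ≤ gDrift m (kappa Q ρ Z) ∧ gDrift m (kappa Q ρ Z) ≤ a * m.lam * m.T * |ρ| * (1 / b) *
      (1 / 2 * Real.exp (-(m.lam * m.T * kappa Q ρ Z)) + 1 / 2) := by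
  have hκ := driverCgf_bounds h.a_pos h.b_pos hρ
  rw [← h.kappa_eq hρ] at hκ
  have hlT : 0 < m.lam * m.T := mul_pos m.lam_pos m.T_pos
  have e : -(m.lam * m.T * kappa Q ρ Z) = m.lam * m.T * -kappa Q ρ Z := by ring
  constructor
  · rw [gDrift, e]
    have := hκ.1
    positivity
  · rw [gDrift]
    refine mul_le_mul_of_nonneg_right ?_ (by positivity)
    rw [e]
    calc _ ≤ m.lam * m.T * (a * |ρ| / b) := by gcongr; exact hκ.2
      _ = _ := by ring

lemma IsIGOU.integrable_gVar_pow [IsProbabilityMeasure Q] (h : IsIGOU Q m a b Z V) (n : ℕ) :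
    Integrable (fun ω => gVar Q m ρ Z ω ^ n) Q := by
  rcases eq_or_ne ρ 0 with rfl | hρ
  · have e : (fun ω => gVar Q m 0 Z ω ^ n) = fun _ => gDrift m (kappa Q 0 Z) ^ n := by
      funext ω; simp [gVar_eq]
    rw [e]
    exact integrable_const _
  refine ((h.integrable_driver_add_pow (gDrift m (kappa Q ρ Z) / |ρ|) n).const_mul
    (|ρ| ^ n)).congr (ae_of_all _ fun ω => ?_)
  have : |ρ| ≠ 0 := abs_ne_zero.2 hρ
  simp only [gVar_eq, ← mul_pow]
  congr 1
  field_simp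
  ring

/-- The inequality `(x + y)^n ≤ 2^{n-1} (x^n + y^n)` separates drift and driver. Each part keeps one
factor `a λ T |ρ|` and the full power `b^{-n}`; everything else is bounded by powers of `Y`. -/
lemma IsIGOU.integral_gVar_pow_le [IsProbabilityMeasure Q] (h : IsIGOU Q m a b Z V) (hρ : ρ ≤ 0)
    {n : ℕ} (hn : 1 ≤ n) : ∫ ω, gVar Q m ρ Z ω ^ n ∂Q ≤
      a * m.lam * m.T * |ρ| / b ^ n * evalG (polyG n) m a b ρ (kappa Q ρ Z) := by
  have ha := h.a_pos
  have hb := h.b_pos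
  have hl := m.lam_pos
  have hT := m.T_pos
  obtain ⟨hA0, hA⟩ := h.gDrift_bounds hρ
  set A := gDrift m (kappa Q ρ Z) with hAdef
  have hZi : Integrable (fun ω => Z (driverHorizon m) ω ^ n) Q := by
    simpa using h.integrable_driver_add_pow 0 n
  have hint : Integrable (fun ω => 2 ^ (n - 1) * (A ^ n + |ρ| ^ n * Z (driverHorizon m) ω ^ n)) Q :=
    ((integrable_const _).add (hZi.const_mul _)).const_mul _
  have hle : (fun ω => gVar Q m ρ Z ω ^ n) ≤ᵐ[Q]
      fun ω => 2 ^ (n - 1) * (A ^ n + |ρ| ^ n * Z (driverHorizon m) ω ^ n) := by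
    filter_upwards [h.subordinator.nonneg] with ω hω
    have h1 : 0 ≤ |ρ| * Z (driverHorizon m) ω := mul_nonneg (abs_nonneg _) (hω _)
    rw [gVar_eq, ← mul_pow]
    exact add_pow_le hA0 h1 n
  have hL := driverMomentConst_nonneg n
  set Ex := Real.exp (-(m.lam * m.T * kappa Q ρ Z)) with hEx
  have hEx0 : 0 < Ex := Real.exp_pos _
  set β := a * m.lam * m.T with hβ
  have hβ0 : 0 < β := by positivity
  have hy0 : 0 < 1 / b := by positivity
  have hr0 := abs_nonneg ρ
  obtain ⟨n, rfl⟩ := Nat.exists_eq_add_of_le' hn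
  rw [evalG_polyG, coe_polyGConst, ← hEx, ← hβ]
  set Y := 1 + β + 1 / b + |ρ| + Ex with hY
  have hY1 : 1 ≤ Y := by linarith
  have hY0 : 0 ≤ Y := by linarith
  have hβY : β ≤ Y := by linarith
  have hrY : |ρ| ≤ Y := by linarith
  have hA' : A ^ (n + 1) ≤ β * |ρ| * (1 / b) ^ (n + 1) * Y ^ (3 * (n + 1)) :=
    calc A ^ (n + 1) ≤ (β * |ρ| * (1 / b) * (1 / 2 * Ex + 1 / 2)) ^ (n + 1) := by gcongr
      _ = β * |ρ| * (1 / b) ^ (n + 1) * (β ^ n * |ρ| ^ n * (1 / 2 * Ex + 1 / 2) ^ (n + 1)) := by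
          generalize 1 / 2 * Ex + 1 / 2 = v
          ring
      _ ≤ β * |ρ| * (1 / b) ^ (n + 1) * (Y ^ n * Y ^ n * Y ^ (n + 1)) := by
          gcongr; linarith
      _ = β * |ρ| * (1 / b) ^ (n + 1) * Y ^ (3 * n + 1) := by ring
      _ ≤ _ := by
          have : Y ^ (3 * n + 1) ≤ Y ^ (3 * (n + 1)) := pow_le_pow_right₀ hY1 (by omega)
          gcongr
  have hB' : |ρ| ^ (n + 1) * driverMomentBound m a b (n + 1) ≤
      β * |ρ| * (1 / b) ^ (n + 1) * (driverMomentConst (n + 1) * Y ^ (3 * (n + 1))) :=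
    calc _ = β * |ρ| * (1 / b) ^ (n + 1) *
          (driverMomentConst (n + 1) * (|ρ| ^ n * (1 + β + 1 / b) ^ (2 * (n + 1)))) := by
          rw [driverMomentBound, ← hβ]; ring
      _ ≤ β * |ρ| * (1 / b) ^ (n + 1) *
          (driverMomentConst (n + 1) * (Y ^ n * Y ^ (2 * (n + 1)))) := by
          gcongr; linarith
      _ = β * |ρ| * (1 / b) ^ (n + 1) * (driverMomentConst (n + 1) * Y ^ (3 * n + 2)) := by ring
      _ ≤ _ := by
          have : Y ^ (3 * n + 2) ≤ Y ^ (3 * (n + 1)) := pow_le_pow_right₀ hY1 (by omega)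
          gcongr
  calc _ ≤ ∫ ω, 2 ^ (n + 1 - 1) *
        (A ^ (n + 1) + |ρ| ^ (n + 1) * Z (driverHorizon m) ω ^ (n + 1)) ∂Q :=
        integral_mono_ae (h.integrable_gVar_pow _) hint hle
    _ = 2 ^ (n + 1 - 1) * (A ^ (n + 1) +
        |ρ| ^ (n + 1) * ∫ ω, Z (driverHorizon m) ω ^ (n + 1) ∂Q) := by
        rw [integral_const_mul, integral_add (integrable_const _) (hZi.const_mul _),
          integral_const_mul]
        simp
    _ ≤ 2 ^ (n + 1 - 1) * (β * |ρ| * (1 / b) ^ (n + 1) * Y ^ (3 * (n + 1)) +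
        β * |ρ| * (1 / b) ^ (n + 1) * (driverMomentConst (n + 1) * Y ^ (3 * (n + 1)))) := by
        have := h.integral_driver_pow_le hn
        refine mul_le_mul_of_nonneg_left (add_le_add hA' (le_trans ?_ hB')) (by positivity)
        gcongr
    _ = _ := by
        rw [one_div_pow]; ring

/-- Here `P_T = e^{c - y}` with `c, y ≥ 0`. From above, `e^c - 1` is the integral of a convex
function over `[0, c]` and lies below its trapezoidal value `c (e^c + 1) / 2`. From below, `1 -
e^{c-y} ≤ y - c ≤ y`. -/
lemma IsIGOU.abs_priceFactor_sub_one_le [IsProbabilityMeasure Q] (h : IsIGOU Q m a b Z V)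
    (hρ : ρ ≤ 0) : ∀ᵐ ω ∂Q, |priceFactor Q m ρ Z ω - 1| ≤ gVar Q m ρ Z ω := by
  have hκ := (driverCgf_bounds h.a_pos h.b_pos hρ).1
  rw [← h.kappa_eq hρ] at hκ
  have hlT : 0 < m.lam * m.T := mul_pos m.lam_pos m.T_pos
  filter_upwards [h.subordinator.nonneg] with ω hω
  have hz : 0 ≤ |ρ| * Z (driverHorizon m) ω := mul_nonneg (abs_nonneg _) (hω _)
  set c := -(m.lam * m.T * kappa Q ρ Z) with hc
  have hc0 : 0 ≤ c := by rw [hc]; nlinarith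
  set y := |ρ| * Z (driverHorizon m) ω with hy
  have e1 : priceFactor Q m ρ Z ω = Real.exp (c - y) := by
    rw [priceFactor, hc, hy, abs_of_nonpos hρ, driverHorizon]
    congr 1; ring
  have e2 : gVar Q m ρ Z ω = c * (1 / 2 * Real.exp c + 1 / 2) + y := rfl
  rw [e1, e2]
  have hexp : 1 ≤ Real.exp c := Real.one_le_exp hc0
  have hup : Real.exp c - 1 ≤ c * (1 / 2 * Real.exp c + 1 / 2) := by
    have hsinh : ∀ t : ℝ, 0 ≤ t → 0 ≤ t * (1 / 2 * Real.exp t + 1 / 2) - (Real.exp t - 1) := by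
      intro t ht
      have hd : ∀ t : ℝ, HasDerivAt
          (fun t => t * (1 / 2 * Real.exp t + 1 / 2) - (Real.exp t - 1))
          (1 / 2 * (1 + (t - 1) * Real.exp t)) t := fun t => by
        refine (((hasDerivAt_id t).mul (((Real.hasDerivAt_exp t).const_mul (1 / 2)).add_const
          (1 / 2))).sub ((Real.hasDerivAt_exp t).sub_const 1)).congr_deriv ?_
        simp only [id]; ring
      have hmono : Monotone fun t : ℝ => t * (1 / 2 * Real.exp t + 1 / 2) - (Real.exp t - 1) := by
        refine monotone_of_deriv_nonneg (fun t => (hd t).differentiableAt) fun t => ?_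
        rw [(hd t).deriv]
        -- Non-negativity of `1 + (t - 1) e^t` is `e^{-t} ≥ 1 - t` multiplied by `e^t`.
        have h1 := Real.add_one_le_exp (-t)
        have h2 : Real.exp (-t) * Real.exp t = 1 := by rw [← Real.exp_add]; simp
        nlinarith [mul_le_mul_of_nonneg_right h1 (Real.exp_nonneg t)]
      simpa using hmono ht
    linarith [hsinh c hc0]
  have h3 : Real.exp (c - y) ≤ Real.exp c := Real.exp_le_exp.2 (by linarith)
  have h4 := Real.add_one_le_exp (c - y)
  have h5 : 0 ≤ c * (1 / 2 * Real.exp c + 1 / 2) := by positivity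
  rw [abs_le]
  constructor <;> linarith

lemma measurable_priceFactor (hZ : ∀ t, Measurable (Z t)) : Measurable (priceFactor Q m ρ Z) := by
  unfold priceFactor
  fun_prop

lemma IsIGOU.integrable_priceFactor_sub_one_pow [IsProbabilityMeasure Q] (h : IsIGOU Q m a b Z V)
    (hρ : ρ ≤ 0) (n : ℕ) : Integrable (fun ω => (priceFactor Q m ρ Z ω - 1) ^ n) Q := by
  have hm := measurable_priceFactor (Q := Q) (m := m) (ρ := ρ) h.subordinator.measurable
  refine (h.integrable_gVar_pow (ρ := ρ) n).mono'
    (by fun_prop : Measurable _).aestronglyMeasurable ?_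
  filter_upwards [h.abs_priceFactor_sub_one_le hρ] with ω hω
  rw [norm_pow, Real.norm_eq_abs]
  exact pow_le_pow_left₀ (abs_nonneg _) hω n

lemma IsIGOU.integral_priceFactor_sub_one_pow_le [IsProbabilityMeasure Q]
    (h : IsIGOU Q m a b Z V) (hρ : ρ ≤ 0) {k : ℕ} (hk : 1 ≤ k) :
    ∫ ω, (priceFactor Q m ρ Z ω - 1) ^ (2 * k) ∂Q ≤
      a * m.lam * m.T * |ρ| / b ^ (2 * k) * evalG (polyG (2 * k)) m a b ρ (kappa Q ρ Z) := by
  refine le_trans ?_ (h.integral_gVar_pow_le hρ (by omega))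
  refine integral_mono_ae (h.integrable_priceFactor_sub_one_pow hρ _) (h.integrable_gVar_pow _) ?_
  filter_upwards [h.abs_priceFactor_sub_one_le hρ] with ω hω
  rw [← (even_two_mul k).pow_abs]
  exact pow_le_pow_left₀ (abs_nonneg _) hω _

end PolynomialBounds

/-! ### The Cauchy-Schwarz inequality for expectations. -/

section CauchySchwarz

variable {Ω : Type*} [MeasurableSpace Ω] {μ : Measure Ω} {f g : Ω → ℝ}

lemma integral_abs_mul_abs_le_sqrt (hf : AEStronglyMeasurable f μ) (hg : AEStronglyMeasurable g μ)
    (hf2 : Integrable (fun ω => f ω ^ 2) μ) (hg2 : Integrable (fun ω => g ω ^ 2) μ) :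
    ∫ ω, |f ω| * |g ω| ∂μ ≤ √((∫ ω, f ω ^ 2 ∂μ) * ∫ ω, g ω ^ 2 ∂μ) := by
  have h := integral_mul_le_Lp_mul_Lq_of_nonneg (μ := μ) (p := 2) (q := 2)
    (f := fun ω => |f ω|) (g := fun ω => |g ω|) Real.HolderConjugate.two_two
    (ae_of_all _ fun _ => abs_nonneg _) (ae_of_all _ fun _ => abs_nonneg _)
    (by rw [ENNReal.ofReal_ofNat]; exact ((memLp_two_iff_integrable_sq hf).2 hf2).abs)
    (by rw [ENNReal.ofReal_ofNat]; exact ((memLp_two_iff_integrable_sq hg).2 hg2).abs)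
  simpa [Real.sqrt_mul (integral_nonneg fun ω => sq_nonneg (f ω)), Real.sqrt_eq_rpow] using h

end CauchySchwarz

/-! ### Derivatives along the Taylor segment. -/

section Segment

variable {Ω : Type*} [MeasurableSpace Ω] {Q : Measure Ω} {m : Market} {a b ρ : ℝ}
  {Z : ℝ≥0 → Ω → ℝ} {V : ℝ → Ω → ℝ}

/-- A lower bound for the integrated variance. -/
noncomputable def minIntVar (m : Market) : ℝ := m.v₀ * decayIntegral m.lam m.T

lemma minIntVar_pos (m : Market) : 0 < minIntVar m :=
  mul_pos m.v₀_pos (decayIntegral_pos m.lam_pos m.T_pos)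

/-- The spot coordinate of the segment along which the put price is expanded. -/
noncomputable def segSpot (Q : Measure Ω) (m : Market) (ρ : ℝ) (Z : ℝ≥0 → Ω → ℝ) (u : ℝ) (ω : Ω) :
    ℝ := (1 - u) * m.S₀ + u * priceFactor Q m ρ Z ω * m.S₀

/-- The variance coordinate of the segment along which the put price is expanded. -/
noncomputable def segVar (Q : Measure Ω) (m : Market) (V : ℝ → Ω → ℝ) (u : ℝ) (ω : Ω) : ℝ :=
  (1 - u) * meanIntVar Q m V + u * intVar m V ω

lemma derivOnSegment_eq (i j : ℕ) (u : ℝ) (ω : Ω) : derivOnSegment Q m ρ Z V i j u ω =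
    bsPutDeriv m i j (segSpot Q m ρ Z u ω) (segVar Q m V u ω) := rfl

lemma segSpot_pos (ω : Ω) {u : ℝ} (hu : u ∈ Ioc (0 : ℝ) 1) : 0 < segSpot Q m ρ Z u ω := by
  have hS := m.S₀_pos
  have hP : 0 < priceFactor Q m ρ Z ω := Real.exp_pos _
  have h1 : 0 ≤ 1 - u := by linarith [hu.2]
  have h2 := hu.1
  unfold segSpot
  positivity

lemma le_segSpot (ω : Ω) {u : ℝ} (hu : u ∈ Ioc (0 : ℝ) 1) :
    (1 - u) * m.S₀ ≤ segSpot Q m ρ Z u ω := by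
  have hS := m.S₀_pos
  have hP : 0 < priceFactor Q m ρ Z ω := Real.exp_pos _
  have h2 := hu.1
  have : 0 ≤ u * priceFactor Q m ρ Z ω * m.S₀ := by positivity
  unfold segSpot
  linarith

lemma IsIGOU.minIntVar_le_intVar (h : IsIGOU Q m a b Z V) :
    ∀ᵐ ω ∂Q, minIntVar m ≤ intVar m V ω := by
  filter_upwards [h.intVar_ae_eq, h.randomVar_bounds] with ω h1 h2
  rw [h1, minIntVar]
  linarith [h2.1]

lemma IsIGOU.minIntVar_le_segVar [IsProbabilityMeasure Q] (h : IsIGOU Q m a b Z V) :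
    ∀ᵐ ω ∂Q, ∀ u ∈ Ioc (0 : ℝ) 1, minIntVar m ≤ segVar Q m V u ω := by
  have h0 : minIntVar m ≤ meanIntVar Q m V := by
    rw [h.meanIntVar_eq, minIntVar]
    linarith [h.integral_randomVar_bounds.1]
  filter_upwards [h.minIntVar_le_intVar] with ω h1 u hu
  have h2 : 0 ≤ 1 - u := by linarith [hu.2]
  have h3 := hu.1.le
  unfold segVar
  nlinarith [mul_le_mul_of_nonneg_left h0 h2, mul_le_mul_of_nonneg_left h1 h3]

/-- The constants in the bounds for the derivatives of the put price. -/
noncomputable def bsDerivConst (i j : ℕ) (m : Market) : ℝ :=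
  if hij : 2 ≤ i + j then (exists_abs_bsPutDeriv_le m (minIntVar m) (minIntVar_pos m) hij).choose
  else 0

lemma bsDerivConst_nonneg (i j : ℕ) (m : Market) : 0 ≤ bsDerivConst i j m := by
  unfold bsDerivConst
  split_ifs with hij
  · exact (exists_abs_bsPutDeriv_le m (minIntVar m) (minIntVar_pos m) hij).choose_spec.1
  · exact le_rfl

lemma abs_bsPutDeriv_le (m : Market) {i j : ℕ} (hij : 2 ≤ i + j) {x y : ℝ} (hx : 0 < x)
    (hy : minIntVar m ≤ y) : |bsPutDeriv m i j x y| ≤ bsDerivConst i j m * x⁻¹ ^ (i - 1) := by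
  rw [bsDerivConst, dif_pos hij]
  exact (exists_abs_bsPutDeriv_le m (minIntVar m) (minIntVar_pos m) hij).choose_spec.2 x y hx hy

/-- Bounds for the weighted averages of the derivatives of the put price along the segment. -/
noncomputable def averageConst (i j : ℕ) (m : Market) : ℝ :=
  (i + j) * (bsDerivConst i j m * m.S₀⁻¹ ^ (i - 1))

lemma averageConst_nonneg (i j : ℕ) (m : Market) : 0 ≤ averageConst i j m := by
  have := bsDerivConst_nonneg i j m
  have := m.S₀_pos
  unfold averageConst
  positivity

/-- The pointwise bound contains `x^{-(i-1)}`, which blows up when the spot coordinate is near `0`.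
Since that coordinate is at least `(1-u) S₀`, the Taylor weight cancels the singularity, whatever
the value of `P_T`. -/
lemma IsIGOU.abs_derivOnSegment_le [IsProbabilityMeasure Q] (h : IsIGOU Q m a b Z V) {i j : ℕ}
    (hij : 2 ≤ i + j) : ∀ᵐ ω ∂Q, ∀ u ∈ Ioo (0 : ℝ) 1,
      (1 - u) ^ (i + j - 1) * |derivOnSegment Q m ρ Z V i j u ω| ≤
        bsDerivConst i j m * m.S₀⁻¹ ^ (i - 1) := by
  have hS := m.S₀_pos
  have hc := bsDerivConst_nonneg i j m
  filter_upwards [h.minIntVar_le_segVar] with ω hω u hu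
  have hu' : u ∈ Ioc (0 : ℝ) 1 := ⟨hu.1, hu.2.le⟩
  have h1 : 0 < 1 - u := by linarith [hu.2]
  have h2 : 1 - u ≤ 1 := by linarith [hu.1]
  have hx := segSpot_pos (Q := Q) (m := m) (ρ := ρ) (Z := Z) ω hu'
  have hxl := le_segSpot (Q := Q) (m := m) (ρ := ρ) (Z := Z) ω hu'
  have hb := abs_bsPutDeriv_le m hij hx (hω u hu')
  rw [derivOnSegment_eq]
  have h3 : (segSpot Q m ρ Z u ω)⁻¹ ≤ ((1 - u) * m.S₀)⁻¹ := by gcongr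
  have h4 : (1 - u) ^ (i + j - 1) ≤ (1 - u) ^ (i - 1) :=
    pow_le_pow_of_le_one h1.le h2 (by omega)
  calc _ ≤ (1 - u) ^ (i - 1) * (bsDerivConst i j m * ((1 - u) * m.S₀)⁻¹ ^ (i - 1)) := by
        gcongr
        exact hb.trans (by gcongr)
    _ = _ := by
        rw [mul_inv, mul_pow, inv_pow (1 - u)]
        field_simp

lemma IsIGOU.averageBound [IsProbabilityMeasure Q] (h : IsIGOU Q m a b Z V) {i j : ℕ}
    (hij : 2 ≤ i + j) : AverageBound Q m ρ Z V i j (averageConst i j m) := by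
  filter_upwards [h.abs_derivOnSegment_le (ρ := ρ) hij] with ω hω
  calc _ ≤ ∫⁻ _ in Ioo (0 : ℝ) 1, ENNReal.ofReal (averageConst i j m) := by
        refine setLIntegral_mono' measurableSet_Ioo fun u hu => ENNReal.ofReal_le_ofReal ?_
        rw [mul_assoc]
        exact mul_le_mul_of_nonneg_left (hω u hu) (by positivity)
    _ = _ := by simp

lemma kappa_zero [IsProbabilityMeasure Q] : kappa Q 0 Z = 0 := by simp [kappa]

lemma priceFactor_zero [IsProbabilityMeasure Q] (ω : Ω) : priceFactor Q m 0 Z ω = 1 := by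
  simp [priceFactor, kappa_zero]

/-- For `ρ = 0` the spot coordinate is constantly `S₀`, so there is no singularity and the weight is
not needed. -/
lemma IsIGOU.supBound_zero [IsProbabilityMeasure Q] (h : IsIGOU Q m a b Z V) {i j : ℕ}
    (hij : 2 ≤ i + j) : SupBound Q m 0 Z V i j (averageConst i j m) := by
  have hS := m.S₀_pos
  have hc := bsDerivConst_nonneg i j m
  filter_upwards [h.minIntVar_le_segVar] with ω hω u hu
  have hu' : u ∈ Ioc (0 : ℝ) 1 := ⟨hu.1, hu.2.le⟩
  have hx : segSpot Q m 0 Z u ω = m.S₀ := by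
    rw [segSpot, priceFactor_zero]; ring
  rw [derivOnSegment_eq, hx]
  refine (abs_bsPutDeriv_le m hij hS (hω u hu')).trans ?_
  have h1 : (1 : ℝ) ≤ i + j := by exact_mod_cast (by omega : 1 ≤ i + j)
  exact le_mul_of_one_le_left (by positivity) h1

/-- The integral over the segment in the Taylor remainder. -/
noncomputable def segIntegral (Q : Measure Ω) (m : Market) (ρ : ℝ) (Z : ℝ≥0 → Ω → ℝ)
    (V : ℝ → Ω → ℝ) (N i j : ℕ) (ω : Ω) : ℝ :=
  ∫ u in (0 : ℝ)..1, (1 - u) ^ N * derivOnSegment Q m ρ Z V i j u ω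

lemma remainderIntegrand_eq (N n : ℕ) (ω : Ω) : remainderIntegrand Q m ρ Z V N n ω =
    (priceFactor Q m ρ Z ω - 1) ^ (N + 1 - n) * centeredVar Q m V ω ^ n *
      segIntegral Q m ρ Z V N (N + 1 - n) n ω := rfl

lemma IsIGOU.abs_segIntegral_le_averageConst [IsProbabilityMeasure Q] (h : IsIGOU Q m a b Z V)
    {N i j : ℕ} (hij : i + j = N + 1) (hN : 1 ≤ N) :
    ∀ᵐ ω ∂Q, |segIntegral Q m ρ Z V N i j ω| ≤ averageConst i j m / (N + 1) := by
  filter_upwards [h.abs_derivOnSegment_le (ρ := ρ) (i := i) (j := j) (by omega)] with ω hω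
  rw [hij, Nat.add_sub_cancel] at hω
  have hb : ∀ᵐ u ∂volume, u ∈ Ioc (0 : ℝ) 1 →
      ‖(1 - u) ^ N * derivOnSegment Q m ρ Z V i j u ω‖ ≤
        bsDerivConst i j m * m.S₀⁻¹ ^ (i - 1) := by
    have h1 : ∀ᵐ u : ℝ ∂volume, u ≠ 1 := by simp [ae_iff]
    filter_upwards [h1] with u hu1 hu
    have hu' : u ∈ Ioo (0 : ℝ) 1 := ⟨hu.1, lt_of_le_of_ne hu.2 hu1⟩
    have h2 : 0 ≤ 1 - u := by linarith [hu.2]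
    rw [norm_mul, norm_pow, Real.norm_eq_abs, Real.norm_eq_abs, abs_of_nonneg h2]
    exact hω u hu'
  have := intervalIntegral.norm_integral_le_of_norm_le_const_ae (a := (0 : ℝ)) (b := 1)
    (by rwa [uIoc_of_le zero_le_one])
  rw [Real.norm_eq_abs, sub_zero, abs_one, mul_one] at this
  have e : averageConst i j m / (N + 1) = bsDerivConst i j m * m.S₀⁻¹ ^ (i - 1) := by
    rw [averageConst, show (i : ℝ) + j = N + 1 by exact_mod_cast hij]
    field_simp
  rw [e]
  exact this

lemma abs_segIntegral_le_of_supBound {N i j : ℕ} {c : ℝ} (hc : SupBound Q m ρ Z V i j c) :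
    ∀ᵐ ω ∂Q, |segIntegral Q m ρ Z V N i j ω| ≤ c / (N + 1) := by
  filter_upwards [hc] with ω hω
  have hb : ∀ᵐ u ∂volume, u ∈ Ioc (0 : ℝ) 1 →
      ‖(1 - u) ^ N * derivOnSegment Q m ρ Z V i j u ω‖ ≤ (1 - u) ^ N * c := by
    have h1 : ∀ᵐ u : ℝ ∂volume, u ≠ 1 := by simp [ae_iff]
    filter_upwards [h1] with u hu1 hu
    have hu' : u ∈ Ioo (0 : ℝ) 1 := ⟨hu.1, lt_of_le_of_ne hu.2 hu1⟩
    have h2 : 0 ≤ 1 - u := by linarith [hu.2]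
    rw [norm_mul, norm_pow, Real.norm_eq_abs, Real.norm_eq_abs, abs_of_nonneg h2]
    exact mul_le_mul_of_nonneg_left (hω u hu') (by positivity)
  have := intervalIntegral.norm_integral_le_of_norm_le zero_le_one hb
    (Continuous.intervalIntegrable (by fun_prop) _ _)
  rw [Real.norm_eq_abs] at this
  refine this.trans (le_of_eq ?_)
  have hint : ∫ u in (0 : ℝ)..1, (1 - u) ^ N = 1 / (N + 1) := by
    rw [intervalIntegral.integral_comp_sub_left (fun u => u ^ N) (1 : ℝ)]
    simp [integral_pow]
  rw [intervalIntegral.integral_mul_const, hint]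
  ring

/-- The closed form makes the integrand jointly measurable in `(ω, u)`, once `I_T` is replaced by a
measurable version. -/
lemma IsIGOU.aestronglyMeasurable_segIntegral [IsProbabilityMeasure Q] (h : IsIGOU Q m a b Z V)
    (N : ℕ) {i j : ℕ} (hij : 2 ≤ i + j) :
    AEStronglyMeasurable (segIntegral Q m ρ Z V N i j) Q := by
  obtain ⟨p, hp⟩ := exists_bsPutDeriv_eq hij
  obtain ⟨I, hI, hIe⟩ := h.aemeasurable_intVar
  have hP := measurable_priceFactor (Q := Q) (m := m) (ρ := ρ) h.subordinator.measurable
  set F : Ω × ℝ → ℝ := fun z => (1 - z.2) ^ N * (bsConst m * bsTerm m i p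
    ((1 - z.2) * m.S₀ + z.2 * priceFactor Q m ρ Z z.1 * m.S₀)
    ((1 - z.2) * meanIntVar Q m V + z.2 * I z.1)) with hF
  have hP' : Measurable fun z : Ω × ℝ => priceFactor Q m ρ Z z.1 := hP.comp measurable_fst
  have hI' : Measurable fun z : Ω × ℝ => I z.1 := hI.comp measurable_fst
  have hFm : Measurable F := by
    have h1 : Measurable fun z : Ω × ℝ => ((1 - z.2) * m.S₀ + z.2 * priceFactor Q m ρ Z z.1 * m.S₀,
        (1 - z.2) * meanIntVar Q m V + z.2 * I z.1) := by fun_prop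
    have h2 := (measurable_bsTerm m i p).comp h1
    exact (by fun_prop : Measurable fun z : Ω × ℝ => (1 - z.2) ^ N).mul (h2.const_mul _)
  have hsm := hFm.stronglyMeasurable.integral_prod_right' (ν := volume.restrict (Ioc (0 : ℝ) 1))
  refine hsm.aestronglyMeasurable.congr ?_
  filter_upwards [hIe, h.minIntVar_le_segVar] with ω h1 h2
  rw [segIntegral, intervalIntegral.integral_of_le zero_le_one]
  refine setIntegral_congr_fun measurableSet_Ioc fun u hu => ?_
  simp only [hF]
  rw [derivOnSegment_eq, hp m _ _ (segSpot_pos ω hu) ((minIntVar_pos m).trans_le (h2 u hu)),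
    segVar, h1, segSpot]

end Segment

/-! ### Bounds on the remainder. -/

section Remainder

variable {Ω : Type*} [MeasurableSpace Ω] {Q : Measure Ω} {m : Market} {a b ρ : ℝ}
  {Z : ℝ≥0 → Ω → ℝ} {V : ℝ → Ω → ℝ}

lemma IsIGOU.abs_priceFactor_sub_one_le_exp [IsProbabilityMeasure Q] (h : IsIGOU Q m a b Z V)
    (hρ : ρ ≤ 0) : ∀ᵐ ω ∂Q, |priceFactor Q m ρ Z ω - 1| ≤
      Real.exp (-(m.lam * m.T * kappa Q ρ Z)) + 1 := by
  filter_upwards [h.subordinator.nonneg] with ω hω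
  have h1 : priceFactor Q m ρ Z ω ≤ Real.exp (-(m.lam * m.T * kappa Q ρ Z)) := by
    refine Real.exp_le_exp.2 ?_
    nlinarith [hω (m.lam * m.T).toNNReal]
  have h2 : 0 < priceFactor Q m ρ Z ω := Real.exp_pos _
  rw [abs_le]
  constructor <;> linarith

/-- Since `ρ Z ≤ 0`, the price factor is bounded, and so is the segment integral; only a power of
the centered variance remains. -/
lemma IsIGOU.integrable_remainderIntegrand [IsProbabilityMeasure Q] (h : IsIGOU Q m a b Z V)
    (hρ : ρ ≤ 0) {N n : ℕ} (hN : 1 ≤ N) (hn : n ≤ N + 1) :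
    Integrable (remainderIntegrand Q m ρ Z V N n) Q := by
  have hP := measurable_priceFactor (Q := Q) (m := m) (ρ := ρ) h.subordinator.measurable
  have hPm : AEStronglyMeasurable (fun ω => (priceFactor Q m ρ Z ω - 1) ^ (N + 1 - n)) Q :=
    ((hP.sub_const 1).pow_const _).aestronglyMeasurable
  have hS := h.aestronglyMeasurable_segIntegral (ρ := ρ) N (i := N + 1 - n) (j := n) (by omega)
  have hX := h.integrable_centeredVar_pow n
  refine (hX.norm.const_mul ((Real.exp (-(m.lam * m.T * kappa Q ρ Z)) + 1) ^ (N + 1 - n) *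
    (averageConst (N + 1 - n) n m / (N + 1)))).mono'
      ((hPm.mul hX.aestronglyMeasurable).mul hS) ?_
  filter_upwards [h.abs_priceFactor_sub_one_le_exp hρ, h.abs_segIntegral_le_averageConst (ρ := ρ)
    (N := N) (i := N + 1 - n) (j := n) (by omega) hN] with ω h1 h2
  rw [remainderIntegrand_eq, norm_mul, norm_mul, norm_pow, Real.norm_eq_abs,
    Real.norm_eq_abs (segIntegral _ _ _ _ _ _ _ _ _)]
  calc _ ≤ (Real.exp (-(m.lam * m.T * kappa Q ρ Z)) + 1) ^ (N + 1 - n) *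
        ‖centeredVar Q m V ω ^ n‖ * (averageConst (N + 1 - n) n m / (N + 1)) := by gcongr
    _ = _ := by ring

/-- Bound for one expectation in the remainder by the Cauchy-Schwarz inequality. -/
lemma IsIGOU.abs_integral_remainderIntegrand_le [IsProbabilityMeasure Q]
    (h : IsIGOU Q m a b Z V) (hρ : ρ ≤ 0) {N n : ℕ} {c : ℝ}
    (hc : ∀ᵐ ω ∂Q, |segIntegral Q m ρ Z V N (N + 1 - n) n ω| ≤ c / (N + 1)) :
    |∫ ω, remainderIntegrand Q m ρ Z V N n ω ∂Q| ≤
      c / (N + 1) * √((∫ ω, (priceFactor Q m ρ Z ω - 1) ^ (2 * (N + 1 - n)) ∂Q) *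
        ∫ ω, centeredVar Q m V ω ^ (2 * n) ∂Q) := by
  have hP := measurable_priceFactor (Q := Q) (m := m) (ρ := ρ) h.subordinator.measurable
  have hPi := h.integrable_priceFactor_sub_one_pow hρ
  have hXi := h.integrable_centeredVar_pow
  -- No sign of `c` is assumed: it bounds an absolute value almost surely under a probability
  -- measure.
  have hc0 : 0 ≤ c / (N + 1) := by
    obtain ⟨ω, hω⟩ := hc.exists
    exact (abs_nonneg _).trans hω
  have hPm : AEStronglyMeasurable (fun ω => (priceFactor Q m ρ Z ω - 1) ^ (N + 1 - n)) Q :=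
    (hPi _).aestronglyMeasurable
  have hcs := integral_abs_mul_abs_le_sqrt (μ := Q)
    (f := fun ω => (priceFactor Q m ρ Z ω - 1) ^ (N + 1 - n))
    (g := fun ω => centeredVar Q m V ω ^ n) hPm (hXi n).aestronglyMeasurable
    (by simpa only [← pow_mul] using hPi _) (by simpa only [← pow_mul] using hXi _)
  simp only [← pow_mul] at hcs
  rw [mul_comm 2, mul_comm 2]
  refine le_trans ?_ (mul_le_mul_of_nonneg_left hcs hc0)
  rw [← integral_const_mul, ← Real.norm_eq_abs]
  have hint : Integrable (fun ω => |(priceFactor Q m ρ Z ω - 1) ^ (N + 1 - n)| *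
      |centeredVar Q m V ω ^ n|) Q := by
    have h1 := ((memLp_two_iff_integrable_sq hPm).2
      (by simpa only [← pow_mul] using hPi _)).integrable_mul
      ((memLp_two_iff_integrable_sq (hXi n).aestronglyMeasurable).2
        (by simpa only [← pow_mul] using hXi _))
    refine h1.abs.congr (ae_of_all _ fun ω => ?_)
    simp [abs_mul]
  refine norm_integral_le_of_norm_le (hint.const_mul _) ?_
  filter_upwards [hc] with ω hω
  rw [remainderIntegrand_eq, norm_mul, norm_mul, mul_comm]
  exact mul_le_mul_of_nonneg_right hω (by positivity)

lemma sqrt_le_sqrt_div_mul_sqrt {p q α β : ℝ} (hα : 0 ≤ α) (hβ : 0 < β)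
    (hp : p ≤ α / β ^ 2 * q) : √p ≤ √α / β * √q := by
  refine (Real.sqrt_le_sqrt hp).trans (le_of_eq ?_)
  rw [Real.sqrt_mul (by positivity), Real.sqrt_div hα, Real.sqrt_sq hβ.le]

lemma sum_range_add_two (f : ℕ → ℝ) (N : ℕ) : ∑ n ∈ Finset.range (N + 2), f n =
    (∑ n ∈ Finset.Icc 1 N, f n) + f (N + 1) + f 0 := by
  rw [Finset.sum_range_succ, Finset.sum_range_succ',
    show Finset.Icc 1 N = Finset.Ico 1 (N + 1) from rfl, Finset.sum_Ico_eq_sum_range, Nat.add_sub_cancel]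
  simp only [add_comm 1]
  ring

/-- The factors `λ` and `1/λ` cancel, and `b^{2(N+1-n)} b^{2n+1} = (b^{N+1})² b`, which leaves the
single `1/b` under the root of the mixed terms. -/
lemma IsIGOU.moment_product_le [IsProbabilityMeasure Q] (h : IsIGOU Q m a b Z V) (hρ : ρ ≤ 0)
    {N n : ℕ} (h1 : 1 ≤ n) (hn : n ≤ N) :
    (∫ ω, (priceFactor Q m ρ Z ω - 1) ^ (2 * (N + 1 - n)) ∂Q) *
        ∫ ω, centeredVar Q m V ω ^ (2 * n) ∂Q ≤
      a * m.T / (b ^ (N + 1)) ^ 2 * (a * m.T * |ρ| / b *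
        evalG (polyG (2 * N + 2 - 2 * n)) m a b ρ (kappa Q ρ Z) * evalF (polyF (2 * n)) m a b) := by
  have ha := h.a_pos
  have hb := h.b_pos
  have hl := m.lam_pos
  have hT := m.T_pos
  have hp := h.integral_priceFactor_sub_one_pow_le hρ (k := N + 1 - n) (by omega)
  have hx := (le_abs_self _).trans
    (h.abs_integral_centeredVar_pow_le_evalF (n := 2 * n) (e := 0) (by norm_num) (by omega))
  have hg := evalG_polyG_nonneg m ha hb ρ (kappa Q ρ Z) (2 * (N + 1 - n))
  have hx0 : 0 ≤ ∫ ω, centeredVar Q m V ω ^ (2 * n) ∂Q :=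
    integral_nonneg fun ω => by rw [pow_mul]; positivity
  refine (mul_le_mul hp hx hx0 (by positivity)).trans (le_of_eq ?_)
  rw [show 2 * N + 2 - 2 * n = 2 * (N + 1 - n) by omega]
  have e : b ^ (2 * (N + 1 - n)) * b ^ (2 * n + 1 + 0) = (b ^ (N + 1)) ^ 2 * b := by
    rw [← pow_add, ← pow_mul, ← pow_succ]; congr 1; omega
  set G := evalG (polyG (2 * (N + 1 - n))) m a b ρ (kappa Q ρ Z)
  set F := evalF (polyF (2 * n)) m a b
  calc _ = a * m.T * (a * m.T * |ρ|) * G * F / (b ^ (2 * (N + 1 - n)) * b ^ (2 * n + 1 + 0)) := by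
        field_simp
    _ = _ := by rw [e]; field_simp

/-- The error bound for constants that bound the integrals over the segment. -/
lemma IsIGOU.abs_remainder_le [IsProbabilityMeasure Q] (h : IsIGOU Q m a b Z V) (hρ : ρ ≤ 0)
    {N : ℕ} (hN : 2 ≤ N) {M : ℕ → ℕ → ℝ}
    (hM : ∀ n ≤ N + 1, ∀ᵐ ω ∂Q,
      |segIntegral Q m ρ Z V N (N + 1 - n) n ω| ≤ M (N + 1 - n) n / (N + 1)) :
    |remainder Q m ρ Z V N| ≤ errorBound polyF polyG M m a b ρ (kappa Q ρ Z) N := by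
  have ha := h.a_pos
  have hb := h.b_pos
  have hl := m.lam_pos
  have hT := m.T_pos
  have hS := m.S₀_pos
  have hM0 : ∀ n ≤ N + 1, 0 ≤ M (N + 1 - n) n / (N + 1) := fun n hn => by
    obtain ⟨ω, hω⟩ := (hM n hn).exists
    exact (abs_nonneg _).trans hω
  have haT : 0 ≤ a * m.T := by positivity
  have hbN : 0 < b ^ (N + 1) := by positivity
  set κ := kappa Q ρ Z
  -- The square root in `errorBound` belonging to index `n`: pure price term, pure variance term,
  -- mixed terms.
  set W : ℕ → ℝ := fun n => if n = 0 then √(m.lam * |ρ| * evalG (polyG (2 * N + 2)) m a b ρ κ)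
    else if n = N + 1 then √(1 / (b ^ 2 * m.lam) * evalF (polyF (2 * N + 2)) m a b)
    else √(a * m.T * |ρ| / b * evalG (polyG (2 * N + 2 - 2 * n)) m a b ρ κ *
      evalF (polyF (2 * n)) m a b) with hW
  have hterm : ∀ n ∈ Finset.range (N + 2), |∫ ω, remainderIntegrand Q m ρ Z V N n ω ∂Q| ≤
      M (N + 1 - n) n / (N + 1) * (√(a * m.T) / b ^ (N + 1) * W n) := by
    intro n hn
    have hn : n ≤ N + 1 := by have := Finset.mem_range.1 hn; omega
    refine (h.abs_integral_remainderIntegrand_le hρ (hM n hn)).trans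
      (mul_le_mul_of_nonneg_left ?_ (hM0 n hn))
    rcases Nat.eq_zero_or_pos n with rfl | hn0
    · simp only [hW, if_true]
      refine sqrt_le_sqrt_div_mul_sqrt haT hbN ?_
      have hp := h.integral_priceFactor_sub_one_pow_le hρ (k := N + 1) (by omega)
      simp only [tsub_zero, mul_zero, pow_zero, integral_const, probReal_univ, one_smul, mul_one]
      refine hp.trans (le_of_eq ?_)
      rw [← pow_mul, mul_comm (N + 1) 2, show 2 * (N + 1) = 2 * N + 2 by ring]
      field_simp
      rfl
    rcases hn.eq_or_lt with rfl | hlt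
    · simp only [hW, if_neg (Nat.succ_ne_zero N), if_true]
      refine sqrt_le_sqrt_div_mul_sqrt haT hbN ?_
      -- The refined moment bound `e = 1`, available as `2(N+1) ≥ 3`, produces the `1/b²` under this
      -- root.
      have hx := (le_abs_self _).trans (h.abs_integral_centeredVar_pow_le_evalF
        (n := 2 * (N + 1)) (e := 1) (by norm_num) (by omega))
      simp only [tsub_self, mul_zero, pow_zero, integral_const, probReal_univ, one_smul, one_mul]
      refine hx.trans (le_of_eq ?_)
      rw [← pow_mul, mul_comm (N + 1) 2, show 2 * (N + 1) + 1 + 1 = (2 * N + 2) + 2 by ring,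
        show 2 * (N + 1) = 2 * N + 2 by ring, pow_add b (2 * N + 2) 2]
      field_simp
    · simp only [hW, if_neg hn0.ne', if_neg hlt.ne]
      exact sqrt_le_sqrt_div_mul_sqrt haT hbN (h.moment_product_le hρ hn0 (by omega))
  have hsum : |remainder Q m ρ Z V N| ≤ 1 / (N ! : ℝ) * ∑ n ∈ Finset.range (N + 2),
      ((N + 1).choose n : ℝ) * m.S₀ ^ (N + 1 - n) *
        (M (N + 1 - n) n / (N + 1) * (√(a * m.T) / b ^ (N + 1) * W n)) := by
    rw [remainder, abs_mul, abs_of_nonneg (by positivity : (0 : ℝ) ≤ 1 / (N ! : ℝ))]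
    refine mul_le_mul_of_nonneg_left ?_ (by positivity)
    refine (Finset.abs_sum_le_sum_abs _ _).trans (Finset.sum_le_sum fun n hn => ?_)
    rw [abs_mul, abs_of_nonneg (by positivity :
      (0 : ℝ) ≤ ((N + 1).choose n : ℝ) * m.S₀ ^ (N + 1 - n))]
    exact mul_le_mul_of_nonneg_left (hterm n hn) (by positivity)
  refine hsum.trans (le_of_eq ?_)
  have e1 : ∀ n, ((N + 1).choose n : ℝ) * m.S₀ ^ (N + 1 - n) *
      (M (N + 1 - n) n / (N + 1) * (√(a * m.T) / b ^ (N + 1) * W n)) =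
      √(a * m.T) / b ^ (N + 1) / (N + 1) *
        (((N + 1).choose n : ℝ) * m.S₀ ^ (N + 1 - n) * M (N + 1 - n) n * W n) := fun n => by ring
  simp only [e1]
  rw [← Finset.mul_sum, sum_range_add_two, errorBound]
  have e2 : ∑ n ∈ Finset.Icc 1 N, ((N + 1).choose n : ℝ) * m.S₀ ^ (N + 1 - n) *
      M (N + 1 - n) n * W n = ∑ n ∈ Finset.Icc 1 N, ((N + 1).choose n : ℝ) *
        m.S₀ ^ (N + 1 - n) * M (N + 1 - n) n * √(a * m.T * |ρ| / b *
          evalG (polyG (2 * N + 2 - 2 * n)) m a b ρ κ * evalF (polyF (2 * n)) m a b) := by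
    refine Finset.sum_congr rfl fun n hn => ?_
    have hn := Finset.mem_Icc.1 hn
    simp only [hW, if_neg (show n ≠ 0 by omega), if_neg (show n ≠ N + 1 by omega)]
  rw [e2]
  simp only [hW, if_true, if_neg (Nat.succ_ne_zero N), Nat.choose_self, Nat.choose_zero_right,
    tsub_self, tsub_zero, pow_zero, Nat.cast_one, one_mul, mul_one, Nat.factorial_succ,
    Nat.cast_mul]
  push_cast
  field_simp

/-- As `P_T = 1`, only the term `n = N + 1` survives. It is bounded by the absolute moment of order
`N + 1` itself, without the Cauchy-Schwarz inequality. -/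
lemma IsIGOU.abs_remainder_le_of_zero [IsProbabilityMeasure Q] (h : IsIGOU Q m a b Z V)
    {N : ℕ} (hN : 2 ≤ N) {c : ℝ} (hc : SupBound Q m 0 Z V 0 (N + 1) c) :
    |remainder Q m 0 Z V N| ≤ errorBoundZero polyF c m a b N := by
  have hD := abs_segIntegral_le_of_supBound (N := N) hc
  have hc0 : 0 ≤ c / (N + 1) := by
    obtain ⟨ω, hω⟩ := hD.exists
    exact (abs_nonneg _).trans hω
  have hXi : Integrable (fun ω => |centeredVar Q m V ω| ^ (N + 1)) Q := by
    simpa only [abs_pow] using (h.integrable_centeredVar_pow (N + 1)).abs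
  have hz : ∀ n ∈ Finset.range (N + 1), ((N + 1).choose n : ℝ) * m.S₀ ^ (N + 1 - n) *
      ∫ ω, remainderIntegrand Q m 0 Z V N n ω ∂Q = 0 := by
    intro n hn
    have hn : N + 1 - n ≠ 0 := by have := Finset.mem_range.1 hn; omega
    simp [remainderIntegrand_eq, priceFactor_zero, hn]
  have hb : |∫ ω, remainderIntegrand Q m 0 Z V N (N + 1) ω ∂Q| ≤
      c / (N + 1) * ∫ ω, |centeredVar Q m V ω| ^ (N + 1) ∂Q := by
    rw [← integral_const_mul, ← Real.norm_eq_abs]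
    refine norm_integral_le_of_norm_le (hXi.const_mul _) ?_
    filter_upwards [hD] with ω hω
    rw [remainderIntegrand_eq, tsub_self, pow_zero, one_mul, norm_mul, norm_pow, mul_comm]
    exact mul_le_mul_of_nonneg_right hω (by positivity)
  rw [remainder, Finset.sum_range_succ, Finset.sum_eq_zero hz, zero_add, abs_mul,
    abs_of_nonneg (by positivity : (0 : ℝ) ≤ 1 / (N ! : ℝ))]
  simp only [Nat.choose_self, Nat.cast_one, tsub_self, pow_zero, one_mul]
  calc _ ≤ 1 / (N ! : ℝ) * (c / (N + 1) *
        (a * m.T / (m.lam * b ^ (N + 1 + 1)) * evalF (polyF (N + 1)) m a b)) := by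
        refine mul_le_mul_of_nonneg_left (hb.trans (mul_le_mul_of_nonneg_left ?_ hc0))
          (by positivity)
        exact h.integral_abs_centeredVar_pow_le (by omega)
    _ = _ := by
        rw [errorBoundZero, Nat.factorial_succ]
        push_cast
        field_simp

end Remainder

/-! ### Orders in `1/b`. -/

section Order

/-- The polynomials have non-negative coefficients, so they increase in `1/b` and in `e^{-λTκ}`.
Their values at `b₀` and `κ₀` dominate, and only the prefactor `b^{-(N+1)}` keeps its dependence on
`b`. -/
lemma errorBound_le (m : Market) {a b b₀ κ κ₀ : ℝ} (ha : 0 < a) (hb₀ : 0 < b₀) (hb : b₀ ≤ b)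
    (hκ : κ₀ ≤ κ) (ρ : ℝ) (N : ℕ) {M : ℕ → ℕ → ℝ} (hM : ∀ i j, 0 ≤ M i j) :
    errorBound polyF polyG M m a b ρ κ N ≤
      b₀ ^ (N + 1) * errorBound polyF polyG M m a b₀ ρ κ₀ N / b ^ (N + 1) := by
  have hb' : 0 < b := hb₀.trans_le hb
  have hl := m.lam_pos
  have hT := m.T_pos
  have hS := m.S₀_pos
  have hf := evalF_polyF_anti m ha hb₀ hb
  have hg := evalG_polyG_anti m ha hb₀ hb hκ ρ
  have hf0 := evalF_polyF_nonneg m ha hb'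
  have hg0 := evalG_polyG_nonneg m ha hb' ρ κ
  have hg1 := evalG_polyG_nonneg m ha hb₀ ρ κ₀
  have e : ∀ s : ℝ, b₀ ^ (N + 1) * (√(a * m.T) / (b₀ ^ (N + 1) * ((N + 1)! : ℝ)) * s) /
      b ^ (N + 1) = √(a * m.T) / (b ^ (N + 1) * ((N + 1)! : ℝ)) * s := fun s => by field_simp
  rw [errorBound, errorBound, e]
  refine mul_le_mul_of_nonneg_left ?_ (by positivity)
  refine add_le_add (add_le_add (Finset.sum_le_sum fun n _ => ?_) ?_) ?_
  · refine mul_le_mul_of_nonneg_left (Real.sqrt_le_sqrt ?_)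
      (mul_nonneg (by positivity) (hM _ _))
    exact mul_le_mul (mul_le_mul (by gcongr) (hg _) (hg0 _) (by positivity)) (hf _) (hf0 _)
      (mul_nonneg (by positivity) (hg1 _))
  · refine mul_le_mul_of_nonneg_left (Real.sqrt_le_sqrt ?_) (hM _ _)
    exact mul_le_mul (by gcongr) (hf _) (hf0 _) (by positivity)
  · refine mul_le_mul_of_nonneg_left (Real.sqrt_le_sqrt ?_)
      (mul_nonneg (by positivity) (hM _ _))
    exact mul_le_mul_of_nonneg_left (hg _) (by positivity)

lemma errorBoundZero_le (m : Market) {a b b₀ : ℝ} (ha : 0 < a) (hb₀ : 0 < b₀) (hb : b₀ ≤ b)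
    (N : ℕ) {c : ℝ} (hc : 0 ≤ c) : errorBoundZero polyF c m a b N ≤
      b₀ ^ (N + 2) * errorBoundZero polyF c m a b₀ N / b ^ (N + 2) := by
  have hb' : 0 < b := hb₀.trans_le hb
  have hl := m.lam_pos
  have hT := m.T_pos
  have hf := evalF_polyF_anti m ha hb₀ hb (N + 1)
  have e : ∀ s : ℝ, b₀ ^ (N + 2) *
      (1 / ((N + 1)! : ℝ) * (a * m.T / (m.lam * b₀ ^ (N + 2))) * s * c) / b ^ (N + 2) =
      1 / ((N + 1)! : ℝ) * (a * m.T / (m.lam * b ^ (N + 2))) * s * c := fun s => by field_simp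
  rw [errorBoundZero, errorBoundZero, e]
  gcongr

end Order

end BNS

/-! ### Assembly of the theorem. -/

theorem mainTheorem11 :
    -- polynomials `f n`, `g n` with non-negative coefficients, and constants `M i j` that depend
    -- on the market parameters but not on `a`, `b`, `ρ`
    ∃ (f : ℕ → MvPolynomial (Fin 4) ℝ) (g : ℕ → MvPolynomial (Fin 6) ℝ)
      (M : ℕ → ℕ → BNS.Market → ℝ),
      (∀ n d, 0 ≤ (f n).coeff d) ∧ (∀ n d, 0 ≤ (g n).coeff d) ∧ (∀ i j m, 0 ≤ M i j m) ∧
      (∀ (Ω : Type*) [MeasurableSpace Ω] (Q : Measure Ω) [IsProbabilityMeasure Q]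
        (m : BNS.Market) (a b ρ : ℝ) (Z : ℝ≥0 → Ω → ℝ) (V : ℝ → Ω → ℝ),
        BNS.IsIGOU Q m a b Z V → ρ ≤ 0 →
        -- the moment bounds that `f` and `g` satisfy
        (∀ n : ℕ, 1 ≤ n →
          Integrable (fun ω => (BNS.intVar m V ω - BNS.meanIntVar Q m V) ^ n) Q ∧
          |∫ ω, (BNS.intVar m V ω - BNS.meanIntVar Q m V) ^ n ∂Q|
            ≤ a * m.T / (m.lam * b ^ (n + 1)) * BNS.evalF (f n) m a b ∧
          Integrable (fun ω => BNS.gVar Q m ρ Z ω ^ n) Q ∧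
          ∫ ω, BNS.gVar Q m ρ Z ω ^ n ∂Q
            ≤ a * m.lam * m.T * |ρ| / b ^ n *
              BNS.evalG (g n) m a b ρ (BNS.kappa Q ρ Z)) ∧
        ∀ N : ℕ, 2 ≤ N →
          -- the expectations in `R_N` exist
          (∀ n ≤ N + 1, Integrable (BNS.remainderIntegrand Q m ρ Z V N n) Q) ∧
          -- the bound with any constants that dominate the derivatives on the whole segment
          (∀ M' : ℕ → ℕ → ℝ,
            (∀ n ≤ N + 1, BNS.SupBound Q m ρ Z V (N + 1 - n) n (M' (N + 1 - n) n)) →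
            |BNS.remainder Q m ρ Z V N|
              ≤ BNS.errorBound f g M' m a b ρ (BNS.kappa Q ρ Z) N) ∧
          -- the bound with the finite constants `M`
          (∀ n ≤ N + 1, BNS.AverageBound Q m ρ Z V (N + 1 - n) n (M (N + 1 - n) n m)) ∧
          |BNS.remainder Q m ρ Z V N|
            ≤ BNS.errorBound f g (fun i j => M i j m) m a b ρ (BNS.kappa Q ρ Z) N ∧
          -- the case `ρ = 0`
          (ρ = 0 →
            (∀ n ≤ N + 1, BNS.SupBound Q m ρ Z V (N + 1 - n) n (M (N + 1 - n) n m)) ∧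
            ∀ c : ℝ, BNS.SupBound Q m ρ Z V 0 (N + 1) c →
              |BNS.remainder Q m ρ Z V N| ≤ BNS.errorBoundZero f c m a b N)) ∧
      -- the orders in `1 / b`, with all other parameters fixed
      (∀ (m : BNS.Market) (a ρ b₀ : ℝ) (N : ℕ), 0 < a → ρ ≤ 0 → 0 < b₀ → 2 ≤ N →
        ∃ C : ℝ, ∀ (Ω : Type*) [MeasurableSpace Ω] (Q : Measure Ω) [IsProbabilityMeasure Q]
          (b : ℝ) (Z : ℝ≥0 → Ω → ℝ) (V : ℝ → Ω → ℝ),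
          BNS.IsIGOU Q m a b Z V → b₀ ≤ b →
          |BNS.remainder Q m ρ Z V N| ≤ C / b ^ (N + 1) ∧
          (ρ = 0 → |BNS.remainder Q m ρ Z V N| ≤ C / b ^ (N + 2))) := by
  refine ⟨BNS.polyF, BNS.polyG, BNS.averageConst, BNS.coeff_polyF_nonneg, BNS.coeff_polyG_nonneg,
    BNS.averageConst_nonneg, ?_, ?_⟩
  · intro Ω _ Q _ m a b ρ Z V h hρ
    refine ⟨fun n hn => ⟨h.integrable_centeredVar_pow n,
      h.abs_integral_centeredVar_pow_le_evalF (e := 0) (by norm_num) hn,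
      h.integrable_gVar_pow n, h.integral_gVar_pow_le hρ hn⟩, fun N hN => ?_⟩
    have hav : ∀ n ≤ N + 1, ∀ᵐ ω ∂Q, |BNS.segIntegral Q m ρ Z V N (N + 1 - n) n ω| ≤
        BNS.averageConst (N + 1 - n) n m / (N + 1) := fun n hn =>
      h.abs_segIntegral_le_averageConst (by omega) (by omega)
    refine ⟨fun n hn => h.integrable_remainderIntegrand hρ (by omega) hn,
      fun M' hM' => h.abs_remainder_le hρ hN fun n hn =>
        BNS.abs_segIntegral_le_of_supBound (hM' n hn),
      fun n hn => h.averageBound (by omega),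
      h.abs_remainder_le (M := fun i j => BNS.averageConst i j m) hρ hN hav, ?_⟩
    rintro rfl
    exact ⟨fun n hn => h.supBound_zero (by omega), fun c hc => h.abs_remainder_le_of_zero hN hc⟩
  · intro m a ρ b₀ N ha hρ hb₀ hN
    -- One constant serves both orders: the maximum of the two error bounds at `b₀`, rescaled by
    -- powers of `b₀`.
    refine ⟨max (b₀ ^ (N + 1) * BNS.errorBound BNS.polyF BNS.polyG
        (fun i j => BNS.averageConst i j m) m a b₀ ρ (-(a * |ρ| / b₀)) N)
      (b₀ ^ (N + 2) * BNS.errorBoundZero BNS.polyF (BNS.averageConst 0 (N + 1) m) m a b₀ N), ?_⟩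
    intro Ω _ Q _ b Z V h hb
    have hb' := h.b_pos
    -- `κ(ρ)` varies with `b`, so a lower bound that is uniform in `b ≥ b₀` takes its place in the
    -- constant.
    have hκ : -(a * |ρ| / b₀) ≤ BNS.kappa Q ρ Z := by
      have h1 := (BNS.driverCgf_bounds ha hb' hρ).2
      have h2 : a * |ρ| / b ≤ a * |ρ| / b₀ := by gcongr
      rw [h.kappa_eq hρ]
      linarith
    constructor
    · refine (h.abs_remainder_le (M := fun i j => BNS.averageConst i j m) hρ hN fun n hn =>
        h.abs_segIntegral_le_averageConst (by omega) (by omega)).trans ?_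
      refine (BNS.errorBound_le m ha hb₀ hb hκ ρ N
        fun i j => BNS.averageConst_nonneg i j m).trans ?_
      gcongr
      exact le_max_left _ _
    · rintro rfl
      refine (h.abs_remainder_le_of_zero hN (h.supBound_zero (by omega))).trans ?_
      refine (BNS.errorBoundZero_le m ha hb₀ hb N (BNS.averageConst_nonneg _ _ m)).trans ?_
      gcongr
      exact le_max_right _ _
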